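/- Let $M$ be a smooth manifold (finite-dimensional, Hausdorff, second countable, without boundary) with a Riemannian metric $g$. Let $A\to M$ be a Lie algebroid, i.e. a smooth vector bundle of finite rank with a smooth bundle map $\rho\colon A\to TM$ and a Lie bracket on $\Gamma(A)$ such that $[s,fs']=f[s,s']+(\rho(s)f)\,s'$. Let $\nabla$ be a connection on $A$ such that $(A,\nabla,g)$ is a Killing Lie algebroid, i.e. ${}^\tau\nabla g=0$, where ${}^\tau\nabla_s X=[\rho(s),X]+\rho(\nabla_X s)$ for $s\in\Gamma(A)$ and $X\in\Gamma(TM)$. An $A$-path is a smooth path $a\colon[0,1]\to A$ over a path $x\colon[0,1]\to M$ with $\dot x=\rho(a)$; the orbits of $A$ are the classes of points of $M$ that can be joined by finitely many consecutive $A$-paths. Then the orbits of $A$ are the leaves of a (possibly singular) Riemannian foliation of $(M,g)$. That is: (1) The orbits form a partition of $M$ and carry structures of connected (injectively) immersed submanifolds of $M$ (Hausdorff and second countable), with tangent space $\rho(A_p)$ at each point $p$. Every vector tangent to an orbit is the value of a smooth vector field on $M$ that is everywhere tangent to the orbits. (2) If a geodesic of $(M,g)$ (defined on an open interval) is orthogonal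 at one point to the orbit through that point, then it is orthogonal to every orbit that it meets. (3) Every orbit carries the smooth Riemannian metric induced by $g$, i.e. its pull-back under the inclusion into $M$. -/

import Mathlib

open Bundle Set Function
open scoped Manifold ContDiff Topology

noncomputable section

namespace KillingFoliation

universe u

section LieAlgebroids

variable {E : Type*} [NormedAddCommGroup E] [NormedSpace ℝ E]
  {M : Type*} [TopologicalSpace M] [ChartedSpace E M]
  {F : Type*} [NormedAddCommGroup F] [NormedSpace ℝ F]
  {A : M → Type*} [TopologicalSpace (TotalSpace F A)]
  [∀ x, AddCommGroup (A x)] [∀ x, Module ℝ (A x)] [∀ x, TopologicalSpace (A x)]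
  [∀ x, IsTopologicalAddGroup (A x)] [∀ x, ContinuousSMul ℝ (A x)]
  [FiberBundle F A] [VectorBundle ℝ F A]

/-- The product `f s` of a smooth function `f` and a smooth section `s`. -/
def smulSection (f : C^∞⟮𝓘(ℝ, E), M; 𝓘(ℝ, ℝ), ℝ⟯) (s : Cₛ^∞⟮𝓘(ℝ, E); F, A⟯) :
    Cₛ^∞⟮𝓘(ℝ, E); F, A⟯ :=
  ⟨fun x => f x • s x, f.contMDiff.smul_section s.contMDiff⟩

variable (E F A) in
/-- A Lie algebroid structure on the smooth vector bundle `A → M`: a smooth bundle map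
`ρ : A → TM` (the anchor) and a Lie algebra structure on the space of smooth sections of `A`, with
the Leibniz rule `[s, f t] = f [s, t] + (ρ(s) f) t`. -/
structure LieAlgebroid [IsManifold 𝓘(ℝ, E) 1 M] where
  /-- The anchor. -/
  anchor : ∀ x : M, A x →L[ℝ] TangentSpace 𝓘(ℝ, E) x
  contMDiff_anchor : ContMDiff 𝓘(ℝ, E) (𝓘(ℝ, E).prod 𝓘(ℝ, F →L[ℝ] E)) ∞
    (fun x => TotalSpace.mk' (F →L[ℝ] E)
      (E := fun x : M => A x →L[ℝ] TangentSpace 𝓘(ℝ, E) x) x (anchor x))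
  /-- The bracket of sections. -/
  bracket : Cₛ^∞⟮𝓘(ℝ, E); F, A⟯ → Cₛ^∞⟮𝓘(ℝ, E); F, A⟯ → Cₛ^∞⟮𝓘(ℝ, E); F, A⟯
  bracket_add : ∀ s t t', bracket s (t + t') = bracket s t + bracket s t'
  bracket_smul : ∀ (c : ℝ) s t, bracket s (c • t) = c • bracket s t
  bracket_skew : ∀ s t, bracket s t = - bracket t s
  jacobi : ∀ s t r,
    bracket s (bracket t r) + bracket t (bracket r s) + bracket r (bracket s t) = 0
  leibniz : ∀ (s t : Cₛ^∞⟮𝓘(ℝ, E); F, A⟯) (f : C^∞⟮𝓘(ℝ, E), M; 𝓘(ℝ, ℝ), ℝ⟯) (x : M),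
    bracket s (smulSection f t) x =
      f x • bracket s t x + (mvfderiv 𝓘(ℝ, E) f x (anchor x (s x))) • t x

variable [IsManifold 𝓘(ℝ, E) 1 M]

/-- An `A`-path: a smooth path `a : [0, 1] → A` such that the base path `π ∘ a` has velocity
`ρ(a(t))` at every time `t`. -/
def LieAlgebroid.IsAPath (𝒜 : LieAlgebroid E F A) (a : ℝ → TotalSpace F A) : Prop :=
  ContMDiffOn 𝓘(ℝ, ℝ) (𝓘(ℝ, E).prod 𝓘(ℝ, F)) ∞ a (Icc 0 1) ∧
  ∀ t ∈ Icc (0 : ℝ) 1,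
    HasMFDerivWithinAt 𝓘(ℝ, ℝ) 𝓘(ℝ, E) (fun t => (a t).proj) (Icc 0 1) t
      ((1 : ℝ →L[ℝ] ℝ).smulRight (𝒜.anchor (a t).proj (a t).2))

/-- The orbit of `A` through `p`: the points that can be joined to `p` by finitely many
consecutive `A`-paths. (`A`-paths can be reversed, so this is an equivalence class.) -/
def LieAlgebroid.orbit (𝒜 : LieAlgebroid E F A) (p : M) : Set M :=
  {q | Relation.ReflTransGen
    (fun x y => ∃ a, 𝒜.IsAPath a ∧ (a 0).proj = x ∧ (a 1).proj = y) p q}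

/-- The `A`-connection `ᵗ∇_s X = [ρ(s), X] + ρ(∇_X s)` on `TM` induced by a connection `∇`
on `A`. -/
def LieAlgebroid.tauConn (𝒜 : LieAlgebroid E F A) (nabla : CovariantDerivative 𝓘(ℝ, E) F A)
    (s : Cₛ^∞⟮𝓘(ℝ, E); F, A⟯)
    (X : Cₛ^∞⟮𝓘(ℝ, E); E, fun x : M => TangentSpace 𝓘(ℝ, E) x⟯) (x : M) :
    TangentSpace 𝓘(ℝ, E) x :=
  VectorField.mlieBracket 𝓘(ℝ, E) (fun y => 𝒜.anchor y (s y)) (fun y => X y) x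
    + 𝒜.anchor x (nabla (fun y => s y) x (X x))

/-- `(A, ∇, g)` is a Killing Lie algebroid: `ᵗ∇ g = 0`, that is,
`ρ(s)(g(X, Y)) = g(ᵗ∇_s X, Y) + g(X, ᵗ∇_s Y)` for all smooth sections `s` and vector fields
`X`, `Y`. -/
def LieAlgebroid.IsKilling (𝒜 : LieAlgebroid E F A)
    (nabla : CovariantDerivative 𝓘(ℝ, E) F A)
    (g : ContMDiffRiemannianMetric 𝓘(ℝ, E) ∞ E (fun x : M => TangentSpace 𝓘(ℝ, E) x)) : Prop :=
  ∀ (s : Cₛ^∞⟮𝓘(ℝ, E); F, A⟯)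
    (X Y : Cₛ^∞⟮𝓘(ℝ, E); E, fun x : M => TangentSpace 𝓘(ℝ, E) x⟯) (x : M),
    mvfderiv 𝓘(ℝ, E) (fun y => g.inner y (X y) (Y y)) x (𝒜.anchor x (s x))
      = g.inner x (𝒜.tauConn nabla s X x) (Y x) + g.inner x (X x) (𝒜.tauConn nabla s Y x)

end LieAlgebroids

section Geodesics

variable {E : Type*} [NormedAddCommGroup E] [NormedSpace ℝ E]
  {M : Type*} [TopologicalSpace M] [ChartedSpace E M] [IsManifold 𝓘(ℝ, E) 1 M]

/-- The metric `g` read in the chart `φ` around `x₀`: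
`G(y)(u, v) = g(d(φ⁻¹)_y u, d(φ⁻¹)_y v)` at the point `φ⁻¹(y)`. -/
def chartMetric
    (g : ContMDiffRiemannianMetric 𝓘(ℝ, E) ∞ E (fun x : M => TangentSpace 𝓘(ℝ, E) x))
    (x₀ : M) (y : E) : E →L[ℝ] E →L[ℝ] ℝ :=
  let D : E →L[ℝ] E := mfderiv 𝓘(ℝ, E) 𝓘(ℝ, E) (extChartAt 𝓘(ℝ, E) x₀).symm y
  let B : E →L[ℝ] E →L[ℝ] ℝ := g.inner ((extChartAt 𝓘(ℝ, E) x₀).symm y)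
  B.bilinearComp D D

/-- The Christoffel symbols of the first kind of the Levi-Civita connection of `g` in the chart
around `x₀`: `Γ(u, v; w) = ½ (∂_u G(v, w) + ∂_v G(u, w) - ∂_w G(u, v)) = G(∇_u v, w)` for
constant `u`, `v`, `w`. -/
def christoffel
    (g : ContMDiffRiemannianMetric 𝓘(ℝ, E) ∞ E (fun x : M => TangentSpace 𝓘(ℝ, E) x))
    (x₀ : M) (y u v w : E) : ℝ :=
  (fderiv ℝ (chartMetric g x₀) y u v w + fderiv ℝ (chartMetric g x₀) y v u w
    - fderiv ℝ (chartMetric g x₀) y w u v) / 2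

/-- `γ` is a geodesic of `g` on the open set `J` of times (in practice an interval): it is `C²` on
`J`, and its representative `c` in every chart satisfies the geodesic equation
`∇_ċ ċ = 0` for the Levi-Civita connection, i.e. `G(c̈, w) + Γ(ċ, ċ; w) = 0` for all `w`. -/
def IsGeodesicOn
    (g : ContMDiffRiemannianMetric 𝓘(ℝ, E) ∞ E (fun x : M => TangentSpace 𝓘(ℝ, E) x))
    (γ : ℝ → M) (J : Set ℝ) : Prop :=
  ContMDiffOn 𝓘(ℝ, ℝ) 𝓘(ℝ, E) 2 γ J ∧
  ∀ (x₀ : M), ∀ t ∈ J, γ t ∈ (chartAt E x₀).source →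
    let c : ℝ → E := fun r => extChartAt 𝓘(ℝ, E) x₀ (γ r)
    ∀ w : E, chartMetric g x₀ (c t) (deriv (deriv c) t) w
      + christoffel g x₀ (c t) (deriv c t) (deriv c t) w = 0

/-- The velocity of a curve. -/
def velocity (γ : ℝ → M) (t : ℝ) : TangentSpace 𝓘(ℝ, E) (γ t) :=
  mfderiv 𝓘(ℝ, ℝ) 𝓘(ℝ, E) γ t (1 : ℝ)

end Geodesics

section Foliations

variable (E : Type*) [NormedAddCommGroup E] [NormedSpace ℝ E]
  (M : Type u) [TopologicalSpace M] [ChartedSpace E M]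

/-- A connected immersed submanifold of `M`, given as a connected smooth manifold (Hausdorff,
second countable) together with an injective immersion into `M`. -/
structure ConnectedImmersedSubmanifold where
  /-- The dimension. -/
  dim : ℕ
  /-- The underlying manifold, whose topology may be finer than the subspace topology. -/
  carrier : Type u
  [topologicalSpace : TopologicalSpace carrier]
  [chartedSpace : ChartedSpace (EuclideanSpace ℝ (Fin dim)) carrier]
  [isManifold : IsManifold (𝓡 dim) ∞ carrier]
  [t2Space : T2Space carrier]
  [secondCountableTopology : SecondCountableTopology carrier]
  [connectedSpace : ConnectedSpace carrier]
  /-- The inclusion into `M`. -/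
  incl : carrier → M
  contMDiff_incl : ContMDiff (𝓡 dim) 𝓘(ℝ, E) ∞ incl
  injective_incl : Injective incl
  injective_mfderiv_incl : ∀ x, Injective (mfderiv (𝓡 dim) 𝓘(ℝ, E) incl x)

attribute [instance] ConnectedImmersedSubmanifold.topologicalSpace
attribute [instance] ConnectedImmersedSubmanifold.chartedSpace
attribute [instance] ConnectedImmersedSubmanifold.isManifold
attribute [instance] ConnectedImmersedSubmanifold.t2Space
attribute [instance] ConnectedImmersedSubmanifold.secondCountableTopology
attribute [instance] ConnectedImmersedSubmanifold.connectedSpace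

/-- The vectors tangent to a family of immersed submanifolds, as a subset of `TM`. -/
def tangentVectors {ι : Type*} (leaf : ι → ConnectedImmersedSubmanifold E M) :
    Set (TangentBundle 𝓘(ℝ, E) M) :=
  ⋃ i, range (tangentMap (𝓡 (leaf i).dim) 𝓘(ℝ, E) (leaf i).incl)

/-- A (possibly singular) foliation of `M`: a partition of `M` into connected immersed
submanifolds (the leaves), such that every vector tangent to a leaf is the value of a smooth vector
field on `M` that is everywhere tangent to the leaves. -/
structure SingularFoliation [IsManifold 𝓘(ℝ, E) 1 M] where
  /-- The set of leaves. -/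
  Index : Type u
  /-- The leaves. -/
  leaf : Index → ConnectedImmersedSubmanifold E M
  partition : ∀ p : M, ∃! i, p ∈ range (leaf i).incl
  exists_vectorField : ∀ ξ ∈ tangentVectors E M leaf,
    ∃ X : Cₛ^∞⟮𝓘(ℝ, E); E, fun x : M => TangentSpace 𝓘(ℝ, E) x⟯,
      (∀ p : M, (⟨p, X p⟩ : TangentBundle 𝓘(ℝ, E) M) ∈ tangentVectors E M leaf) ∧
      X ξ.proj = ξ.2

variable {E M} [IsManifold 𝓘(ℝ, E) 1 M]

/-- A vector `v` at `p` is orthogonal to the leaf through `p`. -/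
def SingularFoliation.IsOrthogonal (𝓕 : SingularFoliation E M)
    (g : ContMDiffRiemannianMetric 𝓘(ℝ, E) ∞ E (fun x : M => TangentSpace 𝓘(ℝ, E) x))
    (p : M) (v : TangentSpace 𝓘(ℝ, E) p) : Prop :=
  ∀ w : TangentSpace 𝓘(ℝ, E) p,
    (⟨p, w⟩ : TangentBundle 𝓘(ℝ, E) M) ∈ tangentVectors E M 𝓕.leaf → g.inner p v w = 0

/-- A singular foliation is Riemannian with respect to `g` if every geodesic that is orthogonal to
the leaf through one of its points is orthogonal to every leaf that it meets. -/
def SingularFoliation.IsRiemannian (𝓕 : SingularFoliation E M)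
    (g : ContMDiffRiemannianMetric 𝓘(ℝ, E) ∞ E (fun x : M => TangentSpace 𝓘(ℝ, E) x)) : Prop :=
  ∀ (γ : ℝ → M) (J : Set ℝ), IsOpen J → J.OrdConnected → IsGeodesicOn g γ J →
    ∀ t₀ ∈ J, 𝓕.IsOrthogonal g (γ t₀) (velocity γ t₀) →
      ∀ t ∈ J, 𝓕.IsOrthogonal g (γ t) (velocity γ t)

/-- The Riemannian metric `h` on an immersed submanifold is the one induced by `g`. -/
def IsInducedMetric (N : ConnectedImmersedSubmanifold E M)
    (g : ContMDiffRiemannianMetric 𝓘(ℝ, E) ∞ E (fun x : M => TangentSpace 𝓘(ℝ, E) x))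
    (h : ContMDiffRiemannianMetric (𝓡 N.dim) ∞ (EuclideanSpace ℝ (Fin N.dim))
      (fun x : N.carrier => TangentSpace (𝓡 N.dim) x)) : Prop :=
  ∀ (x : N.carrier) (u v : TangentSpace (𝓡 N.dim) x),
    h.inner x u v = g.inner (N.incl x) (mfderiv (𝓡 N.dim) 𝓘(ℝ, E) N.incl x u)
      (mfderiv (𝓡 N.dim) 𝓘(ℝ, E) N.incl x v)

end Foliations

end KillingFoliation

end

/-!
The orbits are made into immersed submanifolds without assuming that the anchor has constant rank.
In a chart and a trivialization around a point `p` the anchor becomes a smooth family of linear maps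
`ρ(y) : F → E` with `[ρ e, ρ f] = ρ (c(e, f))` for constant `e`, `f`; this relation follows from
the Jacobi identity and the Leibniz rule (`LieAlgebroid.deriv_bracket`,
`LieAlgebroid.exists_involutiveAnchor`). Let `k` be the rank of `ρ` at `p`, and choose
`q : E → ℝᵏ` and `σ : ℝᵏ → F` with `q ρ(p) σ = 1`. Near `p` there is a map
`X(y) = ρ(y) τ(y) : ℝᵏ → E` with `q X(y) = 1`, whose image is a part of the image of `ρ(y)`. The
defect `ψ = (1 - X q) ρ` vanishes exactly where the two images agree. The bracket relation
implies that `ψ` satisfies a homogeneous linear differential equation along curves tangent to the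
image of `ρ` (`fderiv_defect_apply`), so that `ψ = 0` persists along such curves, and that where
`ψ = 0` the total differential equation `DU = X(U)` is integrable (`fderiv_spanMap_symm`). Its
radial solutions therefore assemble to a smooth map `U` on a ball of `ℝᵏ` with `DU = X(U)`
(`TameOnBall.hasFDerivAt_radial`), and `A`-paths that start in the image of `U` remain in it as long
as they remain near `p` (`LeafBall.exists_leaf`).

These images, the plaques, are the charts of the orbits. Changes of charts are smooth because a
plaque is parametrized with a left inverse that is smooth on an open subset of `M`; the leaf
topology is Hausdorff because it is finer than that of `M`, and connected because `A`-paths are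
continuous in it. It is second countable by the theorem of Poincaré and Volterra
(`secondCountableTopology_of_continuous`), since a plaque is relatively closed, in the leaf
topology, in the preimage of an open subset of `M`.

For the Riemannian property let `γ` be a geodesic and `s` a section of `A`. In the chart at `γ(t)`,
the geodesic equation and the Killing equation combine to
`d/dt g(γ', ρ(s)) = g(γ', ρ(∇_{γ'} s))` (`LieAlgebroid.IsKilling.hasDerivAt_inner`). For the
elements `s_i` of a local frame of `A` this is a homogeneous linear system for the functions
`g(γ', ρ(s_i))`. Hence the set of times at which `γ'` is orthogonal to the image of the anchor,
which is the tangent space of the orbit, is open and closed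
(`LieAlgebroid.IsKilling.isRiemannian_orbitFoliation`).
-/

namespace KillingFoliation

-- the normed group of bilinear maps on a space is found only after a long search
set_option synthInstance.maxHeartbeats 200000
-- the sections fix the same hypotheses on the bundle for all of their lemmas
set_option linter.unusedSectionVars false

/-! ### Total differential equations -/

section TotalDifferential

open Metric
open scoped NNReal

variable {H E : Type*} [NormedAddCommGroup H] [NormedSpace ℝ H]
  [NormedAddCommGroup E] [NormedSpace ℝ E]

/-- `X` is smooth on the ball `B(y₀, R)`, and the constant `K` bounds `X` and is a Lipschitz
constant both for `X` and for its derivative. -/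
structure TameOnBall (X : E → H →L[ℝ] E) (y₀ : E) (R : ℝ) (K : ℝ≥0) : Prop where
  pos : 0 < R
  contDiffOn : ContDiffOn ℝ ∞ X (ball y₀ R)
  norm_le : ∀ y ∈ ball y₀ R, ‖X y‖ ≤ K
  lipschitz : LipschitzOnWith K X (ball y₀ R)
  lipschitz_fderiv : LipschitzOnWith K (fderiv ℝ X) (ball y₀ R)

theorem exists_tameOnBall {X : E → H →L[ℝ] E} {y₀ : E}
    (h₄ : ∀ᶠ y in 𝓝 y₀, ContDiffAt ℝ ∞ X y) :
    ∃ R₀ > 0, ∃ K : ℝ≥0, ∀ R, 0 < R → R ≤ R₀ → TameOnBall X y₀ R K := by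
  have hX := h₄.self_of_nhds
  obtain ⟨K₁, s₁, hs₁, h₁⟩ := (hX.of_le (m := 1) (by norm_cast)).exists_lipschitzOnWith
  have hX' : ContDiffAt ℝ 1 (fderiv ℝ X) y₀ :=
    hX.fderiv_right (m := 1) (by norm_cast)
  obtain ⟨K₂, s₂, hs₂, h₂⟩ := hX'.exists_lipschitzOnWith
  have h₃ : ∀ᶠ y in 𝓝 y₀, ‖X y‖ < ‖X y₀‖ + 1 :=
    hX.continuousAt.norm.eventually_lt continuousAt_const (by simp)
  obtain ⟨R₀, hR₀, hball⟩ := Metric.eventually_nhds_iff_ball.1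
    (((Filter.eventually_of_mem hs₁ fun _ h => h).and
      (Filter.eventually_of_mem hs₂ fun _ h => h)).and (h₃.and h₄))
  refine ⟨R₀, hR₀, max (max K₁ K₂) (‖X y₀‖₊ + 1), fun R hR hRR => ?_⟩
  have hsub : ball y₀ R ⊆ ball y₀ R₀ := ball_subset_ball hRR
  refine ⟨hR, fun y hy => (hball y (hsub hy)).2.2.contDiffWithinAt, fun y hy => ?_,
    (h₁.mono fun y hy => (hball y (hsub hy)).1.1).weaken (by simp),
    (h₂.mono fun y hy => (hball y (hsub hy)).1.2).weaken (by simp)⟩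
  refine (hball y (hsub hy)).2.1.le.trans ?_
  simp

/-- Picard–Lindelöf for `y' = X(y) v`, together with the information that the solution stays in
the half ball. -/
theorem TameOnBall.exists_solution [CompleteSpace E] {X : E → H →L[ℝ] E} {y₀ : E} {R : ℝ}
    {K : ℝ≥0} (hX : TameOnBall X y₀ R K) {v : H} (hv : K * ‖v‖ ≤ R / 2) :
    ∃ y : ℝ → E, y 0 = y₀ ∧ ∀ t ∈ Icc (0 : ℝ) 1,
      HasDerivWithinAt y (X (y t) v) (Icc 0 1) t ∧ y t ∈ closedBall y₀ (R / 2) := by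
  have hR := hX.pos
  have hsub : closedBall y₀ (R / 2) ⊆ ball y₀ R := closedBall_subset_ball (by linarith)
  obtain ⟨a, ha⟩ : ∃ a : ℝ≥0, (a : ℝ) = R / 2 := ⟨⟨R / 2, by positivity⟩, rfl⟩
  rw [← ha] at hsub hv ⊢
  have hpl : IsPicardLindelof (fun _ y => X y v) (tmin := 0) (tmax := 1) ⟨0, by simp⟩ y₀
      a 0 (K * ‖v‖₊) (K * ‖v‖₊) := by
    refine ⟨fun t _ => ?_, fun _ _ => continuousOn_const, fun t _ y hy => ?_, ?_⟩
    · refine LipschitzOnWith.of_dist_le_mul fun y hy z hz => ?_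
      have := hX.lipschitz.dist_le_mul y (hsub hy) z (hsub hz)
      rw [dist_eq_norm] at this ⊢
      calc ‖X y v - X z v‖ = ‖(X y - X z) v‖ := by simp
        _ ≤ ‖X y - X z‖ * ‖v‖ := ContinuousLinearMap.le_opNorm _ _
        _ ≤ (K * dist y z) * ‖v‖ := by gcongr
        _ = _ := by push_cast; ring
    · calc ‖X y v‖ ≤ ‖X y‖ * ‖v‖ := ContinuousLinearMap.le_opNorm _ _
        _ ≤ K * ‖v‖ := by gcongr; exact hX.norm_le y (hsub hy)
        _ = _ := by simp
    · simpa using hv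
  have hx : y₀ ∈ closedBall y₀ ((0 : ℝ≥0) : ℝ) := by simp
  obtain ⟨α, hα⟩ := ODE.FunSpace.exists_isFixedPt_next hpl hx
  refine ⟨α.compProj, ?_, fun t ht => ⟨?_, ?_⟩⟩
  · have : α.compProj ((⟨0, by simp⟩ : Icc (0 : ℝ) 1) : ℝ) = y₀ := by
      rw [ODE.FunSpace.compProj_val, ← hα, ODE.FunSpace.next_apply₀]
    simpa using this
  · apply ODE.hasDerivWithinAt_picard_Icc (⟨0, by simp⟩ : Icc (0 : ℝ) 1).2
      hpl.continuousOn_uncurry α.continuous_compProj.continuousOn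
      (fun _ ht' ↦ α.compProj_mem_closedBall hpl.mul_max_le) y₀ ht |>.congr_of_mem _ ht
    intro t' ht'
    nth_rw 1 [← hα]
    rw [ODE.FunSpace.compProj_of_mem ht', ODE.FunSpace.next_apply]
  · exact α.compProj_mem_closedBall hpl.mul_max_le

theorem HasDerivWithinAt.Ici_of_Icc {y : ℝ → E} {y' : E} {t a b : ℝ}
    (h : HasDerivWithinAt y y' (Icc a b) t) (ht : t ∈ Ico a b) :
    HasDerivWithinAt y y' (Ici t) t :=
  h.mono_of_mem_nhdsWithin <| Filter.mem_of_superset (Icc_mem_nhdsGE ht.2)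
    (Icc_subset_Icc_left ht.1)

theorem TameOnBall.lipschitz_apply {X : E → H →L[ℝ] E} {y₀ : E} {R : ℝ}
    {K : ℝ≥0} (hX : TameOnBall X y₀ R K) {v : H} {C : ℝ≥0} (hv : ‖v‖ ≤ C) :
    LipschitzOnWith (K * C) (fun y => X y v) (ball y₀ R) := by
  refine LipschitzOnWith.of_dist_le_mul fun y hy z hz => ?_
  have := hX.lipschitz.dist_le_mul y hy z hz
  rw [dist_eq_norm] at this ⊢
  calc ‖X y v - X z v‖ = ‖(X y - X z) v‖ := by simp
    _ ≤ ‖X y - X z‖ * ‖v‖ := ContinuousLinearMap.le_opNorm _ _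
    _ ≤ (K * dist y z) * C := by gcongr
    _ = _ := by push_cast; ring

/-- Two curves in the ball that solve `y' = X(y) v'(t)` with the same bounded `v'` and the same
initial value agree. -/
theorem TameOnBall.solution_unique {X : E → H →L[ℝ] E} {y₀ : E} {R : ℝ}
    {K : ℝ≥0} (hX : TameOnBall X y₀ R K) {v' : ℝ → H} {C : ℝ}
    (hC : ∀ t ∈ Icc (0 : ℝ) 1, ‖v' t‖ ≤ C) {y z : ℝ → E}
    (hy : ∀ t ∈ Icc (0 : ℝ) 1, HasDerivWithinAt y (X (y t) (v' t)) (Icc 0 1) t)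
    (hz : ∀ t ∈ Icc (0 : ℝ) 1, HasDerivWithinAt z (X (z t) (v' t)) (Icc 0 1) t)
    (hyB : ∀ t ∈ Icc (0 : ℝ) 1, y t ∈ ball y₀ R) (hzB : ∀ t ∈ Icc (0 : ℝ) 1, z t ∈ ball y₀ R)
    (h0 : y 0 = z 0) : EqOn y z (Icc 0 1) := by
  intro t ht
  have := dist_le_of_trajectories_ODE_of_mem (v := fun t y => X y (v' t)) (s := fun _ => ball y₀ R)
    (K := K * C.toNNReal) (δ := 0) (f := y) (g := z) (a := 0) (b := 1)
    (fun t ht => hX.lipschitz_apply ((hC t (Ico_subset_Icc_self ht)).trans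
      C.le_coe_toNNReal))
    (fun t ht => (hy t ht).continuousWithinAt)
    (fun t ht => HasDerivWithinAt.Ici_of_Icc (hy t (Ico_subset_Icc_self ht)) ht)
    (fun t ht => hyB t (Ico_subset_Icc_self ht))
    (fun t ht => (hz t ht).continuousWithinAt)
    (fun t ht => HasDerivWithinAt.Ici_of_Icc (hz t (Ico_subset_Icc_self ht)) ht)
    (fun t ht => hzB t (Ico_subset_Icc_self ht)) (by simp [h0]) t ht
  simpa using this

/-- The radial solutions of `y' = X(y) v` assemble to a single map `U` with
`d/dt U(t v) = X(U(t v)) v`. -/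
theorem TameOnBall.exists_radial [CompleteSpace E] {X : E → H →L[ℝ] E} {y₀ : E} {R : ℝ}
    {K : ℝ≥0} (hX : TameOnBall X y₀ R K) {r : ℝ} (hr : K * r ≤ R / 2) :
    ∃ U : H → E, U 0 = y₀ ∧ ∀ v ∈ ball (0 : H) r,
      U v ∈ closedBall y₀ (R / 2) ∧ ∀ t ∈ Icc (0 : ℝ) 1,
        HasDerivWithinAt (fun t : ℝ => U (t • v)) (X (U (t • v)) v) (Icc 0 1) t := by
  have hR := hX.pos
  have hsub : closedBall y₀ (R / 2) ⊆ ball y₀ R := closedBall_subset_ball (by linarith)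
  have hsol : ∀ v : H, ∃ y : ℝ → E, v ∈ ball (0 : H) r → y 0 = y₀ ∧ ∀ t ∈ Icc (0 : ℝ) 1,
      HasDerivWithinAt y (X (y t) v) (Icc 0 1) t ∧ y t ∈ closedBall y₀ (R / 2) := by
    intro v
    by_cases hv : v ∈ ball (0 : H) r
    · obtain ⟨y, hy⟩ := hX.exists_solution (v := v) (by
        refine le_trans ?_ hr
        gcongr
        simpa using (mem_ball_zero_iff.1 hv).le)
      exact ⟨y, fun _ => hy⟩
    · exact ⟨fun _ => 0, fun h => absurd h hv⟩
  choose y hy using hsol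
  have hscale : ∀ v ∈ ball (0 : H) r, ∀ t ∈ Icc (0 : ℝ) 1, t • v ∈ ball (0 : H) r := by
    intro v hv t ht
    rw [mem_ball_zero_iff] at hv ⊢
    rw [norm_smul, Real.norm_of_nonneg ht.1]
    exact (mul_le_of_le_one_left (norm_nonneg _) ht.2).trans_lt hv
  have key : ∀ v ∈ ball (0 : H) r, ∀ t ∈ Icc (0 : ℝ) 1, y (t • v) 1 = y v t := by
    intro v hv t ht
    have h1 := hy v hv
    have h2 := hy _ (hscale v hv t ht)
    have hmaps : MapsTo (fun s : ℝ => t * s) (Icc 0 1) (Icc 0 1) := fun s hs =>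
      ⟨mul_nonneg ht.1 hs.1, mul_le_one₀ ht.2 hs.1 hs.2⟩
    have := hX.solution_unique (v' := fun _ => t • v) (C := ‖t • v‖) (fun _ _ => le_rfl)
      (y := y (t • v)) (z := fun s => y v (t * s)) (fun s hs => (h2.2 s hs).1)
      (fun s hs => by
        have := (h1.2 (t * s) (hmaps hs)).1.scomp s (h := fun s => t * s)
          (((hasDerivAt_id s).const_mul t).hasDerivWithinAt) hmaps
        simpa [Function.comp_def] using this)
      (fun s hs => hsub (h2.2 s hs).2) (fun s hs => hsub (h1.2 _ (hmaps hs)).2)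
      (by simp [h1.1, h2.1])
    simpa using this (right_mem_Icc.2 zero_le_one)
  classical
  refine ⟨fun v => if v ∈ ball (0 : H) r then y v 1 else y₀, ?_, fun v hv => ⟨?_, ?_⟩⟩
  · dsimp only
    split_ifs with h
    · have := key 0 h 0 (by simp)
      simpa [(hy 0 h).1] using this
    · rfl
  · simp only [hv, if_true]
    exact ((hy v hv).2 1 (by simp)).2
  · intro t ht
    have heq : ∀ s ∈ Icc (0 : ℝ) 1,
        (if s • v ∈ ball (0 : H) r then y (s • v) 1 else y₀) = y v s := by
      intro s hs
      simp only [hscale v hv s hs, if_true, key v hv s hs]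
    simp only [heq t ht]
    exact ((hy v hv).2 t ht).1.congr heq (heq t ht)

/-- Second order Taylor estimate. -/
theorem TameOnBall.norm_taylor_le {X : E → H →L[ℝ] E} {y₀ : E} {R : ℝ}
    {K : ℝ≥0} (hX : TameOnBall X y₀ R K) {y z : E} (hy : y ∈ ball y₀ R) (hz : z ∈ ball y₀ R) :
    ‖X z - X y - fderiv ℝ X y (z - y)‖ ≤ K * ‖z - y‖ * ‖z - y‖ := by
  have hseg : segment ℝ y z ⊆ ball y₀ R := (convex_ball y₀ R).segment_subset hy hz
  refine (convex_segment y z).norm_image_sub_le_of_norm_hasFDerivWithin_le'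
    (f' := fderiv ℝ X) (fun w hw => ?_) (fun w hw => ?_)
    (left_mem_segment ℝ y z) (right_mem_segment ℝ y z)
  · exact ((hX.contDiffOn.contDiffAt (isOpen_ball.mem_nhds (hseg hw))).differentiableAt
      (by simp)).hasFDerivAt.hasFDerivWithinAt
  · rw [← dist_eq_norm]
    refine (hX.lipschitz_fderiv.dist_le_mul w (hseg hw) y hy).trans ?_
    gcongr
    rw [dist_eq_norm]
    exact norm_sub_le_of_mem_segment hw

/-- If the integrability condition `D_{X(y)w} X (y) w' = D_{X(y)w'} X (y) w` holds along the
image of the radial solution `U`, then `U` solves the total differential equation `DU = X(U)`.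
The curve `t ↦ U(t v) + t X(U(t v)) h` solves the equation of `t ↦ U(t (v + h))` up to an error
of order `‖h‖²`, so that Grönwall's inequality gives the derivative of `U` at `v`. -/
theorem TameOnBall.hasFDerivAt_radial {X : E → H →L[ℝ] E} {y₀ : E} {R : ℝ}
    {K : ℝ≥0} (hX : TameOnBall X y₀ R K) {r : ℝ} {U : H → E}
    (hU : ∀ v ∈ ball (0 : H) r, U v ∈ closedBall y₀ (R / 2) ∧ ∀ t ∈ Icc (0 : ℝ) 1,
        HasDerivWithinAt (fun t : ℝ => U (t • v)) (X (U (t • v)) v) (Icc 0 1) t)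
    (hflat : ∀ v ∈ ball (0 : H) r, ∀ w w' : H,
      fderiv ℝ X (U v) (X (U v) w) w' = fderiv ℝ X (U v) (X (U v) w') w)
    {v : H} (hv : v ∈ ball (0 : H) r) : HasFDerivAt U (X (U v)) v := by
  have hR := hX.pos
  have hr : 0 < r := pos_of_mem_ball hv
  have hsub : closedBall y₀ (R / 2) ⊆ ball y₀ R := closedBall_subset_ball (by linarith)
  have hscale : ∀ v ∈ ball (0 : H) r, ∀ t ∈ Icc (0 : ℝ) 1, t • v ∈ ball (0 : H) r := by
    intro v hv t ht
    rw [mem_ball_zero_iff] at hv ⊢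
    rw [norm_smul, Real.norm_of_nonneg ht.1]
    exact (mul_le_of_le_one_left (norm_nonneg _) ht.2).trans_lt hv
  have hdiff : ∀ y ∈ ball y₀ R, HasFDerivAt X (fderiv ℝ X y) y := fun y hy =>
    ((hX.contDiffOn.contDiffAt (isOpen_ball.mem_nhds hy)).differentiableAt
      (by simp)).hasFDerivAt
  have hDX : ∀ y ∈ ball y₀ R, ‖fderiv ℝ X y‖ ≤ K := fun y hy =>
    norm_fderiv_le_of_lipschitzOn ℝ (isOpen_ball.mem_nhds hy) hX.lipschitz
  set A : ℝ := K * K * K * r + K * K with hA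
  set G : ℝ := gronwallBound 0 (K * r) 1 1 with hG
  have hest : ∀ h : H, v + h ∈ ball (0 : H) r → K * ‖h‖ < R / 2 →
      ‖U (v + h) - U v - X (U v) h‖ ≤ (A * G) * ‖h‖ ^ 2 := by
    intro h hvh hKh
    set y : ℝ → E := fun t => U (t • v) with hydef
    have hyB : ∀ t ∈ Icc (0 : ℝ) 1, y t ∈ closedBall y₀ (R / 2) := fun t ht =>
      (hU _ (hscale v hv t ht)).1
    have hy' : ∀ t ∈ Icc (0 : ℝ) 1, HasDerivWithinAt y (X (y t) v) (Icc 0 1) t :=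
      (hU v hv).2
    have hXh : ∀ t ∈ Icc (0 : ℝ) 1, ‖X (y t) h‖ ≤ K * ‖h‖ := fun t ht =>
      ((X (y t)).le_opNorm h).trans (by gcongr; exact hX.norm_le _ (hsub (hyB t ht)))
    set z : ℝ → E := fun t => y t + t • X (y t) h with hzdef
    have hzB : ∀ t ∈ Icc (0 : ℝ) 1, z t ∈ ball y₀ R := by
      intro t ht
      rw [mem_ball_iff_norm]
      have h1 := mem_closedBall_iff_norm.1 (hyB t ht)
      have h2 : ‖t • X (y t) h‖ ≤ K * ‖h‖ := by
        rw [norm_smul, Real.norm_of_nonneg ht.1]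
        exact (mul_le_of_le_one_left (norm_nonneg _) ht.2).trans (hXh t ht)
      calc ‖z t - y₀‖ = ‖(y t - y₀) + t • X (y t) h‖ := by simp [hzdef]; abel_nf
        _ ≤ ‖y t - y₀‖ + ‖t • X (y t) h‖ := norm_add_le _ _
        _ < R := by linarith
    have hz' : ∀ t ∈ Icc (0 : ℝ) 1, HasDerivWithinAt z
        (X (y t) v + (t • (fderiv ℝ X (y t) (X (y t) v)) h + X (y t) h)) (Icc 0 1) t := by
      intro t ht
      have h1 : HasDerivWithinAt (fun t => X (y t)) (fderiv ℝ X (y t) (X (y t) v)) (Icc 0 1) t :=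
        (hdiff _ (hsub (hyB t ht))).comp_hasDerivWithinAt t (hy' t ht)
      have h2 : HasDerivWithinAt (fun t => X (y t) h)
          (fderiv ℝ X (y t) (X (y t) v) h) (Icc 0 1) t := by
        simpa using h1.clm_apply (hasDerivWithinAt_const t (Icc 0 1) h)
      have h3 := (hasDerivWithinAt_id t (Icc (0 : ℝ) 1)).smul h2
      exact ((hy' t ht).add h3).congr_deriv (by simp)
    have herr : ∀ t ∈ Icc (0 : ℝ) 1,
        dist (X (y t) v + (t • (fderiv ℝ X (y t) (X (y t) v)) h + X (y t) h))
          (X (z t) (v + h)) ≤ A * ‖h‖ ^ 2 := by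
      intro t ht
      have hyt := hsub (hyB t ht)
      have hzy : z t - y t = t • X (y t) h := by simp [hzdef]
      have hzyn : ‖z t - y t‖ ≤ K * ‖h‖ := by
        rw [hzy, norm_smul, Real.norm_of_nonneg ht.1]
        exact (mul_le_of_le_one_left (norm_nonneg _) ht.2).trans (hXh t ht)
      have hid : X (z t) (v + h) - (X (y t) v + (t • (fderiv ℝ X (y t) (X (y t) v)) h + X (y t) h))
          = (X (z t) - X (y t) - fderiv ℝ X (y t) (z t - y t)) (v + h)
            + t • fderiv ℝ X (y t) (X (y t) h) h := by
        have hfl : fderiv ℝ X (y t) (X (y t) v) h = fderiv ℝ X (y t) (X (y t) h) v :=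
          hflat _ (hscale v hv t ht) v h
        rw [hzy, hfl]
        simp only [map_smul, sub_apply, smul_apply, map_add]
        abel
      rw [dist_comm, dist_eq_norm, hid]
      have e1 : ‖(X (z t) - X (y t) - fderiv ℝ X (y t) (z t - y t)) (v + h)‖
          ≤ (K * (K * ‖h‖) * (K * ‖h‖)) * r := by
        refine (ContinuousLinearMap.le_opNorm _ _).trans ?_
        gcongr
        · refine (hX.norm_taylor_le hyt (hzB t ht)).trans ?_
          gcongr
        · exact (mem_ball_zero_iff.1 hvh).le
      have e2 : ‖t • fderiv ℝ X (y t) (X (y t) h) h‖ ≤ (K * (K * ‖h‖)) * ‖h‖ := by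
        rw [norm_smul, Real.norm_of_nonneg ht.1]
        refine (mul_le_of_le_one_left (norm_nonneg _) ht.2).trans ?_
        refine (ContinuousLinearMap.le_opNorm _ _).trans ?_
        gcongr
        refine (ContinuousLinearMap.le_opNorm _ _).trans ?_
        gcongr
        · exact hDX _ hyt
        · exact hXh t ht
      refine (norm_add_le _ _).trans ((add_le_add e1 e2).trans (le_of_eq ?_))
      rw [hA]; ring
    have hvh' : ∀ t ∈ Icc (0 : ℝ) 1, U (t • (v + h)) ∈ ball y₀ R := fun t ht =>
      hsub (hU _ (hscale _ hvh t ht)).1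
    have hgr := dist_le_of_approx_trajectories_ODE_of_mem (v := fun _ y => X y (v + h))
      (s := fun _ => ball y₀ R) (K := K * r.toNNReal) (δ := 0) (f := fun t => U (t • (v + h)))
      (g := z) (a := 0) (b := 1) (εf := 0) (εg := A * ‖h‖ ^ 2)
      (fun t ht => hX.lipschitz_apply ((mem_ball_zero_iff.1 hvh).le.trans r.le_coe_toNNReal))
      (fun t ht => ((hU _ hvh).2 t ht).continuousWithinAt)
      (fun t ht => HasDerivWithinAt.Ici_of_Icc ((hU _ hvh).2 t (Ico_subset_Icc_self ht)) ht)
      (fun t ht => by simp)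
      (fun t ht => hvh' t (Ico_subset_Icc_self ht))
      (fun t ht => (hz' t ht).continuousWithinAt)
      (fun t ht => HasDerivWithinAt.Ici_of_Icc (hz' t (Ico_subset_Icc_self ht)) ht)
      (fun t ht => herr t (Ico_subset_Icc_self ht))
      (fun t ht => hzB t (Ico_subset_Icc_self ht)) (by simp [hzdef, hydef])
      1 (right_mem_Icc.2 zero_le_one)
    have hlin : ∀ κ ε : ℝ, gronwallBound 0 κ ε 1 = ε * gronwallBound 0 κ 1 1 := by
      intro κ ε
      unfold gronwallBound
      split_ifs <;> ring
    rw [zero_add, sub_zero, hlin, dist_eq_norm] at hgr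
    have e : U ((1 : ℝ) • (v + h)) - z 1 = U (v + h) - U v - X (U v) h := by
      simp [hzdef, hydef]; abel
    rw [e] at hgr
    refine hgr.trans (le_of_eq ?_)
    rw [hG]; push_cast; rw [Real.coe_toNNReal r hr.le]; ring
  rw [hasFDerivAt_iff_isLittleO_nhds_zero]
  have hO : (fun h => U (v + h) - U v - X (U v) h) =O[𝓝 0] fun h : H => ‖h‖ ^ 2 := by
    refine Asymptotics.IsBigO.of_bound (A * G) ?_
    have h1 : ∀ᶠ h : H in 𝓝 0, v + h ∈ ball (0 : H) r :=
      (continuous_const.add continuous_id).continuousAt.eventually_mem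
        (isOpen_ball.mem_nhds (by simpa using hv))
    have h2 : ∀ᶠ h : H in 𝓝 0, K * ‖h‖ < R / 2 := by
      have : ContinuousAt (fun h : H => (K : ℝ) * ‖h‖) 0 := by fun_prop
      exact this.eventually_lt continuousAt_const (by simpa using hR)
    filter_upwards [h1, h2] with h h1 h2
    simpa using hest h h1 h2
  refine hO.trans_isLittleO ?_
  have := Asymptotics.isLittleO_norm_pow_id (E' := H) (n := 2) (by norm_num)
  exact this

/-- A solution of `DU = X(U)` is smooth. -/
theorem contDiffOn_of_hasFDerivAt_comp {X : E → H →L[ℝ] E} {S : Set E} {D : Set H} (hD : IsOpen D)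
    (hX : ContDiffOn ℝ ∞ X S) {U : H → E} (hmaps : MapsTo U D S)
    (hU : ∀ v ∈ D, HasFDerivAt U (X (U v)) v) : ContDiffOn ℝ ∞ U D := by
  rw [contDiffOn_infty]
  intro n
  induction n with
  | zero =>
    rw [Nat.cast_zero, contDiffOn_zero]
    exact fun v hv => (hU v hv).continuousAt.continuousWithinAt
  | succ n ih =>
    push_cast
    rw [contDiffOn_succ_iff_fderiv_of_isOpen hD]
    refine ⟨fun v hv => (hU v hv).differentiableAt.differentiableWithinAt, by simp, ?_⟩
    exact ((hX.of_le (by exact_mod_cast le_top)).comp ih hmaps).congr fun v hv => (hU v hv).fderiv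

end TotalDifferential

/-! ### Local leaves of an involutive anchor on an open subset of a vector space -/

section LocalAnchor

open Metric
open scoped NNReal

variable {H E F : Type*} [NormedAddCommGroup H] [NormedSpace ℝ H]
  [NormedAddCommGroup E] [NormedSpace ℝ E] [NormedAddCommGroup F] [NormedSpace ℝ F]

/-- A Lie algebroid in local coordinates: a smooth family `ρ(y) : F → E` of linear maps on an open
set `Ω`, with the bracket relation `[ρ e, ρ f] = ρ (c(e, f))` for constant sections `e`, `f`.
The only property of the structure functions `c` that matters is a bound. -/
structure InvolutiveAnchor (ρ : E → F →L[ℝ] E) (c : E → F → F → F) (Ω : Set E) (C : ℝ) :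
    Prop where
  isOpen : IsOpen Ω
  contDiffOn : ContDiffOn ℝ ∞ ρ Ω
  nonneg : 0 ≤ C
  bound : ∀ y ∈ Ω, ∀ e f, ‖c y e f‖ ≤ C * ‖e‖ * ‖f‖
  bracket : ∀ y ∈ Ω, ∀ e f, fderiv ℝ ρ y (ρ y e) f - fderiv ℝ ρ y (ρ y f) e = ρ y (c y e f)

variable (ρ : E → F →L[ℝ] E) (σ : H →L[ℝ] F) (q : E →L[ℝ] H)

/-- Given `σ : H → F` and `q : E → H` such that `q ρ(y) σ` is invertible, the modification `τ(y)`
of `σ` that satisfies `q ρ(y) τ(y) = 1`. -/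
noncomputable def liftMap (y : E) : H →L[ℝ] F := σ ∘L (q ∘L ρ y ∘L σ).inverse

/-- The map `X(y) = ρ(y) τ(y) : H → E`, a right inverse of `q` with image in that of `ρ(y)`. -/
noncomputable def spanMap (y : E) : H →L[ℝ] E := ρ y ∘L liftMap ρ σ q y

/-- The part `ψ(y) = (1 - X(y) q) ρ(y)` of `ρ(y)` outside the image of `X(y)`. It vanishes exactly
where the image of `ρ(y)` is as small as the image of `X(y)`. -/
noncomputable def defect (y : E) : F →L[ℝ] E := ρ y - spanMap ρ σ q y ∘L q ∘L ρ y

variable {ρ σ q}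

theorem proj_spanMap {y : E} (hy : (q ∘L ρ y ∘L σ).IsInvertible) (v : H) :
    q (spanMap ρ σ q y v) = v := by
  obtain ⟨e, he⟩ := hy
  have : (q ∘L ρ y ∘L σ) ((q ∘L ρ y ∘L σ).inverse v) = v := by
    rw [← he]; simp
  simpa [spanMap, liftMap] using this

theorem defect_apply (y : E) (f : F) :
    defect ρ σ q y f = ρ y f - spanMap ρ σ q y (q (ρ y f)) := rfl

theorem contDiffAt_liftMap [CompleteSpace H] {y : E} (hρ : ContDiffAt ℝ ∞ ρ y)
    (hy : (q ∘L ρ y ∘L σ).IsInvertible) : ContDiffAt ℝ ∞ (liftMap ρ σ q) y := by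
  obtain ⟨e, he⟩ := hy
  have h1 : ContDiffAt ℝ ∞ (fun y => q ∘L ρ y ∘L σ) y :=
    contDiffAt_const.clm_comp (hρ.clm_comp contDiffAt_const)
  have h2 : ContDiffAt ℝ ∞ ContinuousLinearMap.inverse (q ∘L ρ y ∘L σ) := by
    rw [← he]; exact contDiffAt_map_inverse e
  have h3 : ContDiffAt ℝ ∞ (fun y => (q ∘L ρ y ∘L σ).inverse) y :=
    ContDiffAt.comp (g := fun A : H →L[ℝ] H => A.inverse) y h2 h1
  exact contDiffAt_const.clm_comp h3

theorem contDiffAt_spanMap [CompleteSpace H] {y : E} (hρ : ContDiffAt ℝ ∞ ρ y)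
    (hy : (q ∘L ρ y ∘L σ).IsInvertible) : ContDiffAt ℝ ∞ (spanMap ρ σ q) y :=
  hρ.clm_comp (contDiffAt_liftMap hρ hy)

theorem contDiffAt_defect [CompleteSpace H] {y : E} (hρ : ContDiffAt ℝ ∞ ρ y)
    (hy : (q ∘L ρ y ∘L σ).IsInvertible) : ContDiffAt ℝ ∞ (defect ρ σ q) y :=
  hρ.sub ((contDiffAt_spanMap hρ hy).clm_comp (contDiffAt_const.clm_comp hρ))

theorem isOpen_invertible [CompleteSpace H] {Ω : Set E} (hΩ : IsOpen Ω)
    (hρ : ContDiffOn ℝ ∞ ρ Ω) : IsOpen {y ∈ Ω | (q ∘L ρ y ∘L σ).IsInvertible} := by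
  have h : ContinuousOn (fun y => q ∘L ρ y ∘L σ) Ω :=
    continuousOn_const.clm_comp (hρ.continuousOn.clm_comp continuousOn_const)
  have hopen : IsOpen {A : H →L[ℝ] H | A.IsInvertible} := by
    convert! ContinuousLinearEquiv.isOpen (𝕜 := ℝ) (E := H) (F := H) using 1
  exact h.isOpen_inter_preimage hΩ hopen

section Identities

variable {c : E → F → F → F} {Ω : Set E} {C : ℝ}

/-- The derivative of `X` has its values in the kernel of `q`, and modulo the image of the defect it
is determined by the derivative of `ρ`. -/
theorem fderiv_spanMap_apply [CompleteSpace H] {y : E}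
    (hρ : ContDiffAt ℝ ∞ ρ y) (hopen : ∀ᶠ z in 𝓝 y, (q ∘L ρ z ∘L σ).IsInvertible)
    (z : E) (w : H) :
    fderiv ℝ (spanMap ρ σ q) y z w =
      (fderiv ℝ ρ y z (liftMap ρ σ q y w)
        - spanMap ρ σ q y (q (fderiv ℝ ρ y z (liftMap ρ σ q y w))))
      + defect ρ σ q y (fderiv ℝ (liftMap ρ σ q) y z w) := by
  have hy := hopen.self_of_nhds
  have hdX := ((contDiffAt_spanMap hρ hy).differentiableAt (by simp)).hasFDerivAt
  have hdρ := (hρ.differentiableAt (by simp)).hasFDerivAt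
  have hdτ := ((contDiffAt_liftMap hρ hy).differentiableAt (by simp)).hasFDerivAt
  have h1 : fderiv ℝ (spanMap ρ σ q) y z w =
      fderiv ℝ ρ y z (liftMap ρ σ q y w) + ρ y (fderiv ℝ (liftMap ρ σ q) y z w) := by
    have := hdX.unique (hdρ.clm_comp hdτ)
    rw [this]
    simp [add_comm]
  have h2 : q (fderiv ℝ (spanMap ρ σ q) y z w) = 0 := by
    have hconst : (fun y => q (spanMap ρ σ q y w)) =ᶠ[𝓝 y] fun _ => w := by
      filter_upwards [hopen] with x hx using proj_spanMap hx w
    have h3 := (q.hasFDerivAt (x := spanMap ρ σ q y w)).comp y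
      (hdX.clm_apply (hasFDerivAt_const w y))
    have h4 := (hasFDerivAt_const (𝕜 := ℝ) w y).congr_of_eventuallyEq hconst
    simpa using DFunLike.congr_fun (h3.unique h4) z
  have h3 : spanMap ρ σ q y (q (fderiv ℝ (spanMap ρ σ q) y z w)) = 0 := by rw [h2, map_zero]
  rw [h1, map_add, map_add] at h3
  rw [h1, defect_apply, ← sub_zero (_ + ρ y _), ← h3]
  abel

/-- Along directions in the image of `ρ`, the defect satisfies a linear homogeneous equation. -/
theorem fderiv_defect_apply [CompleteSpace H] (hρ : InvolutiveAnchor ρ c Ω C) {y : E} (hyΩ : y ∈ Ω)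
    (hy : (q ∘L ρ y ∘L σ).IsInvertible) (a f : F) :
    fderiv ℝ (defect ρ σ q) y (ρ y a) f =
      (fderiv ℝ ρ y (defect ρ σ q y f) a
        - spanMap ρ σ q y (q (fderiv ℝ ρ y (defect ρ σ q y f) a)))
      + defect ρ σ q y (c y a f)
      - defect ρ σ q y (c y a (liftMap ρ σ q y (q (ρ y f))))
      - defect ρ σ q y (fderiv ℝ (liftMap ρ σ q) y (ρ y a) (q (ρ y f))) := by
  have hρy := hρ.contDiffOn.contDiffAt (hρ.isOpen.mem_nhds hyΩ)
  have hopen : ∀ᶠ z in 𝓝 y, (q ∘L ρ z ∘L σ).IsInvertible := by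
    filter_upwards [(isOpen_invertible hρ.isOpen hρ.contDiffOn).mem_nhds ⟨hyΩ, hy⟩] with z hz
      using hz.2
  have hdX := ((contDiffAt_spanMap hρy hy).differentiableAt (by simp)).hasFDerivAt
  have hdρ := (hρy.differentiableAt (by simp)).hasFDerivAt
  have hdψ := ((contDiffAt_defect hρy hy).differentiableAt (by simp)).hasFDerivAt
  set w := q (ρ y f) with hw
  have h1 : fderiv ℝ (defect ρ σ q) y (ρ y a) f = fderiv ℝ ρ y (ρ y a) f
      - (spanMap ρ σ q y (q (fderiv ℝ ρ y (ρ y a) f))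
        + fderiv ℝ (spanMap ρ σ q) y (ρ y a) w) := by
    have := hdψ.unique (hdρ.sub (hdX.clm_comp ((hasFDerivAt_const q y).clm_comp hdρ)))
    rw [this]
    simp [hw]
  have h2 := hρ.bracket y hyΩ a f
  have h3 := hρ.bracket y hyΩ a (liftMap ρ σ q y w)
  have h4 : ρ y f = defect ρ σ q y f + ρ y (liftMap ρ σ q y w) := by
    rw [defect_apply]; simp [spanMap, hw]
  have h5 := fderiv_spanMap_apply hρy hopen (ρ y a) w
  rw [sub_eq_iff_eq_add] at h2 h3
  -- `ρ f` is split into its defect and `ρ` of the lift of `q ρ f`, before the bracket is used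
  have h6 : fderiv ℝ ρ y (ρ y a) f = ρ y (c y a f) + fderiv ℝ ρ y (defect ρ σ q y f) a
      + fderiv ℝ ρ y (ρ y (liftMap ρ σ q y w)) a := by
    rw [h2, add_assoc]; congr 1
    rw [h4]; simp
  rw [h1, h5, h3, h6]
  simp only [defect_apply, map_add, map_sub]
  abel

/-- Where the defect vanishes, the integrability condition of `DU = X(U)` holds. -/
theorem fderiv_spanMap_symm [CompleteSpace H] (hρ : InvolutiveAnchor ρ c Ω C) {y : E} (hyΩ : y ∈ Ω)
    (hy : (q ∘L ρ y ∘L σ).IsInvertible) (hψ : defect ρ σ q y = 0) (v w : H) :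
    fderiv ℝ (spanMap ρ σ q) y (spanMap ρ σ q y v) w =
      fderiv ℝ (spanMap ρ σ q) y (spanMap ρ σ q y w) v := by
  have hρy := hρ.contDiffOn.contDiffAt (hρ.isOpen.mem_nhds hyΩ)
  have hopen : ∀ᶠ z in 𝓝 y, (q ∘L ρ z ∘L σ).IsInvertible := by
    filter_upwards [(isOpen_invertible hρ.isOpen hρ.contDiffOn).mem_nhds ⟨hyΩ, hy⟩] with z hz
      using hz.2
  rw [fderiv_spanMap_apply hρy hopen, fderiv_spanMap_apply hρy hopen, hψ]
  have h2 := hρ.bracket y hyΩ (liftMap ρ σ q y v) (liftMap ρ σ q y w)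
  rw [sub_eq_iff_eq_add] at h2
  have h3 : spanMap ρ σ q y v = ρ y (liftMap ρ σ q y v) := rfl
  have h4 : spanMap ρ σ q y w = ρ y (liftMap ρ σ q y w) := rfl
  have h5 := congr($hψ (c y (liftMap ρ σ q y v) (liftMap ρ σ q y w)))
  rw [defect_apply, zero_apply, sub_eq_zero] at h5
  rw [h3, h4, h2, map_add, map_add, ← h5]
  simp

/-- The derivative of the defect in directions tangent to the image of `ρ` is bounded by a multiple
of the defect. -/
theorem InvolutiveAnchor.norm_fderiv_defect_le [CompleteSpace H] (hρ : InvolutiveAnchor ρ c Ω C)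
    {y : E} (hyΩ : y ∈ Ω) (hy : (q ∘L ρ y ∘L σ).IsInvertible) (a : F) :
    ‖fderiv ℝ (defect ρ σ q) y (ρ y a)‖ ≤
      (‖fderiv ℝ ρ y‖ + ‖spanMap ρ σ q y‖ * ‖q‖ * ‖fderiv ℝ ρ y‖ + C
        + C * ‖liftMap ρ σ q y‖ * ‖q‖ * ‖ρ y‖
        + ‖fderiv ℝ (liftMap ρ σ q) y‖ * ‖ρ y‖ * ‖q‖ * ‖ρ y‖) * ‖a‖ * ‖defect ρ σ q y‖ := by
  have hC := hρ.nonneg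
  refine ContinuousLinearMap.opNorm_le_bound _ (by positivity) fun f => ?_
  rw [fderiv_defect_apply hρ hyΩ hy]
  set ψ := defect ρ σ q y
  set X := spanMap ρ σ q y
  set τ := liftMap ρ σ q y
  set Dρ := fderiv ℝ ρ y
  set Dτ := fderiv ℝ (liftMap ρ σ q) y
  have e0 : ‖Dρ (ψ f) a‖ ≤ ‖Dρ‖ * (‖ψ‖ * ‖f‖) * ‖a‖ :=
    (ContinuousLinearMap.le_opNorm _ _).trans
      (by gcongr; exact ContinuousLinearMap.le_opNorm_of_le _ (ContinuousLinearMap.le_opNorm _ _))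
  have ew : ‖q (ρ y f)‖ ≤ ‖q‖ * (‖ρ y‖ * ‖f‖) :=
    ContinuousLinearMap.le_opNorm_of_le _ (ContinuousLinearMap.le_opNorm _ _)
  have e1 : ‖X (q (Dρ (ψ f) a))‖ ≤ ‖X‖ * (‖q‖ * (‖Dρ‖ * (‖ψ‖ * ‖f‖) * ‖a‖)) :=
    ContinuousLinearMap.le_opNorm_of_le _ (ContinuousLinearMap.le_opNorm_of_le _ e0)
  have e2 : ‖ψ (c y a f)‖ ≤ ‖ψ‖ * (C * ‖a‖ * ‖f‖) :=
    ContinuousLinearMap.le_opNorm_of_le _ (hρ.bound y hyΩ _ _)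
  have e3 : ‖ψ (c y a (τ (q (ρ y f))))‖ ≤ ‖ψ‖ * (C * ‖a‖ * (‖τ‖ * (‖q‖ * (‖ρ y‖ * ‖f‖)))) :=
    ContinuousLinearMap.le_opNorm_of_le _ ((hρ.bound y hyΩ _ _).trans
      (by gcongr; exact ContinuousLinearMap.le_opNorm_of_le _ ew))
  have e4 : ‖ψ (Dτ (ρ y a) (q (ρ y f)))‖
      ≤ ‖ψ‖ * (‖Dτ‖ * (‖ρ y‖ * ‖a‖) * (‖q‖ * (‖ρ y‖ * ‖f‖))) :=
    ContinuousLinearMap.le_opNorm_of_le _ ((ContinuousLinearMap.le_opNorm _ _).trans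
      (by gcongr; exact ContinuousLinearMap.le_opNorm_of_le _ (ContinuousLinearMap.le_opNorm _ _)))
  calc _ ≤ ‖Dρ (ψ f) a‖ + ‖X (q (Dρ (ψ f) a))‖ + ‖ψ (c y a f)‖ + ‖ψ (c y a (τ (q (ρ y f))))‖
        + ‖ψ (Dτ (ρ y a) (q (ρ y f)))‖ :=
        (norm_sub_le _ _).trans (by
          gcongr
          refine (norm_sub_le _ _).trans ?_
          gcongr
          refine (norm_add_le _ _).trans ?_
          gcongr
          exact norm_sub_le _ _)
    _ ≤ _ := by
        refine (add_le_add (add_le_add (add_le_add (add_le_add e0 e1) e2) e3) e4).trans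
          (le_of_eq ?_)
        ring

end Identities

/-- A ball on which the local leaf theory works: `X` is tame, and the defect satisfies a linear
differential inequality along curves tangent to the image of `ρ`. -/
structure LeafBall (ρ : E → F →L[ℝ] E) (σ : H →L[ℝ] F) (q : E →L[ℝ] H) (y₀ : E) (R : ℝ) (K : ℝ≥0)
    (m : ℝ) : Prop extends TameOnBall (spanMap ρ σ q) y₀ R K where
  invertible : ∀ y ∈ ball y₀ R, (q ∘L ρ y ∘L σ).IsInvertible
  contDiffAt : ∀ y ∈ ball y₀ R, ContDiffAt ℝ ∞ ρ y
  norm_anchor_le : ∀ y ∈ ball y₀ R, ‖ρ y‖ ≤ m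
  norm_liftMap_le : ∀ y ∈ ball y₀ R, ‖liftMap ρ σ q y‖ ≤ m
  norm_fderiv_defect_le : ∀ y ∈ ball y₀ R, ∀ a,
    ‖fderiv ℝ (defect ρ σ q) y (ρ y a)‖ ≤ m * ‖a‖ * ‖defect ρ σ q y‖
  symm : ∀ y ∈ ball y₀ R, defect ρ σ q y = 0 → ∀ v w,
    fderiv ℝ (spanMap ρ σ q) y (spanMap ρ σ q y v) w =
      fderiv ℝ (spanMap ρ σ q) y (spanMap ρ σ q y w) v

/-- All the bounds hold near `y₀` because the quantities concerned are continuous there. -/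
theorem InvolutiveAnchor.exists_leafBall [CompleteSpace H] {c : E → F → F → F} {Ω : Set E} {C : ℝ}
    (hρ : InvolutiveAnchor ρ c Ω C) {y₀ : E} (hy₀ : y₀ ∈ Ω)
    (hinv : (q ∘L ρ y₀ ∘L σ).IsInvertible) :
    ∃ R K m, LeafBall ρ σ q y₀ R K m ∧ ball y₀ R ⊆ Ω := by
  set Ω' := {y ∈ Ω | (q ∘L ρ y ∘L σ).IsInvertible} with hΩ'
  have hopen : IsOpen Ω' := isOpen_invertible hρ.isOpen hρ.contDiffOn
  have hsmooth : ∀ y ∈ Ω', ContDiffAt ℝ ∞ ρ y := fun y hy =>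
    hρ.contDiffOn.contDiffAt (hρ.isOpen.mem_nhds hy.1)
  have h0 : y₀ ∈ Ω' := ⟨hy₀, hinv⟩
  obtain ⟨R₁, hR₁, K, hK⟩ := exists_tameOnBall (X := spanMap ρ σ q) (y₀ := y₀)
    (by filter_upwards [hopen.mem_nhds h0] with y hy using contDiffAt_spanMap (hsmooth y hy) hy.2)
  have cρ := (hsmooth y₀ h0).continuousAt
  have cτ := (contDiffAt_liftMap (hsmooth y₀ h0) hinv).continuousAt
  have cX := (contDiffAt_spanMap (hsmooth y₀ h0) hinv).continuousAt
  have cDρ : ContinuousAt (fderiv ℝ ρ) y₀ :=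
    ((hsmooth y₀ h0).fderiv_right (m := 0) (by norm_cast)).continuousAt
  have cDτ : ContinuousAt (fderiv ℝ (liftMap ρ σ q)) y₀ :=
    ((contDiffAt_liftMap (hsmooth y₀ h0) hinv).fderiv_right (m := 0) (by norm_cast)).continuousAt
  set b : E → ℝ := fun y => ‖fderiv ℝ ρ y‖ + ‖spanMap ρ σ q y‖ * ‖q‖ * ‖fderiv ℝ ρ y‖ + C
        + C * ‖liftMap ρ σ q y‖ * ‖q‖ * ‖ρ y‖
        + ‖fderiv ℝ (liftMap ρ σ q) y‖ * ‖ρ y‖ * ‖q‖ * ‖ρ y‖ with hb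
  have n1 : ContinuousAt (fun y => ‖fderiv ℝ ρ y‖) y₀ :=
    ContinuousAt.norm (E := E →L[ℝ] F →L[ℝ] E) cDρ
  have n2 : ContinuousAt (fun y => ‖spanMap ρ σ q y‖) y₀ := cX.norm
  have n3 : ContinuousAt (fun y => ‖liftMap ρ σ q y‖) y₀ := cτ.norm
  have n4 : ContinuousAt (fun y => ‖ρ y‖) y₀ := cρ.norm
  have n5 : ContinuousAt (fun y => ‖fderiv ℝ (liftMap ρ σ q) y‖) y₀ :=
    ContinuousAt.norm (E := E →L[ℝ] H →L[ℝ] F) cDτ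
  have hcont : ∀ {n₁ n₂ n₃ n₄ n₅ : E → ℝ} (p : ℝ), ContinuousAt n₁ y₀ → ContinuousAt n₂ y₀ →
      ContinuousAt n₃ y₀ → ContinuousAt n₄ y₀ → ContinuousAt n₅ y₀ →
      ContinuousAt (fun y => n₁ y + n₂ y * p * n₁ y + C + C * n₃ y * p * n₄ y
        + n₅ y * n₄ y * p * n₄ y) y₀ := by
    intros
    fun_prop
  have cb : ContinuousAt b y₀ := hcont ‖q‖ n1 n2 n3 n4 n5
  have e1 := cb.eventually_lt continuousAt_const (lt_add_one (b y₀))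
  have e2 := cρ.norm.eventually_lt continuousAt_const (lt_add_one ‖ρ y₀‖)
  have e3 := cτ.norm.eventually_lt continuousAt_const (lt_add_one ‖liftMap ρ σ q y₀‖)
  obtain ⟨R₂, hR₂, hball⟩ := Metric.eventually_nhds_iff_ball.1
    ((hopen.eventually_mem h0).and (e1.and (e2.and e3)))
  refine ⟨min R₁ R₂, K, max (b y₀ + 1) (max (‖ρ y₀‖ + 1) (‖liftMap ρ σ q y₀‖ + 1)), ?_, ?_⟩
  · have hsub : ball y₀ (min R₁ R₂) ⊆ ball y₀ R₂ := ball_subset_ball (min_le_right _ _)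
    refine ⟨hK _ (lt_min hR₁ hR₂) (min_le_left _ _), ?_, ?_, ?_, ?_, ?_, ?_⟩
    · exact fun y hy => (hball y (hsub hy)).1.2
    · exact fun y hy => hsmooth y (hball y (hsub hy)).1
    · exact fun y hy => (hball y (hsub hy)).2.2.1.le.trans
        ((le_max_left _ _).trans (le_max_right _ _))
    · exact fun y hy => (hball y (hsub hy)).2.2.2.le.trans
        ((le_max_right _ _).trans (le_max_right _ _))
    · intro y hy a
      obtain ⟨⟨h1, h2⟩, h3, -⟩ := hball y (hsub hy)
      refine (hρ.norm_fderiv_defect_le h1 h2 a).trans ?_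
      gcongr
      exact h3.le.trans (le_max_left _ _)
    · intro y hy hψ v w
      obtain ⟨⟨h1, h2⟩, -⟩ := hball y (hsub hy)
      exact fderiv_spanMap_symm hρ h1 h2 hψ v w
  · exact fun y hy => (hball y (ball_subset_ball (min_le_right _ _) hy)).1.1

section LeafBall

variable {y₀ : E} {R : ℝ} {K : ℝ≥0} {m : ℝ}

/-- The vanishing of the defect propagates along curves tangent to the image of `ρ`. -/
theorem LeafBall.defect_eq_zero [CompleteSpace H] (h : LeafBall ρ σ q y₀ R K m)
    {y : ℝ → E} {a : ℝ → F} {B : ℝ}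
    (hB : ∀ t ∈ Icc (0 : ℝ) 1, ‖a t‖ ≤ B)
    (hy : ∀ t ∈ Icc (0 : ℝ) 1, HasDerivWithinAt y (ρ (y t) (a t)) (Icc 0 1) t)
    (hyB : ∀ t ∈ Icc (0 : ℝ) 1, y t ∈ ball y₀ R) (h0 : defect ρ σ q (y 0) = 0) :
    ∀ t ∈ Icc (0 : ℝ) 1, defect ρ σ q (y t) = 0 := by
  have hm : 0 ≤ m := (norm_nonneg _).trans (h.norm_anchor_le _ (hyB 0 (by simp)))
  have hd : ∀ t ∈ Icc (0 : ℝ) 1, HasDerivWithinAt (fun t => defect ρ σ q (y t))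
      (fderiv ℝ (defect ρ σ q) (y t) (ρ (y t) (a t))) (Icc 0 1) t := fun t ht =>
    ((contDiffAt_defect (h.contDiffAt _ (hyB t ht)) (h.invertible _ (hyB t ht))).differentiableAt
      (by simp)).hasFDerivAt.comp_hasDerivWithinAt t (hy t ht)
  refine eq_zero_of_abs_deriv_le_mul_abs_self_of_eq_zero_right (K := m * B)
    (fun t ht => (hd t ht).continuousWithinAt)
    (fun t ht => HasDerivWithinAt.Ici_of_Icc (hd t (Ico_subset_Icc_self ht)) ht) h0 fun t ht => ?_
  refine (h.norm_fderiv_defect_le _ (hyB t (Ico_subset_Icc_self ht)) _).trans ?_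
  gcongr
  exact hB t (Ico_subset_Icc_self ht)

/-- The leaf through `y₀` in local coordinates: the graph of a smooth solution `U` of
`DU = X(U)`. Curves in the ball that are tangent to the image of `ρ` and start on the graph stay
on the graph. -/
theorem LeafBall.exists_leaf [CompleteSpace H] [CompleteSpace E] (h : LeafBall ρ σ q y₀ R K m)
    (h0 : defect ρ σ q y₀ = 0) :
    ∃ r > 0, ∃ U : H → E, U 0 = y₀ ∧ ContDiffOn ℝ ∞ U (ball 0 r) ∧
      (∀ v ∈ ball (0 : H) r, U v ∈ ball y₀ R ∧ q (U v) = q y₀ + v ∧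
        HasFDerivAt U (spanMap ρ σ q (U v)) v ∧ defect ρ σ q (U v) = 0) ∧
      ∀ (y : ℝ → E) (a : ℝ → F) (B : ℝ), (∀ t ∈ Icc (0 : ℝ) 1, ‖a t‖ ≤ B) →
        (∀ t ∈ Icc (0 : ℝ) 1, HasDerivWithinAt y (ρ (y t) (a t)) (Icc 0 1) t) →
        (∀ t ∈ Icc (0 : ℝ) 1, y t ∈ ball y₀ R) →
        (∀ t ∈ Icc (0 : ℝ) 1, q (y t) - q y₀ ∈ ball (0 : H) r) →
        y 0 ∈ U '' ball 0 r → ∀ t ∈ Icc (0 : ℝ) 1, y t ∈ U '' ball 0 r := by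
  have hR := h.pos
  have hsub : closedBall y₀ (R / 2) ⊆ ball y₀ R := closedBall_subset_ball (by linarith)
  have hm : 0 ≤ m := (norm_nonneg _).trans (h.norm_anchor_le _ (mem_ball_self hR))
  set r := R / 2 / (K + 1) with hr
  have hr0 : 0 < r := by positivity
  have hKr : K * r ≤ R / 2 := by
    rw [hr, mul_div_assoc', div_le_iff₀ (by positivity)]
    nlinarith [K.2]
  obtain ⟨U, hU0, hU⟩ := h.exists_radial hKr
  have hend : ∀ v : H, U ((1 : ℝ) • v) = U v := fun v => by rw [one_smul]
  have hscale : ∀ v ∈ ball (0 : H) r, ∀ t ∈ Icc (0 : ℝ) 1, t • v ∈ ball (0 : H) r := by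
    intro v hv t ht
    rw [mem_ball_zero_iff] at hv ⊢
    rw [norm_smul, Real.norm_of_nonneg ht.1]
    exact (mul_le_of_le_one_left (norm_nonneg _) ht.2).trans_lt hv
  have hUB : ∀ v ∈ ball (0 : H) r, U v ∈ ball y₀ R := fun v hv => hsub (hU v hv).1
  -- the radial curves are tangent to the image of `ρ`, since `X(y) v = ρ(y) (τ(y) v)`
  have hψ : ∀ v ∈ ball (0 : H) r, defect ρ σ q (U v) = 0 := by
    intro v hv
    have := h.defect_eq_zero (y := fun t => U (t • v))
      (a := fun t => liftMap ρ σ q (U (t • v)) v) (B := m * ‖v‖) (fun t ht =>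
        (ContinuousLinearMap.le_opNorm _ _).trans
          (by gcongr; exact h.norm_liftMap_le _ (hUB _ (hscale v hv t ht))))
      (hU v hv).2 (fun t ht => hUB _ (hscale v hv t ht)) (by simpa [hU0] using h0)
      1 (by simp)
    simpa using this
  have hd : ∀ v ∈ ball (0 : H) r, HasFDerivAt U (spanMap ρ σ q (U v)) v := fun v hv =>
    h.hasFDerivAt_radial hU (fun v hv => h.symm _ (hUB v hv) (hψ v hv)) hv
  have hq : ∀ v ∈ ball (0 : H) r, q (U v) = q y₀ + v := by
    intro v hv
    have hdt : ∀ t ∈ Icc (0 : ℝ) 1,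
        HasDerivWithinAt (fun t : ℝ => q (U (t • v)) - (q y₀ + t • v)) 0 (Icc 0 1) t := by
      intro t ht
      have h1 := q.hasFDerivAt.comp_hasDerivWithinAt t ((hU v hv).2 t ht)
      have h2 : HasDerivWithinAt (fun t : ℝ => q y₀ + t • v) v (Icc 0 1) t := by
        simpa using (((hasDerivAt_id t).smul_const v).const_add (q y₀)).hasDerivWithinAt
      refine (h1.sub h2).congr_deriv ?_
      rw [proj_spanMap (h.invertible _ (hUB _ (hscale v hv t ht))), sub_self]
    have := eq_zero_of_abs_deriv_le_mul_abs_self_of_eq_zero_right (K := 0)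
      (fun t ht => (hdt t ht).continuousWithinAt)
      (fun t ht => HasDerivWithinAt.Ici_of_Icc (hdt t (Ico_subset_Icc_self ht)) ht)
      (by simp [hU0]) (by simp) 1 (by simp)
    simpa [sub_eq_zero] using this
  refine ⟨r, hr0, U, hU0, ?_, fun v hv => ⟨hUB v hv, hq v hv, hd v hv, hψ v hv⟩, ?_⟩
  · exact contDiffOn_of_hasFDerivAt_comp isOpen_ball h.contDiffOn hUB hd
  · rintro y a B hB hy hyB hyr ⟨v₀, hv₀, hyv⟩
    have hψy := h.defect_eq_zero hB hy hyB (by rw [← hyv]; exact hψ v₀ hv₀)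
    -- as the defect vanishes along `y`, both `y` and `t ↦ U(q(y t) - q(y₀))` solve `z' = X(z) v'`
    set v' : ℝ → H := fun t => q (ρ (y t) (a t)) with hv'
    have hspan : ∀ t ∈ Icc (0 : ℝ) 1, spanMap ρ σ q (y t) (v' t) = ρ (y t) (a t) := by
      intro t ht
      have := congr($(hψy t ht) (a t))
      rw [defect_apply, zero_apply, sub_eq_zero] at this
      exact this.symm
    have hvd : ∀ t ∈ Icc (0 : ℝ) 1,
        HasDerivWithinAt (fun t => q (y t) - q y₀) (v' t) (Icc 0 1) t := fun t ht =>
      (q.hasFDerivAt.comp_hasDerivWithinAt t (hy t ht)).sub_const _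
    have huniq := h.solution_unique (v' := v') (C := ‖q‖ * (m * B)) (y := y)
      (z := fun t => U (q (y t) - q y₀))
      (fun t ht => ContinuousLinearMap.le_opNorm_of_le _ ((ContinuousLinearMap.le_opNorm _ _).trans
        (by gcongr; exacts [h.norm_anchor_le _ (hyB t ht), hB t ht])))
      (fun t ht => by rw [hspan t ht]; exact hy t ht)
      (fun t ht => (hd _ (hyr t ht)).comp_hasDerivWithinAt t (hvd t ht))
      hyB (fun t ht => hUB _ (hyr t ht))
      (by simp only [← hyv]; rw [hq v₀ hv₀, add_sub_cancel_left])
    exact fun t ht => ⟨_, hyr t ht, (huniq ht).symm⟩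

end LeafBall

/-- At a point where `q ρ(y₀) σ` is invertible and the rank of `ρ(y₀)` is the dimension of `H`, the
defect vanishes. -/
theorem defect_eq_zero_of_finrank [FiniteDimensional ℝ E] {y₀ : E}
    (h1 : (q ∘L ρ y₀ ∘L σ).IsInvertible)
    (hrank : Module.finrank ℝ (LinearMap.range (ρ y₀ : F →ₗ[ℝ] E)) = Module.finrank ℝ H) :
    defect ρ σ q y₀ = 0 := by
  have hX : Injective (spanMap ρ σ q y₀) :=
    LeftInverse.injective (g := q) (proj_spanMap h1)
  have hle : LinearMap.range (spanMap ρ σ q y₀ : H →ₗ[ℝ] E)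
      ≤ LinearMap.range (ρ y₀ : F →ₗ[ℝ] E) := by
    rintro _ ⟨v, rfl⟩
    exact ⟨liftMap ρ σ q y₀ v, rfl⟩
  have heq := Submodule.eq_of_le_of_finrank_eq hle (by
    rw [hrank, LinearMap.finrank_range_of_inj hX])
  ext f
  have : ρ y₀ f ∈ LinearMap.range (spanMap ρ σ q y₀ : H →ₗ[ℝ] E) := by rw [heq]; exact ⟨f, rfl⟩
  obtain ⟨v, hv⟩ := this
  have hv' : spanMap ρ σ q y₀ v = ρ y₀ f := hv
  rw [defect_apply, ← hv', proj_spanMap h1, sub_self, zero_apply]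

theorem range_spanMap_of_defect_eq_zero {y : E} (h : defect ρ σ q y = 0) :
    range (spanMap ρ σ q y) = range (ρ y) := by
  apply Subset.antisymm
  · rintro _ ⟨v, rfl⟩
    exact ⟨liftMap ρ σ q y v, rfl⟩
  · rintro _ ⟨f, rfl⟩
    have := congr($h f)
    rw [defect_apply, zero_apply, sub_eq_zero] at this
    exact ⟨_, this.symm⟩

/-- A linear map of rank `dim H` has a partial inverse through `H`. -/
theorem exists_section_proj [FiniteDimensional ℝ H] [FiniteDimensional ℝ E]
    [FiniteDimensional ℝ F] (A : F →L[ℝ] E)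
    (hrank : Module.finrank ℝ (LinearMap.range (A : F →ₗ[ℝ] E)) = Module.finrank ℝ H) :
    ∃ (σ : H →L[ℝ] F) (q : E →L[ℝ] H), q ∘L A ∘L σ = ContinuousLinearMap.id ℝ H := by
  let V := LinearMap.range (A : F →ₗ[ℝ] E)
  obtain ⟨e⟩ : Nonempty (V ≃ₗ[ℝ] H) := ⟨LinearEquiv.ofFinrankEq _ _ hrank⟩
  obtain ⟨p, hp⟩ := V.exists_isCompl
  obtain ⟨s, hs⟩ := (A : F →ₗ[ℝ] E).rangeRestrict.exists_rightInverse_of_surjective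
    (LinearMap.range_rangeRestrict _)
  refine ⟨(s ∘ₗ e.symm.toLinearMap).toContinuousLinearMap,
    (e.toLinearMap ∘ₗ V.projectionOnto p hp).toContinuousLinearMap, ?_⟩
  ext v
  have h1 : (A : F →ₗ[ℝ] E).rangeRestrict (s (e.symm v)) = e.symm v := congr($hs (e.symm v))
  have h2 : A (s (e.symm v)) = (e.symm v : V) := congr(($h1 : E))
  simp [h2]

end LocalAnchor

/-! ### Extension of local sections and functions -/

section Extension

variable {E : Type*} [NormedAddCommGroup E] [NormedSpace ℝ E] [FiniteDimensional ℝ E]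
  {M : Type*} [TopologicalSpace M] [T2Space M] [ChartedSpace E M] [IsManifold 𝓘(ℝ, E) ∞ M]
  {F : Type*} [NormedAddCommGroup F] [NormedSpace ℝ F]
  {A : M → Type*} [TopologicalSpace (TotalSpace F A)]
  [∀ x, AddCommGroup (A x)] [∀ x, Module ℝ (A x)] [∀ x, TopologicalSpace (A x)]
  [∀ x, IsTopologicalAddGroup (A x)] [∀ x, ContinuousSMul ℝ (A x)]
  [FiberBundle F A] [VectorBundle ℝ F A] [ContMDiffVectorBundle ∞ F A 𝓘(ℝ, E)]

theorem contMDiffOn_symmL (p : M) (e : F) :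
    ContMDiffOn 𝓘(ℝ, E) (𝓘(ℝ, E).prod 𝓘(ℝ, F)) ∞
      (fun x => TotalSpace.mk' F x ((trivializationAt F A p).symmL ℝ x e))
      (trivializationAt F A p).baseSet := by
  rw [(trivializationAt F A p).contMDiffOn_section_baseSet_iff]
  exact (contMDiffOn_const (c := e)).congr fun x hx => by
    rw [Bundle.Trivialization.symmL_apply _ hx, Bundle.Trivialization.apply_mk_symm _ hx]

variable (E F A) in
/-- The sections that are constant in the trivialization around `p` extend, from a neighbourhood of
`p` that does not depend on the constant, to global smooth sections. -/
theorem exists_frame (p : M) : ∃ S : F →ₗ[ℝ] Cₛ^∞⟮𝓘(ℝ, E); F, A⟯,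
    ∀ᶠ x in 𝓝 p, ∀ e, S e x = (trivializationAt F A p).symmL ℝ x e := by
  set t := trivializationAt F A p
  have hopen : t.baseSet ∈ 𝓝 p :=
    t.open_baseSet.mem_nhds (FiberBundle.mem_baseSet_trivializationAt' p)
  obtain ⟨χ, -, hχ⟩ := (SmoothBumpFunction.nhds_basis_tsupport (I := 𝓘(ℝ, E)) p).mem_iff.1 hopen
  refine ⟨{ toFun := fun e => ⟨fun x => χ x • t.symmL ℝ x e,
              χ.contMDiff.contMDiffOn.smul_section_of_tsupport t.open_baseSet hχ
                (contMDiffOn_symmL p e)⟩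
            map_add' := fun e e' => ?_
            map_smul' := fun c e => ?_ }, ?_⟩
  · ext x
    show χ x • t.symmL ℝ x (e + e') = χ x • t.symmL ℝ x e + χ x • t.symmL ℝ x e'
    rw [map_add, smul_add]
  · ext x
    show χ x • t.symmL ℝ x (c • e) = c • χ x • t.symmL ℝ x e
    rw [map_smul, smul_comm]
  · filter_upwards [χ.eventuallyEq_one] with x hx e
    show χ x • t.symmL ℝ x e = t.symmL ℝ x e
    rw [hx]; simp

/-- A function that is smooth on a neighbourhood of `x` agrees near `x` with a global smooth
function. -/
theorem exists_contMDiffMap_eventuallyEq {x : M} {U : Set M} (hU : U ∈ 𝓝 x) {h : M → ℝ}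
    (hh : ContMDiffOn 𝓘(ℝ, E) 𝓘(ℝ, ℝ) ∞ h U) :
    ∃ f : C^∞⟮𝓘(ℝ, E), M; 𝓘(ℝ, ℝ), ℝ⟯, f =ᶠ[𝓝 x] h := by
  obtain ⟨V, hVU, hVo, hxV⟩ := mem_nhds_iff.1 hU
  obtain ⟨χ, -, hχ⟩ := (SmoothBumpFunction.nhds_basis_tsupport (I := 𝓘(ℝ, E)) x).mem_iff.1
    (hVo.mem_nhds hxV)
  refine ⟨⟨fun y => χ y • h y, ?_⟩, ?_⟩
  · refine contMDiff_of_tsupport fun y hy => ?_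
    have hyV : y ∈ V := hχ (closure_mono (support_smul_subset_left χ h) hy)
    exact (χ.contMDiff y).smul ((hh.mono hVU).contMDiffAt (hVo.mem_nhds hyV))
  · filter_upwards [χ.eventuallyEq_one] with y hy
    show χ y • h y = h y
    rw [hy]; simp

theorem exists_section_apply_eq {x : M} (v : A x) : ∃ s : Cₛ^∞⟮𝓘(ℝ, E); F, A⟯, s x = v := by
  obtain ⟨S, hS⟩ := exists_frame E F A x
  refine ⟨S (trivializationAt F A x ⟨x, v⟩).2, ?_⟩
  have hx := FiberBundle.mem_baseSet_trivializationAt' (F := F) (E := A) x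
  rw [hS.self_of_nhds, Bundle.Trivialization.symmL_apply _ hx]
  exact (trivializationAt F A x).symm_proj_apply ⟨x, v⟩ hx

end Extension

/-! ### The anchor is compatible with the brackets -/

section Anchor

variable {E : Type*} [NormedAddCommGroup E] [NormedSpace ℝ E]
  {M : Type*} [TopologicalSpace M] [ChartedSpace E M] [IsManifold 𝓘(ℝ, E) ∞ M]
  {F : Type*} [NormedAddCommGroup F] [NormedSpace ℝ F]
  {A : M → Type*} [TopologicalSpace (TotalSpace F A)]
  [∀ x, AddCommGroup (A x)] [∀ x, Module ℝ (A x)] [∀ x, TopologicalSpace (A x)]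
  [∀ x, IsTopologicalAddGroup (A x)] [∀ x, ContinuousSMul ℝ (A x)]
  [FiberBundle F A] [VectorBundle ℝ F A]

/-- The derivative of a smooth function along a smooth vector field is smooth. -/
theorem contMDiff_mvfderiv_apply (f : C^∞⟮𝓘(ℝ, E), M; 𝓘(ℝ, ℝ), ℝ⟯)
    {V : ∀ x : M, TangentSpace 𝓘(ℝ, E) x}
    (hV : ContMDiff 𝓘(ℝ, E) (𝓘(ℝ, E).prod 𝓘(ℝ, E)) ∞
      (fun x => TotalSpace.mk' E (E := fun x : M => TangentSpace 𝓘(ℝ, E) x) x (V x))) :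
    ContMDiff 𝓘(ℝ, E) 𝓘(ℝ, ℝ) ∞ fun x => mvfderiv 𝓘(ℝ, E) f x (V x) := by
  have h1 : ContMDiff 𝓘(ℝ, E).tangent 𝓘(ℝ, ℝ).tangent ∞ (tangentMap 𝓘(ℝ, E) 𝓘(ℝ, ℝ) f) :=
    f.contMDiff.contMDiff_tangentMap (by simp)
  have h2 := h1.comp hV
  intro x
  have h3 := (contMDiffAt_totalSpace.1 (h2 x)).2
  refine h3.congr_of_eventuallyEq (Filter.Eventually.of_forall fun y => ?_)
  simp [mvfderiv, tangentMap]
  rfl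

/-- The smooth vector field `ρ(s)`. -/
theorem LieAlgebroid.contMDiff_anchor_apply [ContMDiffVectorBundle ∞ F A 𝓘(ℝ, E)]
    (𝒜 : LieAlgebroid E F A) (s : Cₛ^∞⟮𝓘(ℝ, E); F, A⟯) :
    ContMDiff 𝓘(ℝ, E) (𝓘(ℝ, E).prod 𝓘(ℝ, E)) ∞
      (fun x => TotalSpace.mk' E (E := fun x : M => TangentSpace 𝓘(ℝ, E) x) x
        (𝒜.anchor x (s x))) :=
  𝒜.contMDiff_anchor.clm_bundle_apply s.contMDiff

variable [ContMDiffVectorBundle ∞ F A 𝓘(ℝ, E)]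

/-- The smooth function `ρ(s) f`. -/
noncomputable def LieAlgebroid.deriv (𝒜 : LieAlgebroid E F A) (s : Cₛ^∞⟮𝓘(ℝ, E); F, A⟯)
    (f : C^∞⟮𝓘(ℝ, E), M; 𝓘(ℝ, ℝ), ℝ⟯) : C^∞⟮𝓘(ℝ, E), M; 𝓘(ℝ, ℝ), ℝ⟯ :=
  ⟨fun x => mvfderiv 𝓘(ℝ, E) f x (𝒜.anchor x (s x)),
    contMDiff_mvfderiv_apply f (𝒜.contMDiff_anchor_apply s)⟩

theorem LieAlgebroid.bracket_smulSection (𝒜 : LieAlgebroid E F A) (s t : Cₛ^∞⟮𝓘(ℝ, E); F, A⟯)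
    (f : C^∞⟮𝓘(ℝ, E), M; 𝓘(ℝ, ℝ), ℝ⟯) :
    𝒜.bracket s (smulSection f t) =
      smulSection f (𝒜.bracket s t) + smulSection (𝒜.deriv s f) t := by
  ext x
  exact 𝒜.leibniz s t f x

theorem LieAlgebroid.bracket_neg (𝒜 : LieAlgebroid E F A) (s t : Cₛ^∞⟮𝓘(ℝ, E); F, A⟯) :
    𝒜.bracket s (-t) = -𝒜.bracket s t := by
  have := 𝒜.bracket_smul (-1) s t
  simpa using this

/-- The anchor maps the bracket of sections to the commutator of derivations: this follows by
applying the Leibniz rule to every term of the Jacobi identity for `s`, `t` and `f r`, where `r` is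
a section that does not vanish at the given point. -/
theorem LieAlgebroid.deriv_bracket [Nontrivial F] (𝒜 : LieAlgebroid E F A)
    (hext : ∀ x : M, ∀ v : A x, ∃ r : Cₛ^∞⟮𝓘(ℝ, E); F, A⟯, r x = v)
    (s t : Cₛ^∞⟮𝓘(ℝ, E); F, A⟯) (f : C^∞⟮𝓘(ℝ, E), M; 𝓘(ℝ, ℝ), ℝ⟯) (x : M) :
    𝒜.deriv (𝒜.bracket s t) f x = 𝒜.deriv s (𝒜.deriv t f) x - 𝒜.deriv t (𝒜.deriv s f) x := by
  obtain ⟨v, hv⟩ := exists_ne (0 : F)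
  have hx := FiberBundle.mem_baseSet_trivializationAt' (F := F) (E := A) x
  let φ := (trivializationAt F A x).continuousLinearEquivAt ℝ x hx
  obtain ⟨r, hr⟩ := hext x (φ.symm v)
  have hr0 : r x ≠ 0 := by
    rw [hr]
    simpa using hv
  have hJ := 𝒜.jacobi s t (smulSection f r)
  have hJ0 := 𝒜.jacobi s t r
  rw [𝒜.bracket_skew (smulSection f r) s, 𝒜.bracket_skew (smulSection f r) (𝒜.bracket s t)] at hJ
  rw [𝒜.bracket_skew r s, 𝒜.bracket_skew r (𝒜.bracket s t)] at hJ0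
  simp only [𝒜.bracket_neg, 𝒜.bracket_smulSection, 𝒜.bracket_add] at hJ hJ0
  have h1 := congr($hJ x)
  have h0 := congr(f x • $hJ0 x)
  simp only [ContMDiffSection.coe_add, ContMDiffSection.coe_neg, Pi.add_apply, Pi.neg_apply,
    ContMDiffSection.coe_zero, Pi.zero_apply, smul_zero] at h1 h0
  have hs : ∀ (h : C^∞⟮𝓘(ℝ, E), M; 𝓘(ℝ, ℝ), ℝ⟯) (u : Cₛ^∞⟮𝓘(ℝ, E); F, A⟯),
      (smulSection h u) x = h x • u x := fun _ _ => rfl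
  simp only [hs] at h1
  -- the difference of the two sides is the coefficient of `r x` in the Jacobi identity
  have h2 : (𝒜.deriv s (𝒜.deriv t f) x - 𝒜.deriv t (𝒜.deriv s f) x
      - 𝒜.deriv (𝒜.bracket s t) f x) • r x = 0 := by
    rw [← h1, ← sub_zero (_ + _), ← h0]
    module
  rcases smul_eq_zero.1 h2 with h | h
  · linarith
  · exact absurd h hr0

end Anchor

/-! ### The anchor in local coordinates -/

section Coordinates

variable {E : Type*} [NormedAddCommGroup E] [NormedSpace ℝ E]
  {M : Type*} [TopologicalSpace M] [ChartedSpace E M] [IsManifold 𝓘(ℝ, E) ∞ M]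
  {F : Type*} [NormedAddCommGroup F] [NormedSpace ℝ F]
  {A : M → Type*} [TopologicalSpace (TotalSpace F A)]
  [∀ x, AddCommGroup (A x)] [∀ x, Module ℝ (A x)] [∀ x, TopologicalSpace (A x)]
  [∀ x, IsTopologicalAddGroup (A x)] [∀ x, ContinuousSMul ℝ (A x)]
  [FiberBundle F A] [VectorBundle ℝ F A] [ContMDiffVectorBundle ∞ F A 𝓘(ℝ, E)]

variable (E F A) in
/-- The open set around `p` on which both the preferred chart of `M` and the preferred
trivialization of `A` at `p` are defined. -/
def coordDomain (p : M) : Set M := (chartAt E p).source ∩ (trivializationAt F A p).baseSet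

variable (E F A) in
/-- The image of `coordDomain` in the chart at `p`. -/
def coordTarget (p : M) : Set E :=
  (extChartAt 𝓘(ℝ, E) p).target ∩ (extChartAt 𝓘(ℝ, E) p).symm ⁻¹' coordDomain E F A p

theorem isOpen_coordDomain (p : M) : IsOpen (coordDomain E F A p) :=
  (chartAt E p).open_source.inter (trivializationAt F A p).open_baseSet

theorem mem_coordDomain (p : M) : p ∈ coordDomain E F A p :=
  ⟨mem_chart_source E p, FiberBundle.mem_baseSet_trivializationAt' p⟩

theorem isOpen_coordTarget (p : M) : IsOpen (coordTarget E F A p) :=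
  (continuousOn_extChartAt_symm p).isOpen_inter_preimage (isOpen_extChartAt_target p)
    (isOpen_coordDomain p)

theorem extChartAt_mem_coordTarget {p x : M} (hx : x ∈ coordDomain E F A p) :
    extChartAt 𝓘(ℝ, E) p x ∈ coordTarget E F A p := by
  have hx' : x ∈ (extChartAt 𝓘(ℝ, E) p).source := by rw [extChartAt_source]; exact hx.1
  refine ⟨(extChartAt 𝓘(ℝ, E) p).map_source hx', ?_⟩
  rw [mem_preimage, (extChartAt 𝓘(ℝ, E) p).left_inv hx']
  exact hx

/-- The anchor in the chart and the trivialization at `p`. -/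
noncomputable def LieAlgebroid.anchorRep (𝒜 : LieAlgebroid E F A) (p : M) (y : E) : F →L[ℝ] E :=
  ContinuousLinearMap.inCoordinates F A E (fun x : M => TangentSpace 𝓘(ℝ, E) x)
    p ((extChartAt 𝓘(ℝ, E) p).symm y) p ((extChartAt 𝓘(ℝ, E) p).symm y)
    (𝒜.anchor ((extChartAt 𝓘(ℝ, E) p).symm y))

theorem LieAlgebroid.anchorRep_apply (𝒜 : LieAlgebroid E F A) {p x : M}
    (hx : x ∈ coordDomain E F A p) (e : F) :
    𝒜.anchorRep p (extChartAt 𝓘(ℝ, E) p x) e =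
      mfderiv 𝓘(ℝ, E) 𝓘(ℝ, E) (extChartAt 𝓘(ℝ, E) p) x
        (𝒜.anchor x ((trivializationAt F A p).symmL ℝ x e)) := by
  have hx' : x ∈ (extChartAt 𝓘(ℝ, E) p).source := by rw [extChartAt_source]; exact hx.1
  rw [← TangentBundle.continuousLinearMapAt_trivializationAt hx.1, LieAlgebroid.anchorRep,
    (extChartAt 𝓘(ℝ, E) p).left_inv hx']
  rfl

theorem trivialization_snd {p x : M} (hx : x ∈ (trivializationAt F A p).baseSet) (v : A x) :
    (trivializationAt F A p ⟨x, v⟩).2 = (trivializationAt F A p).continuousLinearMapAt ℝ x v := by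
  rw [Bundle.Trivialization.continuousLinearMapAt_apply,
    Bundle.Trivialization.coe_linearMapAt_of_mem _ hx]

theorem symmL_trivialization_snd {p x : M} (hx : x ∈ (trivializationAt F A p).baseSet) (v : A x) :
    (trivializationAt F A p).symmL ℝ x (trivializationAt F A p ⟨x, v⟩).2 = v := by
  rw [trivialization_snd hx, Bundle.Trivialization.symmL_continuousLinearMapAt _ hx]

theorem LieAlgebroid.anchorRep_snd (𝒜 : LieAlgebroid E F A) {p x : M}
    (hx : x ∈ coordDomain E F A p) (v : A x) :
    𝒜.anchorRep p (extChartAt 𝓘(ℝ, E) p x) (trivializationAt F A p ⟨x, v⟩).2 =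
      mfderiv 𝓘(ℝ, E) 𝓘(ℝ, E) (extChartAt 𝓘(ℝ, E) p) x (𝒜.anchor x v) := by
  rw [𝒜.anchorRep_apply hx, symmL_trivialization_snd hx.2]

theorem LieAlgebroid.contDiffOn_anchorRep (𝒜 : LieAlgebroid E F A) (p : M) :
    ContDiffOn ℝ ∞ (𝒜.anchorRep p) (coordTarget E F A p) := by
  set t := trivializationAt (F →L[ℝ] E) (fun x : M => A x →L[ℝ] TangentSpace 𝓘(ℝ, E) x) p
  have hbase : t.baseSet = (trivializationAt F A p).baseSet ∩ (chartAt E p).source := rfl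
  have h1 : ContMDiffOn 𝓘(ℝ, E) 𝓘(ℝ, F →L[ℝ] E) ∞ (fun x => (t ⟨x, 𝒜.anchor x⟩).2) t.baseSet :=
    (t.contMDiffOn_section_baseSet_iff).1 𝒜.contMDiff_anchor.contMDiffOn
  have h2 : ContMDiffOn 𝓘(ℝ, E) 𝓘(ℝ, F →L[ℝ] E) ∞ (𝒜.anchorRep p) (coordTarget E F A p) :=
    h1.comp ((contMDiffOn_extChartAt_symm (I := 𝓘(ℝ, E)) (n := ∞) p).mono inter_subset_left)
      fun y hy => by rw [hbase]; exact ⟨hy.2.2, hy.2.1⟩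
  exact h2.contDiffOn

/-- The derivative of a function given in the chart at `p`. -/
theorem mvfderiv_eq_of_eventuallyEq_comp_extChartAt {p x : M} (hx : x ∈ (chartAt E p).source)
    {h : M → ℝ} {k : E → ℝ} (hk : DifferentiableAt ℝ k (extChartAt 𝓘(ℝ, E) p x))
    (hh : h =ᶠ[𝓝 x] k ∘ extChartAt 𝓘(ℝ, E) p) (v : TangentSpace 𝓘(ℝ, E) x) :
    mvfderiv 𝓘(ℝ, E) h x v =
      fderiv ℝ k (extChartAt 𝓘(ℝ, E) p x)
        (mfderiv 𝓘(ℝ, E) 𝓘(ℝ, E) (extChartAt 𝓘(ℝ, E) p) x v) := by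
  have h1 : mfderiv 𝓘(ℝ, E) 𝓘(ℝ, ℝ) (k ∘ extChartAt 𝓘(ℝ, E) p) x =
      (mfderiv 𝓘(ℝ, E) 𝓘(ℝ, ℝ) k (extChartAt 𝓘(ℝ, E) p x)).comp
        (mfderiv 𝓘(ℝ, E) 𝓘(ℝ, E) (extChartAt 𝓘(ℝ, E) p) x) :=
    mfderiv_comp x hk.mdifferentiableAt (mdifferentiableAt_extChartAt hx)
  rw [mfderiv_eq_fderiv] at h1
  have h2 : mfderiv 𝓘(ℝ, E) 𝓘(ℝ, ℝ) h x = mfderiv 𝓘(ℝ, E) 𝓘(ℝ, ℝ) (k ∘ extChartAt 𝓘(ℝ, E) p) x :=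
    hh.mfderiv_eq
  show (mfderiv 𝓘(ℝ, E) 𝓘(ℝ, ℝ) h x v : ℝ) = _
  rw [h2, h1]
  rfl

section Involutive

variable [FiniteDimensional ℝ E] [T2Space M]

/-- The relation `[ρ e, ρ f] = ρ (c(e, f))` for the sections that are constant in the
trivialization at `p`. It is tested on the functions that are linear in the chart. -/
theorem LieAlgebroid.fderiv_anchorRep_sub (𝒜 : LieAlgebroid E F A) {p x : M}
    (hx : x ∈ coordDomain E F A p) {S : F → Cₛ^∞⟮𝓘(ℝ, E); F, A⟯}
    (hS : ∀ᶠ z in 𝓝 x, ∀ e, S e z = (trivializationAt F A p).symmL ℝ z e) (e f : F) :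
    fderiv ℝ (𝒜.anchorRep p) (extChartAt 𝓘(ℝ, E) p x)
        (𝒜.anchorRep p (extChartAt 𝓘(ℝ, E) p x) e) f
      - fderiv ℝ (𝒜.anchorRep p) (extChartAt 𝓘(ℝ, E) p x)
        (𝒜.anchorRep p (extChartAt 𝓘(ℝ, E) p x) f) e
      = 𝒜.anchorRep p (extChartAt 𝓘(ℝ, E) p x)
        (trivializationAt F A p ⟨x, 𝒜.bracket (S e) (S f) x⟩).2 := by
  rcases subsingleton_or_nontrivial F with hF | hF
  -- if the fibres are trivial, both sides vanish
  · rw [Subsingleton.elim e 0, Subsingleton.elim f 0,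
      Subsingleton.elim (trivializationAt F A p ⟨x, _⟩).2 0]
    simp
  set φ := extChartAt 𝓘(ℝ, E) p with hφ
  have hdiff : ∀ z ∈ coordDomain E F A p, DifferentiableAt ℝ (𝒜.anchorRep p) (φ z) := fun z hz =>
    (((𝒜.contDiffOn_anchorRep p).contDiffAt ((isOpen_coordTarget p).mem_nhds
      (extChartAt_mem_coordTarget hz))).differentiableAt (by simp))
  -- vectors are separated by linear forms
  refine SeparatingDual.eq_iff_forall_dual_eq (R := ℝ) |>.2 fun ℓ => ?_
  obtain ⟨h, hh⟩ := exists_contMDiffMap_eventuallyEq (E := E) (x := x) (h := ℓ ∘ φ)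
    (extChartAt_source_mem_nhds' (I := 𝓘(ℝ, E)) (x := p) (by rw [extChartAt_source]; exact hx.1))
    ((ℓ.contDiff.contMDiff).comp_contMDiffOn (by
      rw [extChartAt_source]; exact contMDiffOn_extChartAt (I := 𝓘(ℝ, E))))
  have hlin : ∀ z, fderiv ℝ ℓ z = ℓ := fun z => ℓ.fderiv
  have h1 : ∀ (s : Cₛ^∞⟮𝓘(ℝ, E); F, A⟯) (z : M), z ∈ coordDomain E F A p → h =ᶠ[𝓝 z] ℓ ∘ φ →
      𝒜.deriv s h z = ℓ (𝒜.anchorRep p (φ z) (trivializationAt F A p ⟨z, s z⟩).2) := by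
    intro s z hz hhz
    rw [𝒜.anchorRep_snd hz]
    have := mvfderiv_eq_of_eventuallyEq_comp_extChartAt hz.1 ℓ.differentiableAt hhz
      (𝒜.anchor z (s z))
    rw [hlin] at this
    exact this
  have hcoord : ∀ z ∈ coordDomain E F A p, ∀ e : F,
      (∀ e, S e z = (trivializationAt F A p).symmL ℝ z e) →
      (trivializationAt F A p ⟨z, S e z⟩).2 = e := by
    intro z hz e hSz
    rw [hSz, trivialization_snd hz.2, Bundle.Trivialization.continuousLinearMapAt_symmL _ hz.2]
  have h2 : ∀ e : F, 𝒜.deriv (S e) h =ᶠ[𝓝 x] (fun y => ℓ (𝒜.anchorRep p y e)) ∘ φ := by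
    intro e
    filter_upwards [(isOpen_coordDomain p).mem_nhds hx, hh.eventually_nhds, hS] with z hz hhz hSz
    rw [h1 (S e) z hz hhz, hcoord z hz e hSz]
    rfl
  have h3 : ∀ e f : F, 𝒜.deriv (S e) (𝒜.deriv (S f) h) x =
      ℓ (fderiv ℝ (𝒜.anchorRep p) (φ x) (𝒜.anchorRep p (φ x) e) f) := by
    intro e f
    have hd : HasFDerivAt (fun y => ℓ (𝒜.anchorRep p y f)) _ (φ x) :=
      ℓ.hasFDerivAt.comp (φ x) ((hdiff x hx).hasFDerivAt.clm_apply (hasFDerivAt_const f (φ x)))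
    have := mvfderiv_eq_of_eventuallyEq_comp_extChartAt hx.1 hd.differentiableAt (h2 f)
      (𝒜.anchor x (S e x))
    rw [hd.fderiv, ← hφ, ← 𝒜.anchorRep_snd hx, hcoord x hx e hS.self_of_nhds] at this
    refine Eq.trans this ?_
    simp [hφ]
  have h4 := 𝒜.deriv_bracket (fun y v => exists_section_apply_eq v) (S e) (S f) h x
  rw [h1 _ x hx hh, h3, h3] at h4
  rw [map_sub, h4]

variable [FiniteDimensional ℝ F]

/-- A family of bilinear maps on a finite dimensional space that is pointwise continuous at a point
is uniformly bounded near this point. -/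
theorem exists_bound_of_bilinear {X : Type*} [TopologicalSpace X] {c : X → F →ₗ[ℝ] F →ₗ[ℝ] F}
    {x : X} (hc : ∀ e f, ContinuousAt (fun y => c y e f) x) :
    ∃ C : ℝ, 0 ≤ C ∧ ∀ᶠ y in 𝓝 x, ∀ e f, ‖c y e f‖ ≤ C * ‖e‖ * ‖f‖ := by
  let b := Module.finBasis ℝ F
  let κ : Fin (Module.finrank ℝ F) → F →L[ℝ] ℝ := fun i => (b.coord i).toContinuousLinearMap
  have h1 : ∀ i j, ∀ᶠ y in 𝓝 x, ‖c y (b i) (b j)‖ ≤ ‖c x (b i) (b j)‖ + 1 := fun i j =>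
    ((hc (b i) (b j)).norm.eventually_lt continuousAt_const (lt_add_one _)).mono fun y hy => hy.le
  refine ⟨∑ i, ∑ j, ‖κ i‖ * ‖κ j‖ * (‖c x (b i) (b j)‖ + 1),
    Finset.sum_nonneg fun i _ => Finset.sum_nonneg fun j _ => by positivity, ?_⟩
  filter_upwards [Filter.eventually_all.2 fun i => Filter.eventually_all.2 (h1 i)] with y hy e f
  have hexp : c y e f = ∑ i, ∑ j, (κ i e * κ j f) • c y (b i) (b j) := by
    conv_lhs => rw [← b.sum_repr e, ← b.sum_repr f]
    simp only [map_sum, map_smul, LinearMap.sum_apply, LinearMap.smul_apply, Finset.smul_sum,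
      smul_smul]
    rw [Finset.sum_comm]
    refine Finset.sum_congr rfl fun i _ => Finset.sum_congr rfl fun j _ => ?_
    rw [mul_comm]; rfl
  rw [hexp, Finset.sum_mul, Finset.sum_mul]
  refine (norm_sum_le _ _).trans (Finset.sum_le_sum fun i _ => ?_)
  rw [Finset.sum_mul, Finset.sum_mul]
  refine (norm_sum_le _ _).trans (Finset.sum_le_sum fun j _ => ?_)
  rw [norm_smul, norm_mul]
  calc ‖κ i e‖ * ‖κ j f‖ * ‖c y (b i) (b j)‖
      ≤ (‖κ i‖ * ‖e‖) * (‖κ j‖ * ‖f‖) * (‖c x (b i) (b j)‖ + 1) := by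
        gcongr
        · exact (κ i).le_opNorm e
        · exact (κ j).le_opNorm f
        · exact hy i j
    _ = _ := by ring

theorem LieAlgebroid.bracket_add_left (𝒜 : LieAlgebroid E F A) (s s' t : Cₛ^∞⟮𝓘(ℝ, E); F, A⟯) :
    𝒜.bracket (s + s') t = 𝒜.bracket s t + 𝒜.bracket s' t := by
  rw [𝒜.bracket_skew, 𝒜.bracket_add, neg_add, ← 𝒜.bracket_skew, ← 𝒜.bracket_skew]

theorem LieAlgebroid.bracket_smul_left (𝒜 : LieAlgebroid E F A) (c : ℝ)
    (s t : Cₛ^∞⟮𝓘(ℝ, E); F, A⟯) : 𝒜.bracket (c • s) t = c • 𝒜.bracket s t := by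
  rw [𝒜.bracket_skew, 𝒜.bracket_smul, ← smul_neg, ← 𝒜.bracket_skew]

/-- Near every point, the anchor in coordinates is involutive in the sense of `InvolutiveAnchor`. -/
theorem LieAlgebroid.exists_involutiveAnchor (𝒜 : LieAlgebroid E F A) (p : M) :
    ∃ c Ω C, InvolutiveAnchor (𝒜.anchorRep p) c Ω C ∧ extChartAt 𝓘(ℝ, E) p p ∈ Ω ∧
      Ω ⊆ coordTarget E F A p := by
  obtain ⟨S, hS⟩ := exists_frame E F A p
  set t := trivializationAt F A p
  set φ := extChartAt 𝓘(ℝ, E) p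
  -- the structure functions of the constant sections
  let c : E → F →ₗ[ℝ] F →ₗ[ℝ] F := fun y => LinearMap.mk₂ ℝ
    (fun e f => t.continuousLinearMapAt ℝ (φ.symm y) (𝒜.bracket (S e) (S f) (φ.symm y)))
    (fun e e' f => by rw [map_add, 𝒜.bracket_add_left, ContMDiffSection.coe_add, Pi.add_apply,
      map_add])
    (fun r e f => by rw [map_smul, 𝒜.bracket_smul_left, ContMDiffSection.coe_smul, Pi.smul_apply,
      map_smul])
    (fun e f f' => by rw [map_add, 𝒜.bracket_add, ContMDiffSection.coe_add, Pi.add_apply,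
      map_add])
    (fun r e f => by rw [map_smul, 𝒜.bracket_smul, ContMDiffSection.coe_smul, Pi.smul_apply,
      map_smul])
  have hsymm : φ.symm (φ p) = p := extChartAt_to_inv p
  have hφc : ContinuousAt φ.symm (φ p) := continuousAt_extChartAt_symm p
  have hcont : ∀ e f, ContinuousAt (fun y => c y e f) (φ p) := by
    intro e f
    have h1 : ContinuousAt (fun x => (t ⟨x, 𝒜.bracket (S e) (S f) x⟩).2) (φ.symm (φ p)) := by
      rw [hsymm]
      exact ((contMDiffAt_section p).1 (𝒜.bracket (S e) (S f)).contMDiff.contMDiffAt).continuousAt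
    refine (h1.comp hφc).congr ?_
    have : t.baseSet ∈ 𝓝 (φ.symm (φ p)) := by
      rw [hsymm]; exact t.open_baseSet.mem_nhds (FiberBundle.mem_baseSet_trivializationAt' p)
    filter_upwards [hφc this] with y hy
    exact trivialization_snd hy _
  obtain ⟨C, hC, hbound⟩ := exists_bound_of_bilinear hcont
  have hS' : ∀ᶠ y in 𝓝 (φ p), ∀ᶠ z in 𝓝 (φ.symm y), ∀ e, S e z = t.symmL ℝ z e := by
    refine hφc.eventually (p := fun x => ∀ᶠ z in 𝓝 x, ∀ e, S e z = t.symmL ℝ z e) ?_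
    rw [hsymm]
    exact hS.eventually_nhds
  obtain ⟨Ω, hΩsub, hΩo, hpΩ⟩ := mem_nhds_iff.1 ((hbound.and hS').and
    ((isOpen_coordTarget (F := F) (A := A) p).eventually_mem
      (extChartAt_mem_coordTarget (mem_coordDomain p))))
  refine ⟨fun y e f => c y e f, Ω, C, ⟨hΩo, (𝒜.contDiffOn_anchorRep p).mono
    fun y hy => (hΩsub hy).2, hC, fun y hy => (hΩsub hy).1.1, fun y hy e f => ?_⟩, hpΩ,
    fun y hy => (hΩsub hy).2⟩
  obtain ⟨⟨-, h1⟩, h2⟩ := hΩsub hy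
  have := 𝒜.fderiv_anchorRep_sub h2.2 h1 e f
  rw [(extChartAt 𝓘(ℝ, E) p).right_inv h2.1, trivialization_snd h2.2.2] at this
  exact this

end Involutive

end Coordinates

/-! ### Paths of a Lie algebroid -/

section APaths

variable {E : Type*} [NormedAddCommGroup E] [NormedSpace ℝ E]
  {M : Type*} [TopologicalSpace M] [ChartedSpace E M] [IsManifold 𝓘(ℝ, E) ∞ M]
  {F : Type*} [NormedAddCommGroup F] [NormedSpace ℝ F]
  {A : M → Type*} [TopologicalSpace (TotalSpace F A)]
  [∀ x, AddCommGroup (A x)] [∀ x, Module ℝ (A x)] [∀ x, TopologicalSpace (A x)]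
  [∀ x, IsTopologicalAddGroup (A x)] [∀ x, ContinuousSMul ℝ (A x)]
  [FiberBundle F A] [VectorBundle ℝ F A] [ContMDiffVectorBundle ∞ F A 𝓘(ℝ, E)]

variable {𝒜 : LieAlgebroid E F A}

/-- Affine changes of the time parameter preserve `A`-paths. With `c = -1`, `d = 1` the path is
reversed; with other constants it is restricted to a subinterval. -/
theorem LieAlgebroid.IsAPath.comp_affine {a : ℝ → TotalSpace F A} (ha : 𝒜.IsAPath a) {c d : ℝ}
    (h : MapsTo (fun t => c * t + d) (Icc (0 : ℝ) 1) (Icc (0 : ℝ) 1)) :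
    𝒜.IsAPath (fun t => ⟨(a (c * t + d)).proj, c • (a (c * t + d)).2⟩) := by
  have hdiff : ContMDiff 𝓘(ℝ, ℝ) 𝓘(ℝ, ℝ) ∞ (fun t : ℝ => c * t + d) :=
    ((contDiff_const.mul contDiff_id).add contDiff_const).contMDiff
  have h1 : ContMDiffOn 𝓘(ℝ, ℝ) (𝓘(ℝ, E).prod 𝓘(ℝ, F)) ∞ (fun t => a (c * t + d)) (Icc 0 1) :=
    ha.1.comp hdiff.contMDiffOn h
  refine ⟨fun t ht => ?_, fun t ht => ?_⟩
  · obtain ⟨h2, h3⟩ := (contMDiffWithinAt_totalSpace).1 (h1 t ht)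
    refine (contMDiffWithinAt_totalSpace).2 ⟨h2, ?_⟩
    have h4 : ContMDiff 𝓘(ℝ, F) 𝓘(ℝ, F) ∞ (fun f : F => c • f) :=
      (contDiff_const.smul contDiff_id).contMDiff
    refine (h4.contMDiffAt.comp_contMDiffWithinAt t h3).congr_of_eventuallyEq ?_ ?_
    · filter_upwards [h2.continuousWithinAt ((trivializationAt F A
        (a (c * t + d)).proj).open_baseSet.mem_nhds
          (FiberBundle.mem_baseSet_trivializationAt' _))] with s hs
      exact ((trivializationAt F A (a (c * t + d)).proj).linear ℝ hs).map_smul c _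
    · exact ((trivializationAt F A (a (c * t + d)).proj).linear ℝ
        (FiberBundle.mem_baseSet_trivializationAt' _)).map_smul c _
  · have h2 := ha.2 _ (h ht)
    have h3 : HasMFDerivWithinAt 𝓘(ℝ, ℝ) 𝓘(ℝ, ℝ) (fun t : ℝ => c * t + d) (Icc 0 1) t
        ((1 : ℝ →L[ℝ] ℝ).smulRight c) := by
      have : HasDerivWithinAt (fun t : ℝ => c * t + d) c (Icc 0 1) t := by
        simpa using (((hasDerivAt_id t).const_mul c).add_const d).hasDerivWithinAt
      exact this.hasFDerivWithinAt.hasMFDerivWithinAt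
    refine (HasMFDerivWithinAt.comp t h2 h3 h.subset_preimage).congr_mfderiv ?_
    refine ContinuousLinearMap.ext fun (r : ℝ) => ?_
    have h4 : 𝒜.anchor (a (c * t + d)).proj (c • (a (c * t + d)).2) =
      c • 𝒜.anchor (a (c * t + d)).proj (a (c * t + d)).2 := map_smul _ _ _
    show (r • c) • (𝒜.anchor (a (c * t + d)).proj (a (c * t + d)).2 : E) =
      r • (𝒜.anchor (a (c * t + d)).proj (c • (a (c * t + d)).2) : E)
    rw [h4]
    exact smul_assoc r c (M := ℝ) (α := E) _

theorem LieAlgebroid.IsAPath.continuousOn_proj {a : ℝ → TotalSpace F A} (ha : 𝒜.IsAPath a) :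
    ContinuousOn (fun t => (a t).proj) (Icc 0 1) :=
  fun t ht => (ha.2 t ht).continuousWithinAt

/-- An `A`-path in local coordinates. -/
theorem LieAlgebroid.IsAPath.hasDerivWithinAt_coord {a : ℝ → TotalSpace F A} (ha : 𝒜.IsAPath a)
    {p : M} {t : ℝ} (ht : t ∈ Icc (0 : ℝ) 1) (hp : (a t).proj ∈ coordDomain E F A p) :
    HasDerivWithinAt (fun s => extChartAt 𝓘(ℝ, E) p (a s).proj)
      (𝒜.anchorRep p (extChartAt 𝓘(ℝ, E) p (a t).proj) (trivializationAt F A p (a t)).2)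
      (Icc 0 1) t := by
  have h1 := (mdifferentiableAt_extChartAt (I := 𝓘(ℝ, E)) hp.1).hasMFDerivAt
  have h2 := (HasMFDerivAt.comp_hasMFDerivWithinAt t h1 (ha.2 t ht))
  have h3 : HasFDerivWithinAt (fun s => extChartAt 𝓘(ℝ, E) p (a s).proj)
    (_ : ℝ →L[ℝ] E) (Icc 0 1) t := h2.hasFDerivWithinAt
  refine h3.hasDerivWithinAt.congr_deriv ?_
  refine Eq.trans ?_ (𝒜.anchorRep_snd hp (a t).2).symm
  exact congrArg _ (one_smul ℝ (𝒜.anchor (a t).proj (a t).2 : E))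

theorem LieAlgebroid.IsAPath.continuousOn_coord {a : ℝ → TotalSpace F A} (ha : 𝒜.IsAPath a)
    {p : M} (hp : ∀ t ∈ Icc (0 : ℝ) 1, (a t).proj ∈ coordDomain E F A p) :
    ContinuousOn (fun s => (trivializationAt F A p (a s)).2) (Icc 0 1) :=
  continuousOn_snd.comp ((trivializationAt F A p).continuousOn.comp ha.1.continuousOn
    fun t ht => ((trivializationAt F A p).mem_source).2 (hp t ht).2) (mapsTo_univ _ _)

theorem LieAlgebroid.mfderiv_symm_anchorRep (𝒜 : LieAlgebroid E F A) {p : M} {y : E}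
    (hy : y ∈ coordTarget E F A p) (f : F) :
    mfderiv 𝓘(ℝ, E) 𝓘(ℝ, E) (extChartAt 𝓘(ℝ, E) p).symm y (𝒜.anchorRep p y f) =
      𝒜.anchor ((extChartAt 𝓘(ℝ, E) p).symm y)
        ((trivializationAt F A p).symmL ℝ ((extChartAt 𝓘(ℝ, E) p).symm y) f) := by
  have h2 := 𝒜.anchorRep_apply hy.2 f
  rw [(extChartAt 𝓘(ℝ, E) p).right_inv hy.1] at h2
  have h3 := mfderivWithin_extChartAt_symm_comp_mfderiv_extChartAt (I := 𝓘(ℝ, E)) hy.1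
  rw [ModelWithCorners.Boundaryless.range_eq_univ, mfderivWithin_univ] at h3
  rw [h2]
  exact DFunLike.congr_fun h3 _

/-- A solution of `y' = ρ(y) α` in local coordinates gives an `A`-path. -/
theorem LieAlgebroid.isAPath_of_coord (𝒜 : LieAlgebroid E F A) {p : M} {y : ℝ → E} {α : ℝ → F}
    (hy : ContDiffOn ℝ ∞ y (Icc 0 1)) (hα : ContDiffOn ℝ ∞ α (Icc 0 1))
    (hmem : ∀ t ∈ Icc (0 : ℝ) 1, y t ∈ coordTarget E F A p)
    (hder : ∀ t ∈ Icc (0 : ℝ) 1, HasDerivWithinAt y (𝒜.anchorRep p (y t) (α t)) (Icc 0 1) t) :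
    𝒜.IsAPath (fun t => ⟨(extChartAt 𝓘(ℝ, E) p).symm (y t),
      (trivializationAt F A p).symmL ℝ ((extChartAt 𝓘(ℝ, E) p).symm (y t)) (α t)⟩) := by
  set φ := extChartAt 𝓘(ℝ, E) p
  set e := trivializationAt F A p
  have hx : ContMDiffOn 𝓘(ℝ, ℝ) 𝓘(ℝ, E) ∞ (fun t => φ.symm (y t)) (Icc 0 1) :=
    (contMDiffOn_extChartAt_symm p).comp hy.contMDiffOn fun t ht => (hmem t ht).1
  refine ⟨?_, fun t ht => ?_⟩
  · refine (e.contMDiffOn_iff (fun t ht => e.mem_source.2 (hmem t ht).2.2)).2 ⟨hx, ?_⟩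
    refine hα.contMDiffOn.congr fun t ht => ?_
    rw [trivialization_snd (hmem t ht).2.2,
      Bundle.Trivialization.continuousLinearMapAt_symmL _ (hmem t ht).2.2]
  · have h1 : HasMFDerivWithinAt 𝓘(ℝ, ℝ) 𝓘(ℝ, E) (fun t => φ.symm (y t)) (Icc 0 1) t _ :=
      HasMFDerivAt.comp_hasMFDerivWithinAt (x := t)
        (((contMDiffOn_extChartAt_symm (I := 𝓘(ℝ, E)) (n := ∞) p).contMDiffAt
          ((isOpen_extChartAt_target p).mem_nhds (hmem t ht).1)).mdifferentiableAt
            (by simp)).hasMFDerivAt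
        (hder t ht).hasFDerivWithinAt.hasMFDerivWithinAt
    refine h1.congr_mfderiv ?_
    have h4 := 𝒜.mfderiv_symm_anchorRep (hmem t ht) (α t)
    refine ContinuousLinearMap.ext fun (r : ℝ) => ?_
    show (mfderiv 𝓘(ℝ, E) 𝓘(ℝ, E) φ.symm (y t) (r • 𝒜.anchorRep p (y t) (α t)) : E) =
      r • (𝒜.anchor (φ.symm (y t)) (e.symmL ℝ (φ.symm (y t)) (α t)) : E)
    exact (ContinuousLinearMap.map_smul (mfderiv 𝓘(ℝ, E) 𝓘(ℝ, E) φ.symm (y t)) r _).trans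
      (congrArg (fun v : E => r • v) h4)

/-- The rank of the anchor at a point, which is the dimension of the orbit. -/
noncomputable def LieAlgebroid.rank (𝒜 : LieAlgebroid E F A) (p : M) : ℕ :=
  Module.finrank ℝ (LinearMap.range (𝒜.anchor p).toLinearMap)

theorem LieAlgebroid.finrank_range_anchorRep (𝒜 : LieAlgebroid E F A) (p : M) :
    Module.finrank ℝ (LinearMap.range
      (𝒜.anchorRep p (extChartAt 𝓘(ℝ, E) p p) : F →ₗ[ℝ] E)) = 𝒜.rank p := by
  have h : LinearMap.range (𝒜.anchorRep p (extChartAt 𝓘(ℝ, E) p p) : F →ₗ[ℝ] E) =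
      (LinearMap.range (𝒜.anchor p).toLinearMap : Submodule ℝ E) := by
    have hid : ∀ e, 𝒜.anchorRep p (extChartAt 𝓘(ℝ, E) p p) e =
        𝒜.anchor p ((trivializationAt F A p).symmL ℝ p e) := by
      intro e
      rw [𝒜.anchorRep_apply (mem_coordDomain p), mfderiv_extChartAt_self]
      rfl
    ext v
    constructor
    · rintro ⟨e, rfl⟩
      exact ⟨_, (hid e).symm⟩
    · rintro ⟨w, rfl⟩
      refine ⟨(trivializationAt F A p ⟨p, w⟩).2, (hid _).trans ?_⟩
      rw [symmL_trivialization_snd (mem_coordDomain (E := E) p).2]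
      rfl
  rw [h]
  rfl

open Metric

/-- A piece of an orbit around `p`, parametrized by a ball of `ℝᵏ`. The parametrization `param` has
a left inverse `proj` that is defined and smooth on an open set `nhd` of `M`. Two points of the
plaque are joined by an `A`-path along the image of a line segment, and `A`-paths that stay in `nhd`
cannot leave the plaque. -/
structure Plaque (𝒜 : LieAlgebroid E F A) (k : ℕ) (p : M) where
  /-- The radius of the ball. -/
  radius : ℝ
  radius_pos : 0 < radius
  /-- The parametrization. -/
  param : EuclideanSpace ℝ (Fin k) → M
  /-- The left inverse of the parametrization. -/
  proj : M → EuclideanSpace ℝ (Fin k)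
  /-- The domain of the left inverse. -/
  nhd : Set M
  isOpen_nhd : IsOpen nhd
  contMDiffOn_proj : ContMDiffOn 𝓘(ℝ, E) (𝓡 k) ∞ proj nhd
  contMDiffOn_param : ContMDiffOn (𝓡 k) 𝓘(ℝ, E) ∞ param (ball 0 radius)
  param_zero : param 0 = p
  mapsTo_param : MapsTo param (ball 0 radius) nhd
  mapsTo_proj : MapsTo proj nhd (ball 0 radius)
  proj_param : ∀ v ∈ ball 0 radius, proj (param v) = v
  range_mfderiv_param : ∀ v ∈ ball 0 radius,
    range (mfderiv (𝓡 k) 𝓘(ℝ, E) param v) = range (𝒜.anchor (param v))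
  exists_path : ∀ v ∈ ball 0 radius, ∀ w ∈ ball 0 radius, ∃ a, 𝒜.IsAPath a ∧
    ∀ t ∈ Icc (0 : ℝ) 1, (a t).proj = param (v + t • (w - v))
  mem_of_path : ∀ a, 𝒜.IsAPath a → (∀ t ∈ Icc (0 : ℝ) 1, (a t).proj ∈ nhd) →
    (a 0).proj ∈ param '' ball 0 radius → ∀ t ∈ Icc (0 : ℝ) 1, (a t).proj ∈ param '' ball 0 radius

/-- The local leaf in coordinates, transported to `M`, is a plaque. -/
theorem LieAlgebroid.nonempty_plaque [FiniteDimensional ℝ E] [FiniteDimensional ℝ F] [T2Space M]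
    (𝒜 : LieAlgebroid E F A) (p : M) : Nonempty (Plaque 𝒜 (𝒜.rank p) p) := by
  obtain ⟨c, Ω, C, hinv, hpΩ, hΩ⟩ := 𝒜.exists_involutiveAnchor p
  set φ := extChartAt 𝓘(ℝ, E) p with hφ
  set k := 𝒜.rank p with hk
  have hrank : Module.finrank ℝ (LinearMap.range (𝒜.anchorRep p (φ p) : F →ₗ[ℝ] E)) =
      Module.finrank ℝ (EuclideanSpace ℝ (Fin k)) := by
    rw [finrank_euclideanSpace_fin, hk, hφ, 𝒜.finrank_range_anchorRep]
  obtain ⟨σ, q, hq⟩ := exists_section_proj (𝒜.anchorRep p (φ p)) hrank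
  have hinvert : (q ∘L 𝒜.anchorRep p (φ p) ∘L σ).IsInvertible := by
    rw [hq]; exact ⟨ContinuousLinearEquiv.refl ℝ _, rfl⟩
  obtain ⟨R, K, m, hball, hR⟩ := hinv.exists_leafBall hpΩ hinvert
  obtain ⟨r, hr, U, hU0, hUsmooth, hU, hpath⟩ :=
    hball.exists_leaf (defect_eq_zero_of_finrank hinvert hrank)
  have htarget : ∀ v ∈ ball (0 : EuclideanSpace ℝ (Fin k)) r, U v ∈ coordTarget E F A p :=
    fun v hv => hΩ (hR (hU v hv).1)
  have hsymm : ContMDiffOn 𝓘(ℝ, E) 𝓘(ℝ, E) ∞ φ.symm φ.target := contMDiffOn_extChartAt_symm p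
  have hright : ∀ v ∈ ball (0 : EuclideanSpace ℝ (Fin k)) r, φ (φ.symm (U v)) = U v :=
    fun v hv => φ.right_inv (htarget v hv).1
  have hball_cont : IsOpen {y | y ∈ ball (φ p) R ∧ q y - q (φ p) ∈ ball 0 r} :=
    isOpen_ball.inter (isOpen_ball.preimage (q.continuous.sub continuous_const))
  refine ⟨⟨r, hr, fun v => φ.symm (U v), fun x => q (φ x) - q (φ p),
    coordDomain E F A p ∩ (φ.source ∩ φ ⁻¹' {y | y ∈ ball (φ p) R ∧ q y - q (φ p) ∈ ball 0 r}),
    (isOpen_coordDomain p).inter ((continuousOn_extChartAt p).isOpen_inter_preimage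
      (isOpen_extChartAt_source p) hball_cont), ?_, ?_, ?_, ?_, ?_, ?_, ?_, ?_, ?_⟩⟩
  · refine ContMDiffOn.comp (t := univ) (g := fun y => q y - q (φ p))
      (q.contDiff.sub contDiff_const).contMDiff.contMDiffOn
      (contMDiffOn_extChartAt.mono fun x hx => hx.1.1) (fun _ _ => mem_univ _)
  · exact hsymm.comp hUsmooth.contMDiffOn fun v hv => (htarget v hv).1
  · simp only [hU0]; exact extChartAt_to_inv p
  · intro v hv
    refine ⟨(htarget v hv).2, φ.map_target (htarget v hv).1, ?_, ?_⟩
    · rw [hright v hv]; exact (hU v hv).1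
    · rw [hright v hv, (hU v hv).2.1]; simpa using hv
  · exact fun x hx => hx.2.2.2
  · intro v hv
    simp only [hright v hv, (hU v hv).2.1]
    simp
  · intro v hv
    set D : EuclideanSpace ℝ (Fin k) →L[ℝ] E := spanMap (𝒜.anchorRep p) σ q (U v)
    have h0 : HasMFDerivAt (𝓡 k) 𝓘(ℝ, E) U v D :=
      (hU v hv).2.2.1.hasMFDerivAt
    have h1 : mfderiv (𝓡 k) 𝓘(ℝ, E) (fun v => φ.symm (U v)) v =
        (mfderiv 𝓘(ℝ, E) 𝓘(ℝ, E) φ.symm (U v)).comp D :=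
      (HasMFDerivAt.comp v ((hsymm.contMDiffAt ((isOpen_extChartAt_target p).mem_nhds
        (htarget v hv).1)).mdifferentiableAt (by simp)).hasMFDerivAt h0).mfderiv
    have h2 : range D = range (𝒜.anchorRep p (U v)) :=
      range_spanMap_of_defect_eq_zero (hU v hv).2.2.2
    rw [h1]
    ext w
    constructor
    · rintro ⟨u, rfl⟩
      obtain ⟨f, hf⟩ : D u ∈ range (𝒜.anchorRep p (U v)) := by
        rw [← h2]; exact mem_range_self u
      refine ⟨_, (𝒜.mfderiv_symm_anchorRep (htarget v hv) f).symm.trans ?_⟩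
      rw [hf]
      rfl
    · rintro ⟨f, rfl⟩
      obtain ⟨u, hu⟩ : 𝒜.anchorRep p (U v) (trivializationAt F A p ⟨φ.symm (U v), f⟩).2 ∈
          range D := by
        rw [h2]; exact mem_range_self _
      have h3 := 𝒜.mfderiv_symm_anchorRep (htarget v hv)
        (trivializationAt F A p ⟨φ.symm (U v), f⟩).2
      rw [symmL_trivialization_snd (htarget v hv).2.2, ← hu] at h3
      exact ⟨u, h3⟩
  · intro v hv w hw
    have hline : ∀ t ∈ Icc (0 : ℝ) 1, v + t • (w - v) ∈ ball (0 : EuclideanSpace ℝ (Fin k)) r :=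
      fun t ht => (convex_ball _ _).add_smul_sub_mem hv hw ht
    have hline' : ContDiff ℝ ∞ (fun t : ℝ => v + t • (w - v)) :=
      contDiff_const.add (contDiff_id.smul contDiff_const)
    have hy : ContDiffOn ℝ ∞ (fun t : ℝ => U (v + t • (w - v))) (Icc 0 1) :=
      hUsmooth.comp hline'.contDiffOn hline
    refine ⟨_, 𝒜.isAPath_of_coord (p := p) (y := fun t => U (v + t • (w - v)))
      (α := fun t => liftMap (𝒜.anchorRep p) σ q (U (v + t • (w - v))) (w - v)) hy ?_
      (fun t ht => htarget _ (hline t ht)) ?_, fun t ht => rfl⟩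
    · intro t ht
      have h1 := (hU _ (hline t ht)).1
      exact ((contDiffAt_liftMap (hball.contDiffAt _ h1)
        (hball.invertible _ h1)).comp_contDiffWithinAt t (hy t ht)).clm_apply contDiffWithinAt_const
    · intro t ht
      have h1 : HasDerivAt (fun t : ℝ => v + t • (w - v)) (w - v) t := by
        simpa using ((hasDerivAt_id t).smul_const (w - v)).const_add v
      exact ((hU _ (hline t ht)).2.2.1.comp_hasDerivAt t h1).hasDerivWithinAt
  · intro a ha hmem h0 t ht
    have hdom : ∀ t ∈ Icc (0 : ℝ) 1, (a t).proj ∈ coordDomain E F A p := fun t ht => (hmem t ht).1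
    obtain ⟨B, hB⟩ := (isCompact_Icc.image_of_continuousOn
      (ha.continuousOn_coord hdom).norm).bddAbove
    have h1 := hpath (fun t => φ (a t).proj) (fun t => (trivializationAt F A p (a t)).2) B
      (fun t ht => hB (mem_image_of_mem _ ht))
      (fun t ht => ha.hasDerivWithinAt_coord ht (hdom t ht))
      (fun t ht => (hmem t ht).2.2.1) (fun t ht => (hmem t ht).2.2.2) ?_ t ht
    · obtain ⟨v, hv, hvt⟩ := h1
      refine ⟨v, hv, ?_⟩
      show φ.symm (U v) = _
      rw [hvt, φ.left_inv (hmem t ht).2.1]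
    · obtain ⟨v, hv, hv0⟩ := h0
      refine ⟨v, hv, ?_⟩
      show U v = φ (a 0).proj
      rw [← hv0, hright v hv]

end APaths

/-! ### The theorem of Poincaré and Volterra -/

section PoincareVolterra

open TopologicalSpace

/-- A set of disjoint open sets, all of which meet a given second countable set, is countable. -/
theorem countable_of_pairwiseDisjoint_of_inter_nonempty {X : Type*} [TopologicalSpace X]
    {V : Set X} [SecondCountableTopology V] {𝒞 : Set (Set X)} (hdisj : 𝒞.PairwiseDisjoint id)
    (hopen : ∀ W ∈ 𝒞, IsOpen W) (hmeet : ∀ W ∈ 𝒞, (V ∩ W).Nonempty) : 𝒞.Countable := by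
  refine Set.PairwiseDisjoint.countable_of_isOpen (α := V)
    (s := fun W : Set X => (Subtype.val ⁻¹' W : Set V)) (a := 𝒞) ?_ ?_ ?_
  · exact fun W hW W' hW' hne => (hdisj hW hW' hne).preimage _
  · exact fun W hW => (hopen W hW).preimage continuous_subtype_val
  · intro W hW
    obtain ⟨x, hx, hxW⟩ := hmeet W hW
    exact ⟨⟨x, hx⟩, hxW⟩

/-- If a connected space is covered by a family of nonempty open sets, each of which meets only
countably many others, then countably many of them cover the space. -/
theorem exists_countable_subcover_of_connectedSpace {X : Type*} [TopologicalSpace X]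
    [ConnectedSpace X] {𝒱 : Set (Set X)} (hopen : ∀ V ∈ 𝒱, IsOpen V) (hcover : ⋃₀ 𝒱 = univ)
    (hcount : ∀ V ∈ 𝒱, {W ∈ 𝒱 | (V ∩ W).Nonempty}.Countable) :
    ∃ 𝒲 ⊆ 𝒱, 𝒲.Countable ∧ ⋃₀ 𝒲 = univ := by
  obtain ⟨x₀⟩ := (inferInstance : Nonempty X)
  obtain ⟨V₀, hV₀, hx₀⟩ : x₀ ∈ ⋃₀ 𝒱 := hcover ▸ mem_univ x₀
  -- the sets that are reached from `V₀` in `n` steps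
  let S : ℕ → Set (Set X) := fun n =>
    Nat.rec {V₀} (fun _ S => ⋃ V ∈ S, {W ∈ 𝒱 | (V ∩ W).Nonempty}) n
  have hsucc : ∀ n, S (n + 1) = ⋃ V ∈ S n, {W ∈ 𝒱 | (V ∩ W).Nonempty} := fun n => rfl
  have hS : ∀ n, S n ⊆ 𝒱 := by
    intro n
    induction n with
    | zero => exact singleton_subset_iff.2 hV₀
    | succ n ih =>
      rw [hsucc]
      exact iUnion₂_subset fun V _ W hW => hW.1
  have hSc : ∀ n, (S n).Countable := by
    intro n
    induction n with
    | zero => exact countable_singleton _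
    | succ n ih =>
      rw [hsucc]
      exact ih.biUnion fun V hV => hcount V (hS n hV)
  refine ⟨⋃ n, S n, iUnion_subset hS, countable_iUnion hSc, ?_⟩
  have hclopen : IsClopen (⋃₀ ⋃ n, S n) := by
    refine ⟨⟨?_⟩, isOpen_sUnion fun V hV => hopen V (iUnion_subset hS hV)⟩
    rw [isOpen_iff_mem_nhds]
    intro x hx
    obtain ⟨W, hW, hxW⟩ : x ∈ ⋃₀ 𝒱 := hcover ▸ mem_univ x
    refine Filter.mem_of_superset ((hopen W hW).mem_nhds hxW) fun y hyW hy => hx ?_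
    obtain ⟨V, hV, hyV⟩ := hy
    obtain ⟨n, hn⟩ := mem_iUnion.1 hV
    refine ⟨W, mem_iUnion.2 ⟨n + 1, ?_⟩, hxW⟩
    rw [hsucc]
    exact mem_iUnion₂.2 ⟨V, hn, hW, y, hyV, hyW⟩
  exact hclopen.eq_univ ⟨x₀, V₀, mem_iUnion.2 ⟨0, rfl⟩, hx₀⟩

/-- A connected and locally connected space `X` is second countable if it has a continuous map `f`
to a second countable space, such that every point of `X` has a second countable open neighbourhood
that is relatively closed in the preimage of an open set. The cover to which the chain argument
applies consists of the connected components of the preimages of basic open sets. -/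
theorem secondCountableTopology_of_continuous {X Y : Type*} [TopologicalSpace X]
    [TopologicalSpace Y] [ConnectedSpace X] [LocallyConnectedSpace X] [SecondCountableTopology Y]
    {f : X → Y} (hf : Continuous f)
    (h : ∀ x, ∃ N : Set Y, IsOpen N ∧ f x ∈ N ∧ ∃ W : Set X, x ∈ W ∧ IsOpen W ∧
      SecondCountableTopology W ∧ closure W ∩ f ⁻¹' N ⊆ W) : SecondCountableTopology X := by
  let 𝒱 : Set (Set X) := {V | SecondCountableTopology V ∧ ∃ U ∈ countableBasis Y, ∃ x, f x ∈ U ∧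
    V = connectedComponentIn (f ⁻¹' U) x}
  have hopen : ∀ V ∈ 𝒱, IsOpen V := by
    rintro V ⟨-, U, hU, x, -, rfl⟩
    exact ((isOpen_of_mem_countableBasis hU).preimage hf).connectedComponentIn
  have hcover : ⋃₀ 𝒱 = univ := by
    refine eq_univ_of_forall fun x => ?_
    obtain ⟨N, hN, hxN, W, hxW, hW, hW2, hWN⟩ := h x
    obtain ⟨U, hU, hxU, hUN⟩ := (isBasis_countableBasis Y).exists_subset_of_mem_open hxN hN
    have hxV : x ∈ connectedComponentIn (f ⁻¹' U) x := mem_connectedComponentIn hxU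
    -- as `W` is relatively clopen over `U ⊆ N`, it contains the component of `x`
    have hVW : connectedComponentIn (f ⁻¹' U) x ⊆ W := by
      refine isPreconnected_connectedComponentIn.subset_left_of_subset_union hW
        isClosed_closure.isOpen_compl (disjoint_compl_right.mono_left subset_closure)
        (fun y hy => ?_) ⟨x, hxV, hxW⟩
      by_cases hyW : y ∈ closure W
      · exact Or.inl (hWN ⟨hyW, hUN (connectedComponentIn_subset (f ⁻¹' U) x hy)⟩)
      · exact Or.inr hyW
    exact ⟨_, ⟨(Topology.IsEmbedding.inclusion hVW).secondCountableTopology, U, hU, x, hxU, rfl⟩,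
      hxV⟩
  have hcount : ∀ V ∈ 𝒱, {W ∈ 𝒱 | (V ∩ W).Nonempty}.Countable := by
    intro V hV
    have := hV.1
    have hsub : {W ∈ 𝒱 | (V ∩ W).Nonempty} ⊆ ⋃ U ∈ countableBasis Y,
        {W | (∃ x, f x ∈ U ∧ W = connectedComponentIn (f ⁻¹' U) x) ∧ (V ∩ W).Nonempty} := by
      rintro W ⟨⟨-, U, hU, hW⟩, hne⟩
      exact mem_iUnion₂.2 ⟨U, hU, hW, hne⟩
    refine ((countable_countableBasis Y).biUnion fun U hU => ?_).mono hsub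
    refine countable_of_pairwiseDisjoint_of_inter_nonempty (V := V) ?_ ?_ fun W hW => hW.2
    · rintro _ ⟨⟨x, -, rfl⟩, -⟩ _ ⟨⟨y, -, rfl⟩, -⟩ hne
      refine Set.disjoint_left.2 fun z hzx hzy => hne ?_
      rw [connectedComponentIn_eq hzx, connectedComponentIn_eq hzy]
    · rintro _ ⟨⟨x, -, rfl⟩, -⟩
      exact ((isOpen_of_mem_countableBasis hU).preimage hf).connectedComponentIn
  obtain ⟨𝒲, h𝒲, h𝒲c, h𝒲u⟩ := exists_countable_subcover_of_connectedSpace hopen hcover hcount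
  have := h𝒲c.to_subtype
  have : ∀ V : 𝒲, SecondCountableTopology (V : Set X) := fun V => (h𝒲 V.2).1
  exact secondCountableTopology_of_countable_cover (U := fun V : 𝒲 => (V : Set X))
    (fun V => hopen V (h𝒲 V.2)) (by rw [← sUnion_eq_iUnion, h𝒲u])

end PoincareVolterra

/-! ### Orbits -/

section Orbits

open Metric

variable {E : Type*} [NormedAddCommGroup E] [NormedSpace ℝ E]
  {M : Type*} [TopologicalSpace M] [ChartedSpace E M] [IsManifold 𝓘(ℝ, E) ∞ M]
  {F : Type*} [NormedAddCommGroup F] [NormedSpace ℝ F]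
  {A : M → Type*} [TopologicalSpace (TotalSpace F A)]
  [∀ x, AddCommGroup (A x)] [∀ x, Module ℝ (A x)] [∀ x, TopologicalSpace (A x)]
  [∀ x, IsTopologicalAddGroup (A x)] [∀ x, ContinuousSMul ℝ (A x)]
  [FiberBundle F A] [VectorBundle ℝ F A] [ContMDiffVectorBundle ∞ F A 𝓘(ℝ, E)]

variable {𝒜 : LieAlgebroid E F A}

/-- The part of an `A`-path between the times `s` and `t` (run backwards if `t < s`). -/
theorem LieAlgebroid.IsAPath.exists_subpath {a : ℝ → TotalSpace F A} (ha : 𝒜.IsAPath a) {s t : ℝ}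
    (hs : s ∈ Icc (0 : ℝ) 1) (ht : t ∈ Icc (0 : ℝ) 1) :
    ∃ b, 𝒜.IsAPath b ∧ ∀ r, (b r).proj = (a ((t - s) * r + s)).proj := by
  refine ⟨_, ha.comp_affine (c := t - s) (d := s) fun r hr => ?_, fun r => rfl⟩
  obtain ⟨hs0, hs1⟩ := hs
  obtain ⟨ht0, ht1⟩ := ht
  obtain ⟨hr0, hr1⟩ := hr
  constructor <;> dsimp only <;> nlinarith

theorem LieAlgebroid.IsAPath.mem_orbit {a : ℝ → TotalSpace F A} (ha : 𝒜.IsAPath a) {s t : ℝ}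
    (hs : s ∈ Icc (0 : ℝ) 1) (ht : t ∈ Icc (0 : ℝ) 1) : (a t).proj ∈ 𝒜.orbit (a s).proj := by
  obtain ⟨b, hb, hba⟩ := ha.exists_subpath hs ht
  exact Relation.ReflTransGen.single ⟨b, hb, by rw [hba]; simp, by rw [hba]; simp⟩

theorem LieAlgebroid.mem_orbit_self (p : M) : p ∈ 𝒜.orbit p := Relation.ReflTransGen.refl

theorem LieAlgebroid.mem_orbit_symm {p q : M} (h : q ∈ 𝒜.orbit p) : p ∈ 𝒜.orbit q := by
  induction h with
  | refl => exact Relation.ReflTransGen.refl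
  | tail _ h ih =>
    obtain ⟨a, ha, rfl, rfl⟩ := h
    exact (ha.mem_orbit (right_mem_Icc.2 zero_le_one) (left_mem_Icc.2 zero_le_one)).trans ih

theorem LieAlgebroid.mem_orbit_trans {p q r : M} (h : q ∈ 𝒜.orbit p) (h' : r ∈ 𝒜.orbit q) :
    r ∈ 𝒜.orbit p := Relation.ReflTransGen.trans h h'

theorem LieAlgebroid.orbit_eq_of_mem {p q : M} (h : q ∈ 𝒜.orbit p) : 𝒜.orbit q = 𝒜.orbit p :=
  Subset.antisymm (fun _ hr => LieAlgebroid.mem_orbit_trans h hr)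
    fun _ hr => LieAlgebroid.mem_orbit_trans (LieAlgebroid.mem_orbit_symm h) hr

namespace Plaque

variable {k k' : ℕ} {p p' : M} (P : Plaque 𝒜 k p) (P' : Plaque 𝒜 k' p')

/-- The points of a plaque. -/
def carrier : Set M := P.param '' ball 0 P.radius

theorem mem_carrier_self : p ∈ P.carrier := ⟨0, mem_ball_self P.radius_pos, P.param_zero⟩

theorem carrier_subset_nhd : P.carrier ⊆ P.nhd := P.mapsTo_param.image_subset

theorem mem_carrier_of_path {a : ℝ → TotalSpace F A} (ha : 𝒜.IsAPath a)
    (hmem : ∀ t ∈ Icc (0 : ℝ) 1, (a t).proj ∈ P.nhd) (h0 : (a 0).proj ∈ P.carrier) :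
    (a 1).proj ∈ P.carrier :=
  P.mem_of_path a ha hmem h0 1 (right_mem_Icc.2 zero_le_one)

theorem param_proj {x : M} (hx : x ∈ P.carrier) : P.param (P.proj x) = x := by
  obtain ⟨v, hv, rfl⟩ := hx
  rw [P.proj_param v hv]

theorem carrier_subset_orbit : P.carrier ⊆ 𝒜.orbit p := by
  rintro _ ⟨v, hv, rfl⟩
  obtain ⟨a, ha, hav⟩ := P.exists_path 0 (mem_ball_self P.radius_pos) v hv
  have h := ha.mem_orbit (left_mem_Icc.2 zero_le_one) (right_mem_Icc.2 zero_le_one)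
  rw [hav 0 (left_mem_Icc.2 zero_le_one), hav 1 (right_mem_Icc.2 zero_le_one)] at h
  simpa [P.param_zero] using h

theorem mdifferentiableAt_param {v : EuclideanSpace ℝ (Fin k)} (hv : v ∈ ball 0 P.radius) :
    MDifferentiableAt (𝓡 k) 𝓘(ℝ, E) P.param v :=
  (P.contMDiffOn_param.contMDiffAt (isOpen_ball.mem_nhds hv)).mdifferentiableAt (by simp)

/-- The derivative of `proj` is a left inverse. -/
theorem injective_mfderiv_param {v : EuclideanSpace ℝ (Fin k)} (hv : v ∈ ball 0 P.radius) :
    Injective (mfderiv (𝓡 k) 𝓘(ℝ, E) P.param v) := by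
  have h1 : MDifferentiableAt 𝓘(ℝ, E) (𝓡 k) P.proj (P.param v) :=
    (P.contMDiffOn_proj.contMDiffAt (P.isOpen_nhd.mem_nhds (P.mapsTo_param hv))).mdifferentiableAt
      (by simp)
  have h2 : HasMFDerivAt (𝓡 k) (𝓡 k) (P.proj ∘ P.param) v
      (ContinuousLinearMap.id ℝ (TangentSpace (𝓡 k) v)) := by
    refine (hasMFDerivAt_id v).congr_of_eventuallyEq ?_
    filter_upwards [isOpen_ball.mem_nhds hv] with w hw using P.proj_param w hw
  have h3 := hasMFDerivAt_unique h2
    (HasMFDerivAt.comp v h1.hasMFDerivAt (P.mdifferentiableAt_param hv).hasMFDerivAt)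
  refine LeftInverse.injective (g := mfderiv 𝓘(ℝ, E) (𝓡 k) P.proj (P.param v)) fun u => ?_
  exact (DFunLike.congr_fun h3 u).symm

theorem rank_eq {x : M} (hx : x ∈ P.carrier) : 𝒜.rank x = k := by
  obtain ⟨v, hv, rfl⟩ := hx
  have h1 : LinearMap.range (𝒜.anchor (P.param v)).toLinearMap =
      LinearMap.range (mfderiv (𝓡 k) 𝓘(ℝ, E) P.param v).toLinearMap :=
    SetLike.coe_injective (P.range_mfderiv_param v hv).symm
  rw [LieAlgebroid.rank, h1]
  exact (LinearMap.finrank_range_of_inj (P.injective_mfderiv_param hv)).trans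
    finrank_euclideanSpace_fin

/-- An `A`-path that starts in a plaque stays there for some time. -/
theorem eventually_mem_carrier {a : ℝ → TotalSpace F A} (ha : 𝒜.IsAPath a) {t₀ : ℝ}
    (ht₀ : t₀ ∈ Icc (0 : ℝ) 1) (h : (a t₀).proj ∈ P.carrier) :
    ∀ᶠ t in 𝓝[Icc 0 1] t₀, (a t).proj ∈ P.carrier := by
  obtain ⟨δ, hδ, hδP⟩ := mem_nhdsWithin_iff.1 (ha.continuousOn_proj t₀ ht₀
    (P.isOpen_nhd.mem_nhds (P.carrier_subset_nhd h)))
  refine mem_nhdsWithin_iff.2 ⟨δ, hδ, fun t ⟨htδ, ht⟩ => ?_⟩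
  obtain ⟨b, hb, hba⟩ := ha.exists_subpath ht₀ ht
  have h1 := P.mem_carrier_of_path hb (fun r hr => ?_) (by rw [hba]; simpa using h)
  · rw [hba] at h1; simpa using h1
  · rw [hba]
    refine hδP ⟨?_, ?_⟩
    · rw [mem_ball, Real.dist_eq] at htδ ⊢
      have : (t - t₀) * r + t₀ - t₀ = (t - t₀) * r := by ring
      rw [this, abs_mul, abs_of_nonneg hr.1]
      exact (mul_le_of_le_one_right (abs_nonneg _) hr.2).trans_lt htδ
    · obtain ⟨hs0, hs1⟩ := ht₀
      obtain ⟨ht0, ht1⟩ := ht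
      obtain ⟨hr0, hr1⟩ := hr
      constructor <;> nlinarith

/-- The part of a plaque inside another one is open in the parametrization: the images of short line
segments are `A`-paths that stay in the domain of the other plaque. -/
theorem isOpen_overlap : IsOpen {v | v ∈ ball 0 P.radius ∧ P.param v ∈ P'.carrier} := by
  rw [isOpen_iff_mem_nhds]
  rintro v₀ ⟨hv₀, hP'⟩
  have h1 : P.param ⁻¹' P'.nhd ∈ 𝓝 v₀ := (P.contMDiffOn_param.contMDiffAt
    (isOpen_ball.mem_nhds hv₀)).continuousAt (P'.isOpen_nhd.mem_nhds (P'.carrier_subset_nhd hP'))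
  obtain ⟨ε, hε, hεP⟩ := Metric.mem_nhds_iff.1 (Filter.inter_mem h1 (isOpen_ball.mem_nhds hv₀))
  refine Filter.mem_of_superset (ball_mem_nhds v₀ hε) fun v hv => ⟨(hεP hv).2, ?_⟩
  obtain ⟨a, ha, hav⟩ := P.exists_path v₀ hv₀ v (hεP hv).2
  have h2 := P'.mem_carrier_of_path ha (fun t ht => ?_) ?_
  · rw [hav 1 (right_mem_Icc.2 zero_le_one)] at h2; simpa using h2
  · rw [hav t ht]
    exact (hεP ((convex_ball _ _).add_smul_sub_mem (mem_ball_self hε) hv ht)).1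
  · rw [hav 0 (left_mem_Icc.2 zero_le_one)]; simpa using hP'

theorem contDiffOn_overlap :
    ContDiffOn ℝ ∞ (P'.proj ∘ P.param) {v | v ∈ ball 0 P.radius ∧ P.param v ∈ P'.carrier} :=
  (P'.contMDiffOn_proj.comp (P.contMDiffOn_param.mono fun _ hv => hv.1)
    fun _ hv => P'.carrier_subset_nhd hv.2).contDiffOn

end Plaque

/-- The rank of the anchor is constant on plaques, hence locally constant along `A`-paths. -/
theorem LieAlgebroid.IsAPath.rank_eq [FiniteDimensional ℝ E] [FiniteDimensional ℝ F] [T2Space M]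
    {a : ℝ → TotalSpace F A} (ha : 𝒜.IsAPath a) : 𝒜.rank (a 1).proj = 𝒜.rank (a 0).proj := by
  have hcont : ContinuousOn (fun t => 𝒜.rank (a t).proj) (Icc 0 1) := by
    intro t ht
    obtain ⟨P⟩ := 𝒜.nonempty_plaque (a t).proj
    refine continuousWithinAt_const.congr_of_eventuallyEq
      ((P.eventually_mem_carrier ha ht P.mem_carrier_self).mono fun s hs => P.rank_eq hs) rfl
  exact isPreconnected_Icc.constant hcont (right_mem_Icc.2 zero_le_one)
    (left_mem_Icc.2 zero_le_one)

theorem LieAlgebroid.rank_eq_of_mem_orbit [FiniteDimensional ℝ E] [FiniteDimensional ℝ F]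
    [T2Space M] {p q : M} (h : q ∈ 𝒜.orbit p) : 𝒜.rank q = 𝒜.rank p := by
  induction h with
  | refl => rfl
  | tail _ h ih =>
    obtain ⟨a, ha, rfl, rfl⟩ := h
    rw [ha.rank_eq, ih]

end Orbits

/-! ### The orbits as immersed submanifolds -/

section Leaves

open Metric

variable {E : Type*} [NormedAddCommGroup E] [NormedSpace ℝ E]
  {M : Type*} [TopologicalSpace M] [ChartedSpace E M] [IsManifold 𝓘(ℝ, E) ∞ M]
  {F : Type*} [NormedAddCommGroup F] [NormedSpace ℝ F]
  {A : M → Type*} [TopologicalSpace (TotalSpace F A)]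
  [∀ x, AddCommGroup (A x)] [∀ x, Module ℝ (A x)] [∀ x, TopologicalSpace (A x)]
  [∀ x, IsTopologicalAddGroup (A x)] [∀ x, ContinuousSMul ℝ (A x)]
  [FiberBundle F A] [VectorBundle ℝ F A] [ContMDiffVectorBundle ∞ F A 𝓘(ℝ, E)]

variable {𝒜 : LieAlgebroid E F A}

/-- The orbit through `p` as a type of its own, which carries the leaf topology and not the subspace
topology. -/
@[ext]
structure Leaf (𝒜 : LieAlgebroid E F A) (p : M) where
  /-- The inclusion of the orbit. -/
  incl : M
  incl_mem : incl ∈ 𝒜.orbit p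

namespace Leaf

theorem injective_incl {p : M} : Injective (incl : Leaf 𝒜 p → M) := fun _ _ h => Leaf.ext h

/-- The chart of an orbit given by a plaque. The inverse has the junk value `q` outside the ball. -/
@[simps]
noncomputable def plaqueChart {p : M} {k : ℕ} (q : Leaf 𝒜 p) (P : Plaque 𝒜 k q.incl) :
    PartialEquiv (Leaf 𝒜 p) (EuclideanSpace ℝ (Fin k)) where
  toFun x := P.proj x.incl
  invFun v := open Classical in if h : v ∈ ball 0 P.radius then ⟨P.param v,
    LieAlgebroid.mem_orbit_trans q.incl_mem (P.carrier_subset_orbit (mem_image_of_mem _ h))⟩ else q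
  source := incl ⁻¹' P.carrier
  target := ball 0 P.radius
  map_source' x hx := P.mapsTo_proj (P.carrier_subset_nhd hx)
  map_target' v hv := by
    rw [dif_pos hv]; exact mem_image_of_mem P.param hv
  left_inv' x hx := by
    rw [dif_pos (P.mapsTo_proj (P.carrier_subset_nhd hx))]
    exact injective_incl (P.param_proj hx)
  right_inv' v hv := by
    rw [dif_pos hv]; exact P.proj_param v hv

theorem incl_plaqueChart_symm {p : M} {k : ℕ} {q : Leaf 𝒜 p} (P : Plaque 𝒜 k q.incl)
    {v : EuclideanSpace ℝ (Fin k)} (hv : v ∈ ball 0 P.radius) :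
    ((plaqueChart q P).symm v).incl = P.param v := by
  rw [plaqueChart_symm_apply, dif_pos hv]

theorem plaqueChart_trans_source {p : M} {k k' : ℕ} {q q' : Leaf 𝒜 p} (P : Plaque 𝒜 k q.incl)
    (P' : Plaque 𝒜 k' q'.incl) : ((plaqueChart q P).symm.trans (plaqueChart q' P')).source =
      {v | v ∈ ball 0 P.radius ∧ P.param v ∈ P'.carrier} := by
  ext v
  rw [PartialEquiv.trans_source]
  refine and_congr_right fun hv => ?_
  rw [mem_preimage, plaqueChart_source, mem_preimage, incl_plaqueChart_symm P hv]

theorem plaqueChart_contDiffOn {p : M} {k k' : ℕ} {q q' : Leaf 𝒜 p} (P : Plaque 𝒜 k q.incl)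
    (P' : Plaque 𝒜 k' q'.incl) :
    ContDiffOn ℝ ∞ ((plaqueChart q P).symm.trans (plaqueChart q' P'))
      ((plaqueChart q P).symm.trans (plaqueChart q' P')).source := by
  rw [plaqueChart_trans_source]
  refine (P.contDiffOn_overlap P').congr fun v hv => ?_
  show P'.proj ((plaqueChart q P).symm v).incl = _
  rw [incl_plaqueChart_symm P hv.1]
  rfl

variable [FiniteDimensional ℝ E] [FiniteDimensional ℝ F] [T2Space M]

theorem nonempty_plaque {p : M} (q : Leaf 𝒜 p) : Nonempty (Plaque 𝒜 (𝒜.rank p) q.incl) := by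
  have := 𝒜.nonempty_plaque q.incl
  rwa [LieAlgebroid.rank_eq_of_mem_orbit q.incl_mem] at this

/-- A plaque around each point of an orbit. -/
noncomputable def plaque {p : M} (q : Leaf 𝒜 p) : Plaque 𝒜 (𝒜.rank p) q.incl :=
  Classical.choice q.nonempty_plaque

variable (𝒜) in
/-- The atlas of an orbit. -/
noncomputable def chartedSpaceCore (p : M) :
    ChartedSpaceCore (EuclideanSpace ℝ (Fin (𝒜.rank p))) (Leaf 𝒜 p) where
  atlas := range fun q : Leaf 𝒜 p => plaqueChart q q.plaque
  chartAt q := plaqueChart q q.plaque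
  mem_chart_source q := q.plaque.mem_carrier_self
  chart_mem_atlas q := mem_range_self q
  open_source := by
    rintro _ _ ⟨q, rfl⟩ ⟨q', rfl⟩
    rw [plaqueChart_trans_source]
    exact q.plaque.isOpen_overlap q'.plaque
  continuousOn_toFun := by
    rintro _ _ ⟨q, rfl⟩ ⟨q', rfl⟩
    exact (plaqueChart_contDiffOn _ _).continuousOn

noncomputable instance (p : M) : TopologicalSpace (Leaf 𝒜 p) :=
  (chartedSpaceCore 𝒜 p).toTopologicalSpace

noncomputable instance (p : M) : ChartedSpace (EuclideanSpace ℝ (Fin (𝒜.rank p))) (Leaf 𝒜 p) :=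
  (chartedSpaceCore 𝒜 p).toChartedSpace

instance (p : M) : IsManifold (𝓡 (𝒜.rank p)) ∞ (Leaf 𝒜 p) := by
  refine isManifold_of_contDiffOn _ _ _ fun e e' he he' => ?_
  obtain ⟨f, hf, rfl⟩ := mem_iUnion₂.1 he
  obtain ⟨f', hf', rfl⟩ := mem_iUnion₂.1 he'
  obtain ⟨q, rfl⟩ := hf
  obtain ⟨q', rfl⟩ := hf'
  exact (plaqueChart_contDiffOn q.plaque q'.plaque).mono fun v hv => hv.1

/-- On the domain of a chart, the inclusion is the parametrization of the plaque. -/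
theorem incl_eqOn {p : M} (q : Leaf 𝒜 p) :
    EqOn incl (q.plaque.param ∘ chartAt (EuclideanSpace ℝ (Fin (𝒜.rank p))) q)
      (chartAt (EuclideanSpace ℝ (Fin (𝒜.rank p))) q).source :=
  fun _ hx => (q.plaque.param_proj hx).symm

theorem contMDiff_incl {p : M} :
    ContMDiff (𝓡 (𝒜.rank p)) 𝓘(ℝ, E) ∞ (incl : Leaf 𝒜 p → M) := by
  intro q
  have h1 : ContMDiffOn (𝓡 (𝒜.rank p)) 𝓘(ℝ, E) ∞ (incl : Leaf 𝒜 p → M)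
      (chartAt (EuclideanSpace ℝ (Fin (𝒜.rank p))) q).source := by
    refine ContMDiffOn.congr ?_ q.incl_eqOn
    exact q.plaque.contMDiffOn_param.comp contMDiffOn_chart fun x hx =>
      q.plaque.mapsTo_proj (q.plaque.carrier_subset_nhd hx)
  exact h1.contMDiffAt ((chartAt _ q).open_source.mem_nhds (mem_chart_source _ q))

theorem continuous_incl {p : M} : Continuous (incl : Leaf 𝒜 p → M) := contMDiff_incl.continuous

theorem proj_incl_mem {p : M} (q : Leaf 𝒜 p) :
    q.plaque.proj q.incl ∈ ball 0 q.plaque.radius :=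
  q.plaque.mapsTo_proj (q.plaque.carrier_subset_nhd q.plaque.mem_carrier_self)

/-- The derivative of the inclusion is that of the parametrization of a plaque, up to an
isomorphism. -/
theorem exists_mfderiv_incl_eq {p : M} (q : Leaf 𝒜 p) :
    ∃ D : TangentSpace (𝓡 (𝒜.rank p)) q →L[ℝ] EuclideanSpace ℝ (Fin (𝒜.rank p)),
      D.IsInvertible ∧ mfderiv (𝓡 (𝒜.rank p)) 𝓘(ℝ, E) (incl : Leaf 𝒜 p → M) q =
        (mfderiv (𝓡 (𝒜.rank p)) 𝓘(ℝ, E) q.plaque.param (q.plaque.proj q.incl)).comp D := by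
  refine ⟨mfderiv (𝓡 (𝒜.rank p)) (𝓡 (𝒜.rank p)) (extChartAt (𝓡 (𝒜.rank p)) q) q,
    isInvertible_mfderiv_extChartAt (mem_extChartAt_source q), ?_⟩
  have h1 : (incl : Leaf 𝒜 p → M) =ᶠ[𝓝 q] q.plaque.param ∘ extChartAt (𝓡 (𝒜.rank p)) q :=
    q.incl_eqOn.eventuallyEq_of_mem ((chartAt _ q).open_source.mem_nhds (mem_chart_source _ q))
  rw [h1.mfderiv_eq]
  exact mfderiv_comp q (q.plaque.mdifferentiableAt_param q.proj_incl_mem)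
    (mdifferentiableAt_extChartAt (mem_chart_source _ q))

theorem range_mfderiv_incl {p : M} (q : Leaf 𝒜 p) :
    range (mfderiv (𝓡 (𝒜.rank p)) 𝓘(ℝ, E) (incl : Leaf 𝒜 p → M) q) =
      range (𝒜.anchor q.incl) := by
  obtain ⟨D, ⟨e, rfl⟩, hD⟩ := q.exists_mfderiv_incl_eq
  have h := q.plaque.range_mfderiv_param _ q.proj_incl_mem
  rw [q.plaque.param_proj q.plaque.mem_carrier_self] at h
  rw [hD, ← h]
  exact e.surjective.range_comp _

theorem injective_mfderiv_incl {p : M} (q : Leaf 𝒜 p) :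
    Injective (mfderiv (𝓡 (𝒜.rank p)) 𝓘(ℝ, E) (incl : Leaf 𝒜 p → M) q) := by
  obtain ⟨D, ⟨e, rfl⟩, hD⟩ := q.exists_mfderiv_incl_eq
  rw [hD]
  exact (q.plaque.injective_mfderiv_param q.proj_incl_mem).comp e.injective

instance (p : M) : T2Space (Leaf 𝒜 p) := .of_injective_continuous injective_incl continuous_incl

/-- `A`-paths are continuous in the leaf topology. -/
theorem continuousOn_of_isAPath {p : M} {a : ℝ → TotalSpace F A} (ha : 𝒜.IsAPath a)
    {x : ℝ → Leaf 𝒜 p} (hx : ∀ t ∈ Icc (0 : ℝ) 1, (x t).incl = (a t).proj) :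
    ContinuousOn x (Icc 0 1) := by
  intro t ht
  have h1 : x ⁻¹' (chartAt (EuclideanSpace ℝ (Fin (𝒜.rank p))) (x t)).source ∈ 𝓝[Icc 0 1] t := by
    have h2 := (x t).plaque.eventually_mem_carrier ha ht
      (by rw [← hx t ht]; exact (x t).plaque.mem_carrier_self)
    filter_upwards [h2, self_mem_nhdsWithin] with s hs hs'
    rw [← hx s hs'] at hs
    exact hs
  refine ((chartAt (EuclideanSpace ℝ (Fin (𝒜.rank p)))
    (x t)).continuousWithinAt_iff_continuousWithinAt_comp_left (mem_chart_source _ _) h1).2 ?_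
  have h3 : ContinuousAt (x t).plaque.proj (a t).proj := by
    rw [← hx t ht]
    exact ((x t).plaque.contMDiffOn_proj.contMDiffAt ((x t).plaque.isOpen_nhd.mem_nhds
      ((x t).plaque.carrier_subset_nhd (x t).plaque.mem_carrier_self))).continuousAt
  refine (ContinuousAt.comp_continuousWithinAt (f := fun t => (a t).proj) h3
    (ha.continuousOn_proj t ht)).congr (fun s hs => ?_) ?_
  · exact congrArg (x t).plaque.proj (hx s hs)
  · exact congrArg (x t).plaque.proj (hx t ht)

instance (p : M) : ConnectedSpace (Leaf 𝒜 p) := by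
  let x₀ : Leaf 𝒜 p := ⟨p, LieAlgebroid.mem_orbit_self p⟩
  have h : ∀ q (hq : q ∈ 𝒜.orbit p), (⟨q, hq⟩ : Leaf 𝒜 p) ∈ connectedComponent x₀ := by
    intro q hq
    induction hq with
    | refl => exact mem_connectedComponent
    | @tail b c hb hbc ih =>
      obtain ⟨a, ha, rfl, rfl⟩ := hbc
      have hmem : ∀ t : Icc (0 : ℝ) 1, (a t).proj ∈ 𝒜.orbit p := fun t =>
        LieAlgebroid.mem_orbit_trans hb (ha.mem_orbit (left_mem_Icc.2 zero_le_one) t.2)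
      let x : ℝ → Leaf 𝒜 p := fun t => ⟨_, hmem (projIcc 0 1 zero_le_one t)⟩
      have hx : ∀ t ∈ Icc (0 : ℝ) 1, (x t).incl = (a t).proj := fun t ht => by
        show (a (projIcc 0 1 zero_le_one t)).proj = _
        rw [projIcc_of_mem _ ht]
      have h1 := (isPreconnected_Icc.image x
        (continuousOn_of_isAPath ha hx)).subset_connectedComponent
          (mem_image_of_mem x (left_mem_Icc.2 zero_le_one))
      have h2 := h1 (mem_image_of_mem x (right_mem_Icc.2 zero_le_one))
      have h3 : x 0 = ⟨(a 0).proj, hb⟩ := injective_incl (hx 0 (left_mem_Icc.2 zero_le_one))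
      have h4 : x 1 = ⟨(a 1).proj, LieAlgebroid.mem_orbit_trans hb (ha.mem_orbit
        (left_mem_Icc.2 zero_le_one) (right_mem_Icc.2 zero_le_one))⟩ :=
        injective_incl (hx 1 (right_mem_Icc.2 zero_le_one))
      rw [h3, h4, connectedComponent_eq_iff_mem.2 ih] at h2
      exact h2
  have huniv : connectedComponent x₀ = univ := eq_univ_of_forall fun q => h q.incl q.incl_mem
  exact connectedSpace_iff_connectedComponent.2 ⟨x₀, huniv⟩

instance [SecondCountableTopology M] (p : M) : SecondCountableTopology (Leaf 𝒜 p) := by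
  have : LocallyConnectedSpace (Leaf 𝒜 p) :=
    ChartedSpace.locallyConnectedSpace (EuclideanSpace ℝ (Fin (𝒜.rank p))) _
  refine secondCountableTopology_of_continuous continuous_incl fun q => ?_
  let P := q.plaque
  refine ⟨P.nhd, P.isOpen_nhd, P.carrier_subset_nhd P.mem_carrier_self,
    (chartAt (EuclideanSpace ℝ (Fin (𝒜.rank p))) q).source, mem_chart_source _ q,
    (chartAt _ q).open_source, (chartAt _ q).secondCountableTopology_source, ?_⟩
  rintro x ⟨hx, hxN⟩
  -- the plaque is the set of points of `nhd` where `param ∘ proj` is the identity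
  have hparam : ContinuousAt P.param (P.proj x.incl) :=
    (P.mdifferentiableAt_param (P.mapsTo_proj hxN)).continuousAt
  have hproj : ContinuousAt P.proj x.incl :=
    (P.contMDiffOn_proj.contMDiffAt (P.isOpen_nhd.mem_nhds hxN)).continuousAt
  have h1 : ContinuousAt (fun y : Leaf 𝒜 p => P.param (P.proj y.incl)) x :=
    ContinuousAt.comp (f := fun y : Leaf 𝒜 p => P.proj y.incl) hparam
      (ContinuousAt.comp (f := incl) hproj continuous_incl.continuousAt)
  have : (𝓝[(chartAt (EuclideanSpace ℝ (Fin (𝒜.rank p))) q).source] x).NeBot :=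
    mem_closure_iff_nhdsWithin_neBot.1 hx
  have h2 : P.param (P.proj x.incl) = x.incl := by
    refine tendsto_nhds_unique_of_eventuallyEq
      (l := 𝓝[(chartAt (EuclideanSpace ℝ (Fin (𝒜.rank p))) q).source] x)
      (h1.mono_left nhdsWithin_le_nhds)
      (continuous_incl.continuousAt.mono_left nhdsWithin_le_nhds) ?_
    filter_upwards [self_mem_nhdsWithin] with y hy using P.param_proj hy
  exact ⟨_, P.mapsTo_proj hxN, h2⟩

end Leaf

variable [FiniteDimensional ℝ E] [FiniteDimensional ℝ F] [T2Space M] [SecondCountableTopology M]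

variable (𝒜) in
/-- The orbit through `p` as an immersed submanifold. -/
noncomputable def leafSubmanifold (p : M) : ConnectedImmersedSubmanifold E M where
  dim := 𝒜.rank p
  carrier := Leaf 𝒜 p
  incl := Leaf.incl
  contMDiff_incl := Leaf.contMDiff_incl
  injective_incl := Leaf.injective_incl
  injective_mfderiv_incl := Leaf.injective_mfderiv_incl

theorem range_incl_leafSubmanifold (p : M) :
    range (leafSubmanifold 𝒜 p).incl = 𝒜.orbit p :=
  Subset.antisymm (range_subset_iff.2 Leaf.incl_mem) fun x hx => ⟨⟨x, hx⟩, rfl⟩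

/-- The vectors tangent to the orbits are those in the image of the anchor. -/
theorem mem_tangentVectors_iff {ι : Type*} {base : ι → M} (hbase : ∀ p, ∃ i, p ∈ 𝒜.orbit (base i))
    (ξ : TangentBundle 𝓘(ℝ, E) M) :
    ξ ∈ tangentVectors E M (fun i => leafSubmanifold 𝒜 (base i)) ↔
      ξ.2 ∈ range (𝒜.anchor ξ.proj) := by
  constructor
  · intro h
    obtain ⟨i, ⟨x, u⟩, rfl⟩ := mem_iUnion.1 h
    exact (Leaf.range_mfderiv_incl (𝒜 := 𝒜) (p := base i) x).subset (mem_range_self u)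
  · obtain ⟨p, v⟩ := ξ
    intro h
    obtain ⟨i, hi⟩ := hbase p
    let x : Leaf 𝒜 (base i) := ⟨p, hi⟩
    have h1 : v ∈ range (mfderiv (𝓡 (𝒜.rank (base i))) 𝓘(ℝ, E)
        (Leaf.incl : Leaf 𝒜 (base i) → M) x) := by
      rw [x.range_mfderiv_incl]; exact h
    obtain ⟨u, hu⟩ := h1
    exact mem_iUnion.2 ⟨i, ⟨x, u⟩, by rw [← hu]; rfl⟩

/-- A point of an orbit. -/
noncomputable def orbitBase (O : range 𝒜.orbit) : M := O.2.choose

theorem orbit_orbitBase (O : range 𝒜.orbit) : 𝒜.orbit (orbitBase O) = O.1 := O.2.choose_spec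

theorem exists_mem_orbit_orbitBase (p : M) : ∃ O : range 𝒜.orbit, p ∈ 𝒜.orbit (orbitBase O) :=
  ⟨⟨𝒜.orbit p, mem_range_self p⟩, by
    rw [orbit_orbitBase]; exact LieAlgebroid.mem_orbit_self p⟩

variable (𝒜) in
/-- The foliation of the base of a Lie algebroid by the orbits. The leaves are indexed by the orbits
as sets; each is realized as the orbit through a chosen point. -/
noncomputable def orbitFoliation : SingularFoliation E M where
  Index := range 𝒜.orbit
  leaf O := leafSubmanifold 𝒜 (orbitBase O)
  partition p := by
    obtain ⟨O, hO⟩ := exists_mem_orbit_orbitBase (𝒜 := 𝒜) p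
    simp only [range_incl_leafSubmanifold]
    refine ⟨O, hO, fun O' hO' => Subtype.ext ?_⟩
    rw [← orbit_orbitBase O, ← orbit_orbitBase O', ← LieAlgebroid.orbit_eq_of_mem hO,
      ← LieAlgebroid.orbit_eq_of_mem hO']
  exists_vectorField ξ hξ := by
    obtain ⟨a, ha⟩ := (mem_tangentVectors_iff exists_mem_orbit_orbitBase ξ).1 hξ
    obtain ⟨s, hs⟩ := exists_section_apply_eq (E := E) (F := F) a
    refine ⟨⟨fun p => 𝒜.anchor p (s p), 𝒜.contMDiff_anchor_apply s⟩, fun p => ?_, ?_⟩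
    · exact (mem_tangentVectors_iff exists_mem_orbit_orbitBase _).2 (mem_range_self _)
    · rw [← ha, ← hs]; rfl

theorem isOrthogonal_orbitFoliation_iff
    (g : ContMDiffRiemannianMetric 𝓘(ℝ, E) ∞ E (fun x : M => TangentSpace 𝓘(ℝ, E) x))
    (p : M) (v : TangentSpace 𝓘(ℝ, E) p) :
    (orbitFoliation 𝒜).IsOrthogonal g p v ↔ ∀ a : A p, g.inner p v (𝒜.anchor p a) = 0 := by
  have h := fun w : TangentSpace 𝓘(ℝ, E) p =>
    mem_tangentVectors_iff (𝒜 := 𝒜) exists_mem_orbit_orbitBase ⟨p, w⟩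
  constructor
  · exact fun hv a => hv _ ((h _).2 (mem_range_self a))
  · intro hv w hw
    obtain ⟨a, ha⟩ := (h w).1 hw
    have h1 : 𝒜.anchor p a = w := ha
    rw [← h1]
    exact hv a

end Leaves

/-! ### The metric and vector fields in a chart -/

section ChartMetric

variable {E : Type*} [NormedAddCommGroup E] [NormedSpace ℝ E]
  {M : Type*} [TopologicalSpace M] [ChartedSpace E M] [IsManifold 𝓘(ℝ, E) ∞ M]

variable (g : ContMDiffRiemannianMetric 𝓘(ℝ, E) ∞ E (fun x : M => TangentSpace 𝓘(ℝ, E) x))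

/-- The product of two smooth vector fields along a smooth map is smooth. -/
theorem _root_.Bundle.ContMDiffRiemannianMetric.contMDiffWithinAt_inner {H' : Type*}
    [NormedAddCommGroup H'] [NormedSpace ℝ H'] {N : Type*} [TopologicalSpace N]
    [ChartedSpace H' N] {b : N → M} {v w : ∀ x, TangentSpace 𝓘(ℝ, E) (b x)} {s : Set N} {x : N}
    (hv : ContMDiffWithinAt 𝓘(ℝ, H') (𝓘(ℝ, E).prod 𝓘(ℝ, E)) ∞
      (fun m => TotalSpace.mk' E (E := fun x : M => TangentSpace 𝓘(ℝ, E) x) (b m) (v m)) s x)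
    (hw : ContMDiffWithinAt 𝓘(ℝ, H') (𝓘(ℝ, E).prod 𝓘(ℝ, E)) ∞
      (fun m => TotalSpace.mk' E (E := fun x : M => TangentSpace 𝓘(ℝ, E) x) (b m) (w m)) s x) :
    ContMDiffWithinAt 𝓘(ℝ, H') 𝓘(ℝ, ℝ) ∞ (fun m => g.inner (b m) (v m) (w m)) s x := by
  have hb : ContMDiffWithinAt 𝓘(ℝ, H') 𝓘(ℝ, E) ∞ b s x := ((contMDiffWithinAt_totalSpace).1 hv).1
  have h : ContMDiffWithinAt 𝓘(ℝ, H') (𝓘(ℝ, E).prod 𝓘(ℝ, ℝ)) ∞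
      (fun m => TotalSpace.mk' ℝ (E := Bundle.Trivial M ℝ) (b m) (g.inner (b m) (v m) (w m))) s x :=
    ContMDiffWithinAt.clm_bundle_apply₂ (F₁ := E) (F₂ := E)
      (ContMDiffAt.comp_contMDiffWithinAt x g.contMDiff.contMDiffAt hb) hv hw
  exact ((contMDiffWithinAt_totalSpace).1 h).2

theorem mfderiv_symm_mfderiv_extChartAt {p x : M} (hx : x ∈ (chartAt E p).source)
    (v : TangentSpace 𝓘(ℝ, E) x) :
    mfderiv 𝓘(ℝ, E) 𝓘(ℝ, E) (extChartAt 𝓘(ℝ, E) p).symm (extChartAt 𝓘(ℝ, E) p x)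
      (mfderiv 𝓘(ℝ, E) 𝓘(ℝ, E) (extChartAt 𝓘(ℝ, E) p) x v) = v := by
  have h := mfderivWithin_extChartAt_symm_comp_mfderiv_extChartAt' (I := 𝓘(ℝ, E)) (x := p) (y := x)
    (by rw [extChartAt_source]; exact hx)
  rw [ModelWithCorners.Boundaryless.range_eq_univ, mfderivWithin_univ] at h
  exact DFunLike.congr_fun h v

theorem symmL_trivializationAt_tangentSpace {p x : M} (hx : x ∈ (chartAt E p).source) :
    (trivializationAt E (TangentSpace 𝓘(ℝ, E)) p).symmL ℝ x =
      mfderiv 𝓘(ℝ, E) 𝓘(ℝ, E) (extChartAt 𝓘(ℝ, E) p).symm (extChartAt 𝓘(ℝ, E) p x) := by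
  rw [TangentBundle.symmL_trivializationAt hx, ModelWithCorners.Boundaryless.range_eq_univ,
    mfderivWithin_univ]

/-- The value of the metric in the chart at `p` on the coordinates of two tangent vectors. -/
theorem chartMetric_apply {p x : M} (hx : x ∈ (chartAt E p).source)
    (v w : TangentSpace 𝓘(ℝ, E) x) :
    chartMetric g p (extChartAt 𝓘(ℝ, E) p x)
      (mfderiv 𝓘(ℝ, E) 𝓘(ℝ, E) (extChartAt 𝓘(ℝ, E) p) x v)
      (mfderiv 𝓘(ℝ, E) 𝓘(ℝ, E) (extChartAt 𝓘(ℝ, E) p) x w) = g.inner x v w := by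
  have hv := mfderiv_symm_mfderiv_extChartAt hx v
  have hw := mfderiv_symm_mfderiv_extChartAt hx w
  have hz : ∀ z, z = x → ∀ v w : E, (g.inner z : E →L[ℝ] E →L[ℝ] ℝ) v w =
      (g.inner x : E →L[ℝ] E →L[ℝ] ℝ) v w := by
    rintro z rfl v w; rfl
  have hleft : (extChartAt 𝓘(ℝ, E) p).symm (extChartAt 𝓘(ℝ, E) p x) = x :=
    (extChartAt 𝓘(ℝ, E) p).left_inv (by rw [extChartAt_source]; exact hx)
  refine (hz _ hleft _ _).trans ?_
  exact congrArg₂ (fun v w : E => (g.inner x : E →L[ℝ] E →L[ℝ] ℝ) v w) hv hw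

theorem chartMetric_symm (p : M) (y u v : E) : chartMetric g p y u v = chartMetric g p y v u :=
  g.symm ((extChartAt 𝓘(ℝ, E) p).symm y)
    (mfderiv 𝓘(ℝ, E) 𝓘(ℝ, E) (extChartAt 𝓘(ℝ, E) p).symm y u)
    (mfderiv 𝓘(ℝ, E) 𝓘(ℝ, E) (extChartAt 𝓘(ℝ, E) p).symm y v)

theorem contDiffOn_chartMetric [FiniteDimensional ℝ E] [T2Space M] (p : M) :
    ContDiffOn ℝ ∞ (chartMetric g p) (extChartAt 𝓘(ℝ, E) p).target := by
  set t := trivializationAt E (TangentSpace 𝓘(ℝ, E)) p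
  have hsrc : ∀ y ∈ (extChartAt 𝓘(ℝ, E) p).target,
      (extChartAt 𝓘(ℝ, E) p).symm y ∈ (chartAt E p).source := fun y hy => by
    rw [← extChartAt_source 𝓘(ℝ, E)]; exact (extChartAt 𝓘(ℝ, E) p).map_target hy
  have hconst : ∀ u : E, ContMDiffOn 𝓘(ℝ, E) (𝓘(ℝ, E).prod 𝓘(ℝ, E)) ∞
      (fun y => TotalSpace.mk' E (E := fun x : M => TangentSpace 𝓘(ℝ, E) x)
        ((extChartAt 𝓘(ℝ, E) p).symm y) (t.symmL ℝ ((extChartAt 𝓘(ℝ, E) p).symm y) u))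
      (extChartAt 𝓘(ℝ, E) p).target := fun u =>
    (contMDiffOn_symmL (A := fun x : M => TangentSpace 𝓘(ℝ, E) x) p u).comp
      (contMDiffOn_extChartAt_symm p) hsrc
  refine contDiffOn_clm_apply.2 fun u => contDiffOn_clm_apply.2 fun w => ?_
  have h1 : ContMDiffOn 𝓘(ℝ, E) 𝓘(ℝ, ℝ) ∞ (fun y => g.inner ((extChartAt 𝓘(ℝ, E) p).symm y)
      (t.symmL ℝ ((extChartAt 𝓘(ℝ, E) p).symm y) u) (t.symmL ℝ ((extChartAt 𝓘(ℝ, E) p).symm y) w))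
      (extChartAt 𝓘(ℝ, E) p).target :=
    fun y hy => g.contMDiffWithinAt_inner (hconst u y hy) (hconst w y hy)
  refine h1.contDiffOn.congr fun y hy => ?_
  have h3 := symmL_trivializationAt_tangentSpace (hsrc y hy)
  rw [(extChartAt 𝓘(ℝ, E) p).right_inv hy] at h3
  rw [h3]
  rfl

/-- A vector field read in the chart at `p`; only the values on the target of the chart are
meaningful. -/
noncomputable def fieldRep (X : ∀ x : M, TangentSpace 𝓘(ℝ, E) x) (p : M) (y : E) : E :=
  mfderiv 𝓘(ℝ, E) 𝓘(ℝ, E) (extChartAt 𝓘(ℝ, E) p) ((extChartAt 𝓘(ℝ, E) p).symm y)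
    (X ((extChartAt 𝓘(ℝ, E) p).symm y))

theorem fieldRep_extChartAt (X : ∀ x : M, TangentSpace 𝓘(ℝ, E) x) {p x : M}
    (hx : x ∈ (chartAt E p).source) : fieldRep X p (extChartAt 𝓘(ℝ, E) p x) =
      mfderiv 𝓘(ℝ, E) 𝓘(ℝ, E) (extChartAt 𝓘(ℝ, E) p) x (X x) := by
  rw [fieldRep, (extChartAt 𝓘(ℝ, E) p).left_inv (by rw [extChartAt_source]; exact hx)]

theorem contDiffOn_fieldRep (X : Cₛ^∞⟮𝓘(ℝ, E); E, fun x : M => TangentSpace 𝓘(ℝ, E) x⟯) (p : M) :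
    ContDiffOn ℝ ∞ (fieldRep X p) (extChartAt 𝓘(ℝ, E) p).target := by
  set t := trivializationAt E (TangentSpace 𝓘(ℝ, E)) p
  have h1 : ContMDiffOn 𝓘(ℝ, E) 𝓘(ℝ, E) ∞ (fun x => (t ⟨x, X x⟩).2)
      t.baseSet := (t.contMDiffOn_section_baseSet_iff).1 X.contMDiff.contMDiffOn
  have hsrc : ∀ y ∈ (extChartAt 𝓘(ℝ, E) p).target,
      (extChartAt 𝓘(ℝ, E) p).symm y ∈ (chartAt E p).source := fun y hy => by
    rw [← extChartAt_source 𝓘(ℝ, E)]; exact (extChartAt 𝓘(ℝ, E) p).map_target hy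
  have h2 := h1.comp (contMDiffOn_extChartAt_symm (I := 𝓘(ℝ, E)) (n := ∞) p) hsrc
  refine h2.contDiffOn.congr fun y hy => ?_
  rw [fieldRep, ← TangentBundle.continuousLinearMapAt_trivializationAt (hsrc y hy)]
  exact (trivialization_snd (A := fun x : M => TangentSpace 𝓘(ℝ, E) x) (F := E) (hsrc y hy) _).symm

/-- The bracket at `p` with a vector field `Y` that is constant in the chart at `p`. The derivative
of this chart at `p` is the identity, because tangent spaces are read in the preferred charts. -/
theorem mlieBracket_eq_of_fieldRep_eq_const {X Y : ∀ x : M, TangentSpace 𝓘(ℝ, E) x} {p : M} {v : E}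
    (hY : fieldRep Y p =ᶠ[𝓝 (extChartAt 𝓘(ℝ, E) p p)] fun _ => v) :
    VectorField.mlieBracket 𝓘(ℝ, E) X Y p =
      - fderiv ℝ (fieldRep X p) (extChartAt 𝓘(ℝ, E) p p) v := by
  have hpull : ∀ X : ∀ x : M, TangentSpace 𝓘(ℝ, E) x,
      VectorField.mpullbackWithin 𝓘(ℝ, E) 𝓘(ℝ, E) (extChartAt 𝓘(ℝ, E) p).symm X univ
        =ᶠ[𝓝 (extChartAt 𝓘(ℝ, E) p p)] fieldRep X p := by
    intro X
    filter_upwards [extChartAt_target_mem_nhds (I := 𝓘(ℝ, E)) p] with y hy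
    have hsrc : (extChartAt 𝓘(ℝ, E) p).symm y ∈ (extChartAt 𝓘(ℝ, E) p).source :=
      (extChartAt 𝓘(ℝ, E) p).map_target hy
    have hinv := isInvertible_mfderivWithin_extChartAt_symm (I := 𝓘(ℝ, E)) hy
    rw [ModelWithCorners.Boundaryless.range_eq_univ] at hinv
    have h1 := mfderivWithin_extChartAt_symm_comp_mfderiv_extChartAt (I := 𝓘(ℝ, E)) hy
    rw [ModelWithCorners.Boundaryless.range_eq_univ] at h1
    have h2 := DFunLike.congr_fun h1 (X ((extChartAt 𝓘(ℝ, E) p).symm y))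
    obtain ⟨e, he⟩ := hinv
    rw [VectorField.mpullbackWithin_apply, ← he, ContinuousLinearMap.inverse_equiv]
    rw [← he] at h2
    exact (e.symm_apply_eq).2 h2.symm
  have hset : (extChartAt 𝓘(ℝ, E) p).symm ⁻¹' univ ∩ range 𝓘(ℝ, E) = univ := by
    rw [ModelWithCorners.Boundaryless.range_eq_univ, preimage_univ, univ_inter]
  have h0 : VectorField.mlieBracket 𝓘(ℝ, E) X Y p =
      (mfderiv 𝓘(ℝ, E) 𝓘(ℝ, E) (extChartAt 𝓘(ℝ, E) p) p).inverse
        (VectorField.lieBracketWithin ℝ (E := E)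
          (VectorField.mpullbackWithin 𝓘(ℝ, E) 𝓘(ℝ, E) (extChartAt 𝓘(ℝ, E) p).symm X
            (range 𝓘(ℝ, E)))
          (VectorField.mpullbackWithin 𝓘(ℝ, E) 𝓘(ℝ, E) (extChartAt 𝓘(ℝ, E) p).symm Y
            (range 𝓘(ℝ, E)))
          ((extChartAt 𝓘(ℝ, E) p).symm ⁻¹' univ ∩ range 𝓘(ℝ, E)) (extChartAt 𝓘(ℝ, E) p p) : E) :=
    rfl
  have h1 := Filter.EventuallyEq.lieBracket_vectorField_eq (𝕜 := ℝ) (hpull X) ((hpull Y).trans hY)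
  rw [hset, ModelWithCorners.Boundaryless.range_eq_univ] at h0
  have hinv : ∀ L : E →L[ℝ] E, L = ContinuousLinearMap.id ℝ E → ∀ w, L.inverse w = w := by
    rintro _ rfl w
    rw [ContinuousLinearMap.inverse_id]
    rfl
  refine h0.trans ((hinv _ mfderiv_extChartAt_self _).trans
    ((congrFun (VectorField.lieBracketWithin_univ (𝕜 := ℝ)) (extChartAt 𝓘(ℝ, E) p p)).trans
      (h1.trans ?_)))
  rw [VectorField.lieBracket_eq]
  simp

theorem mfderiv_extChartAt_self_apply (p : M) (v : TangentSpace 𝓘(ℝ, E) p) :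
    mfderiv 𝓘(ℝ, E) 𝓘(ℝ, E) (extChartAt 𝓘(ℝ, E) p) p v = v := by
  rw [mfderiv_extChartAt_self]
  rfl

theorem fieldRep_self (X : ∀ x : M, TangentSpace 𝓘(ℝ, E) x) (p : M) :
    fieldRep X p (extChartAt 𝓘(ℝ, E) p p) = X p :=
  (fieldRep_extChartAt X (mem_chart_source E p)).trans (mfderiv_extChartAt_self_apply p (X p))

theorem chartMetric_self (p : M) (v w : TangentSpace 𝓘(ℝ, E) p) :
    chartMetric g p (extChartAt 𝓘(ℝ, E) p p) v w = g.inner p v w := by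
  refine Eq.trans ?_ (chartMetric_apply g (mem_chart_source E p) v w)
  rw [mfderiv_extChartAt_self_apply, mfderiv_extChartAt_self_apply]

/-- A constant vector field in the chart extends to a global vector field. -/
theorem exists_fieldRep_eq_const [FiniteDimensional ℝ E] [T2Space M] (p : M) (v : E) :
    ∃ X : Cₛ^∞⟮𝓘(ℝ, E); E, fun x : M => TangentSpace 𝓘(ℝ, E) x⟯,
      fieldRep X p =ᶠ[𝓝 (extChartAt 𝓘(ℝ, E) p p)] fun _ => v := by
  obtain ⟨S, hS⟩ := exists_frame E E (fun x : M => TangentSpace 𝓘(ℝ, E) x) p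
  refine ⟨S v, ?_⟩
  have hcont : Filter.Tendsto (extChartAt 𝓘(ℝ, E) p).symm (𝓝 (extChartAt 𝓘(ℝ, E) p p)) (𝓝 p) := by
    have := continuousAt_extChartAt_symm (I := 𝓘(ℝ, E)) p
    rwa [ContinuousAt, extChartAt_to_inv] at this
  filter_upwards [hcont.eventually hS,
    hcont.eventually ((chartAt E p).open_source.mem_nhds (mem_chart_source E p))] with y hy hsrc
  rw [fieldRep, hy v, ← TangentBundle.continuousLinearMapAt_trivializationAt hsrc]
  exact Bundle.Trivialization.continuousLinearMapAt_symmL _ hsrc v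

theorem hasFDerivAt_chartMetric [FiniteDimensional ℝ E] [T2Space M] {p : M} {y : E}
    (hy : y ∈ (extChartAt 𝓘(ℝ, E) p).target) :
    HasFDerivAt (chartMetric g p) (fderiv ℝ (chartMetric g p) y) y :=
  (((contDiffOn_chartMetric g p).contDiffAt ((isOpen_extChartAt_target p).mem_nhds
    hy)).differentiableAt (by simp)).hasFDerivAt

theorem differentiableAt_chartMetric_apply [FiniteDimensional ℝ E] [T2Space M] {p : M} {y : E}
    (hy : y ∈ (extChartAt 𝓘(ℝ, E) p).target) (v w : E) :
    DifferentiableAt ℝ (fun y => chartMetric g p y v w) y :=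
  (((hasFDerivAt_chartMetric g hy).clm_apply (hasFDerivAt_const v _)).clm_apply
    (hasFDerivAt_const w _)).differentiableAt

theorem fderiv_chartMetric_apply [FiniteDimensional ℝ E] [T2Space M] {p : M} {y : E}
    (hy : y ∈ (extChartAt 𝓘(ℝ, E) p).target) (v w u : E) :
    fderiv ℝ (fun y => chartMetric g p y v w) y u = fderiv ℝ (chartMetric g p) y u v w := by
  rw [(((hasFDerivAt_chartMetric g hy).clm_apply (hasFDerivAt_const v _)).clm_apply
    (hasFDerivAt_const w _)).fderiv]
  simp

theorem hasDerivAt_comp_of_hasFDerivAt {V : Type*} [NormedAddCommGroup V] [NormedSpace ℝ V]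
    {G : E → V} {G' : E →L[ℝ] V} {c : ℝ → E} {c' : E} {t : ℝ} (hG : HasFDerivAt G G' (c t))
    (hc : HasDerivAt c c' t) : HasDerivAt (fun τ => G (c τ)) (G' c') t :=
  hG.comp_hasDerivAt t hc

/-- Product rule for a variable bilinear form along a curve. -/
theorem hasDerivAt_bilin_comp {G : E → E →L[ℝ] E →L[ℝ] ℝ} {G' : E →L[ℝ] E →L[ℝ] E →L[ℝ] ℝ}
    {c u w : ℝ → E} {c' u' w' : E} {t : ℝ} (hG : HasFDerivAt G G' (c t)) (hc : HasDerivAt c c' t)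
    (hu : HasDerivAt u u' t) (hw : HasDerivAt w w' t) :
    HasDerivAt (fun τ => G (c τ) (u τ) (w τ))
      (G' c' (u t) (w t) + G (c t) u' (w t) + G (c t) (u t) w') t := by
  have h1 : HasDerivAt (fun τ => G (c τ)) (G' c') t :=
    hasDerivAt_comp_of_hasFDerivAt (V := E →L[ℝ] E →L[ℝ] ℝ) (G := G) (G' := G') hG hc
  have h2 : HasDerivAt (fun τ => G (c τ) (u τ)) (G' c' (u t) + G (c t) u') t := h1.clm_apply hu
  have h3 : HasDerivAt (fun τ => G (c τ) (u τ) (w τ))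
      ((G' c' (u t) + G (c t) u') (w t) + G (c t) (u t) w') t := h2.clm_apply hw
  exact h3

theorem hasDerivAt_chartMetric_comp [FiniteDimensional ℝ E] [T2Space M] {p : M} {c u w : ℝ → E}
    {c' u' w' : E} {t : ℝ} (ht : c t ∈ (extChartAt 𝓘(ℝ, E) p).target) (hc : HasDerivAt c c' t)
    (hu : HasDerivAt u u' t) (hw : HasDerivAt w w' t) :
    HasDerivAt (fun τ => chartMetric g p (c τ) (u τ) (w τ))
      (fderiv ℝ (chartMetric g p) (c t) c' (u t) (w t) + chartMetric g p (c t) u' (w t)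
        + chartMetric g p (c t) (u t) w') t :=
  hasDerivAt_bilin_comp (hasFDerivAt_chartMetric g ht) hc hu hw

end ChartMetric

/-! ### Geodesics and the connection of a Killing Lie algebroid -/

section Killing

variable {E : Type*} [NormedAddCommGroup E] [NormedSpace ℝ E] [FiniteDimensional ℝ E]
  {M : Type*} [TopologicalSpace M] [T2Space M] [ChartedSpace E M] [IsManifold 𝓘(ℝ, E) ∞ M]
  {F : Type*} [NormedAddCommGroup F] [NormedSpace ℝ F]
  {A : M → Type*} [TopologicalSpace (TotalSpace F A)]
  [∀ x, AddCommGroup (A x)] [∀ x, Module ℝ (A x)] [∀ x, TopologicalSpace (A x)]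
  [∀ x, IsTopologicalAddGroup (A x)] [∀ x, ContinuousSMul ℝ (A x)]
  [FiberBundle F A] [VectorBundle ℝ F A] [ContMDiffVectorBundle ∞ F A 𝓘(ℝ, E)]

variable {𝒜 : LieAlgebroid E F A} {nabla : CovariantDerivative 𝓘(ℝ, E) F A}
  {g : ContMDiffRiemannianMetric 𝓘(ℝ, E) ∞ E (fun x : M => TangentSpace 𝓘(ℝ, E) x)}

/-- The Killing equation in the chart at `p`, evaluated at `p` on the constant field `v`. -/
theorem LieAlgebroid.IsKilling.fderiv_chartMetric (h : 𝒜.IsKilling nabla g)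
    (s : Cₛ^∞⟮𝓘(ℝ, E); F, A⟯) (p : M) (v : E) :
    fderiv ℝ (chartMetric g p) (extChartAt 𝓘(ℝ, E) p p) (𝒜.anchor p (s p)) v v =
      2 * (g.inner p (𝒜.anchor p (nabla (fun y => s y) p v)) v
        - chartMetric g p (extChartAt 𝓘(ℝ, E) p p)
          (fderiv ℝ (fieldRep (fun x => 𝒜.anchor x (s x)) p) (extChartAt 𝓘(ℝ, E) p p) v) v) := by
  obtain ⟨V, hV⟩ := exists_fieldRep_eq_const p v
  have hVp : V p = v := (fieldRep_self V p).symm.trans hV.self_of_nhds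
  have htarget := mem_extChartAt_target (I := 𝓘(ℝ, E)) p
  have hcoord : (fun y => g.inner y (V y) (V y)) =ᶠ[𝓝 p]
      (fun y => chartMetric g p y v v) ∘ extChartAt 𝓘(ℝ, E) p := by
    filter_upwards [(continuousAt_extChartAt (I := 𝓘(ℝ, E)) p).eventually hV,
      (chartAt E p).open_source.mem_nhds (mem_chart_source E p)] with z hz hsrc
    rw [fieldRep_extChartAt _ hsrc] at hz
    rw [← chartMetric_apply g hsrc, hz]
    rfl
  have h1 := h s V V p
  have h2 := mvfderiv_eq_of_eventuallyEq_comp_extChartAt (mem_chart_source E p)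
    (differentiableAt_chartMetric_apply g htarget v v) hcoord (𝒜.anchor p (s p))
  have h3 : fderiv ℝ (fun y => chartMetric g p y v v) (extChartAt 𝓘(ℝ, E) p p)
      (mfderiv 𝓘(ℝ, E) 𝓘(ℝ, E) (extChartAt 𝓘(ℝ, E) p) p (𝒜.anchor p (s p))) =
        fderiv ℝ (chartMetric g p) (extChartAt 𝓘(ℝ, E) p p) (𝒜.anchor p (s p)) v v :=
    (fderiv_chartMetric_apply g htarget v v _).trans
      (congrArg (fun u : E => fderiv ℝ (chartMetric g p) (extChartAt 𝓘(ℝ, E) p p) u v v)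
        (mfderiv_extChartAt_self_apply p _))
  have h4 : g.inner p (𝒜.tauConn nabla s V p) v =
      g.inner p (𝒜.anchor p (nabla (fun y => s y) p v)) v
        - chartMetric g p (extChartAt 𝓘(ℝ, E) p p)
          (fderiv ℝ (fieldRep (fun x => 𝒜.anchor x (s x)) p) (extChartAt 𝓘(ℝ, E) p p) v) v := by
    have hadd : ∀ u₁ u₂ : TangentSpace 𝓘(ℝ, E) p,
        g.inner p (u₁ + u₂) v = g.inner p u₁ v + g.inner p u₂ v := fun u₁ u₂ =>
      congrArg (fun f : E →L[ℝ] ℝ => f v) (map_add (g.inner p) u₁ u₂)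
    have hV' : g.inner p (𝒜.anchor p (nabla (fun y => s y) p (V p))) v =
        g.inner p (𝒜.anchor p (nabla (fun y => s y) p v)) v :=
      congrArg (fun u : TangentSpace 𝓘(ℝ, E) p =>
        g.inner p (𝒜.anchor p (nabla (fun y => s y) p u)) v) hVp
    refine (hadd _ _).trans ?_
    have h5 := mlieBracket_eq_of_fieldRep_eq_const (X := fun x => 𝒜.anchor x (s x)) hV
    have h6 := chartMetric_self g p (VectorField.mlieBracket 𝓘(ℝ, E) (fun x => 𝒜.anchor x (s x))
      (fun x => V x) p) v
    have h7 : chartMetric g p (extChartAt 𝓘(ℝ, E) p p)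
        (VectorField.mlieBracket 𝓘(ℝ, E) (fun x => 𝒜.anchor x (s x)) (fun x => V x) p) v =
        - chartMetric g p (extChartAt 𝓘(ℝ, E) p p)
          (fderiv ℝ (fieldRep (fun x => 𝒜.anchor x (s x)) p) (extChartAt 𝓘(ℝ, E) p p) v) v := by
      refine (congrArg (fun u : E => chartMetric g p (extChartAt 𝓘(ℝ, E) p p) u v) h5).trans ?_
      simp only [map_neg, neg_apply]
    refine (congrArg₂ (· + ·) (h6.symm.trans h7) hV').trans ?_
    ring
  have h8 : g.inner p (𝒜.tauConn nabla s V p) (V p) = g.inner p (𝒜.tauConn nabla s V p) v :=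
    congrArg (fun u : TangentSpace 𝓘(ℝ, E) p => g.inner p (𝒜.tauConn nabla s V p) u) hVp
  refine h3.symm.trans (h2.symm.trans (h1.trans ?_))
  refine (congrArg₂ (· + ·) (h8.trans h4)
    ((g.symm p (V p) (𝒜.tauConn nabla s V p)).trans (h8.trans h4))).trans ?_
  ring

theorem hasDerivAt_extChartAt_comp {γ : ℝ → M} {t : ℝ} {p : M}
    (hγ : MDifferentiableAt 𝓘(ℝ, ℝ) 𝓘(ℝ, E) γ t) (hp : γ t ∈ (chartAt E p).source) :
    HasDerivAt (fun τ => extChartAt 𝓘(ℝ, E) p (γ τ))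
      (mfderiv 𝓘(ℝ, E) 𝓘(ℝ, E) (extChartAt 𝓘(ℝ, E) p) (γ t) (velocity γ t)) t := by
  have h1 : HasMFDerivAt 𝓘(ℝ, ℝ) 𝓘(ℝ, E) (fun τ => extChartAt 𝓘(ℝ, E) p (γ τ)) t _ :=
    HasMFDerivAt.comp t (mdifferentiableAt_extChartAt hp).hasMFDerivAt hγ.hasMFDerivAt
  have h2 : HasFDerivAt (fun τ => extChartAt 𝓘(ℝ, E) p (γ τ)) (_ : ℝ →L[ℝ] E) t := h1.hasFDerivAt
  exact h2.hasDerivAt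

/-- Along a geodesic `γ`, the derivative of `g(γ', ρ(s))` is `g(γ', ρ(∇_{γ'} s))`: in the chart at
`γ(t)`, the geodesic equation eliminates the second derivative of `γ`, and the Killing equation the
derivative of the metric in the direction `ρ(s)`. -/
theorem LieAlgebroid.IsKilling.hasDerivAt_inner (h : 𝒜.IsKilling nabla g) {γ : ℝ → M} {J : Set ℝ}
    (hJ : IsOpen J) (hγ : IsGeodesicOn g γ J) (s : Cₛ^∞⟮𝓘(ℝ, E); F, A⟯) {t : ℝ} (ht : t ∈ J) :
    HasDerivAt (fun τ => g.inner (γ τ) (velocity γ τ) (𝒜.anchor (γ τ) (s (γ τ))))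
      (g.inner (γ t) (velocity γ t)
        (𝒜.anchor (γ t) (nabla (fun y => s y) (γ t) (velocity γ t)))) t := by
  set p := γ t with hp
  have hmd : ∀ τ ∈ J, MDifferentiableAt 𝓘(ℝ, ℝ) 𝓘(ℝ, E) γ τ := fun τ hτ =>
    (hγ.1.contMDiffAt (hJ.mem_nhds hτ)).mdifferentiableAt (by simp)
  have hsrc : ∀ᶠ τ in 𝓝 t, γ τ ∈ (chartAt E p).source :=
    (hmd t ht).continuousAt ((chartAt E p).open_source.mem_nhds (mem_chart_source E p))
  let c : ℝ → E := fun τ => extChartAt 𝓘(ℝ, E) p (γ τ)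
  let r : E → E := fieldRep (fun x => 𝒜.anchor x (s x)) p
  have hvel : _root_.deriv c t = (velocity γ t : E) :=
    (hasDerivAt_extChartAt_comp (hmd t ht) (mem_chart_source E p)).deriv.trans
      (mfderiv_extChartAt_self_apply p (velocity γ t))
  have hc2 : ContDiffAt ℝ 2 c t := by
    have : ContMDiffAt 𝓘(ℝ, ℝ) 𝓘(ℝ, E) 2 c t :=
      ContMDiffAt.comp t ((contMDiffAt_extChartAt (I := 𝓘(ℝ, E)) (x := p) (n := 2)))
        (hγ.1.contMDiffAt (hJ.mem_nhds ht))
    exact this.contDiffAt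
  have hc1 : HasDerivAt c (_root_.deriv c t) t := (hc2.differentiableAt (by simp)).hasDerivAt
  have hc' : HasDerivAt (_root_.deriv c) (_root_.deriv (_root_.deriv c) t) t := by
    have : ContDiffAt ℝ 1 (_root_.deriv c) t := ContDiffAt.derivWithin hc2 (by norm_num)
    exact (this.differentiableAt (by simp)).hasDerivAt
  have hr : HasDerivAt (fun τ => r (c τ)) (fderiv ℝ r (c t) (_root_.deriv c t)) t :=
    HasFDerivAt.comp_hasDerivAt t (f := c) (((contDiffOn_fieldRep
      ⟨_, 𝒜.contMDiff_anchor_apply s⟩ p).contDiffAt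
      (extChartAt_target_mem_nhds p)).differentiableAt (by simp)).hasFDerivAt hc1
  have heq : (fun τ => g.inner (γ τ) (velocity γ τ) (𝒜.anchor (γ τ) (s (γ τ)))) =ᶠ[𝓝 t]
      fun τ => chartMetric g p (c τ) (_root_.deriv c τ) (r (c τ)) := by
    filter_upwards [hsrc, hJ.mem_nhds ht] with τ hτ hτJ
    refine (chartMetric_apply g hτ _ _).symm.trans ?_
    exact congrArg₂ (fun u w : E => chartMetric g p (c τ) u w)
      (hasDerivAt_extChartAt_comp (hmd τ hτJ) hτ).deriv.symm
      (fieldRep_extChartAt (fun x => 𝒜.anchor x (s x)) hτ).symm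
  have hmain := hasDerivAt_chartMetric_comp g (mem_extChartAt_target (I := 𝓘(ℝ, E)) p) hc1 hc' hr
  refine (hmain.congr_of_eventuallyEq heq).congr_deriv ?_
  have hrt : r (c t) = (𝒜.anchor p (s p) : E) := fieldRep_self (fun x => 𝒜.anchor x (s x)) p
  have hgeo := hγ.2 p t ht (mem_chart_source E p) (r (c t))
  have hkill := h.fderiv_chartMetric s p (_root_.deriv c t)
  rw [← hrt] at hkill
  have hgp : g.inner p (𝒜.anchor p (nabla (fun y => s y) p (_root_.deriv c t)))
      (_root_.deriv c t) = g.inner p (velocity γ t)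
        (𝒜.anchor p (nabla (fun y => s y) p (velocity γ t))) :=
    (congrArg (fun u : TangentSpace 𝓘(ℝ, E) p =>
      g.inner p (𝒜.anchor p (nabla (fun y => s y) p u)) u) hvel).trans (g.symm p _ _)
  have hsymm := chartMetric_symm g p (c t) (fderiv ℝ r (c t) (_root_.deriv c t))
    (_root_.deriv c t)
  refine Eq.trans ?_ hgp
  -- the geodesic equation, the Killing equation and the symmetry of the metric, in this order
  have key : ∀ a b d e f x : ℝ, a + (b + b - d) / 2 = 0 → d = 2 * (x - e) → e = f →
      b + a + f = x := by intros; linarith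
  exact key _ _ _ _ _ _ hgeo hkill hsymm

/-- The velocity field of a `C²` curve is `C¹`. -/
theorem contMDiffAt_velocity {γ : ℝ → M} {J : Set ℝ} (hJ : IsOpen J)
    (hγ : ContMDiffOn 𝓘(ℝ, ℝ) 𝓘(ℝ, E) 2 γ J) {t : ℝ} (ht : t ∈ J) :
    ContMDiffAt 𝓘(ℝ, ℝ) (𝓘(ℝ, E).prod 𝓘(ℝ, E)) 1
      (fun τ => TotalSpace.mk' E (E := fun x : M => TangentSpace 𝓘(ℝ, E) x) (γ τ) (velocity γ τ))
      t := by
  have h1 : ContMDiffOn 𝓘(ℝ, ℝ).tangent 𝓘(ℝ, E).tangent 1 (tangentMapWithin 𝓘(ℝ, ℝ) 𝓘(ℝ, E) γ J)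
      (π ℝ (TangentSpace 𝓘(ℝ, ℝ)) ⁻¹' J) :=
    hγ.contMDiffOn_tangentMapWithin (by norm_num) hJ.uniqueMDiffOn
  have h2 : ContMDiffOn 𝓘(ℝ, ℝ) 𝓘(ℝ, ℝ).tangent 1
      (fun τ : ℝ => (⟨τ, (1 : ℝ)⟩ : TangentBundle 𝓘(ℝ, ℝ) ℝ)) J :=
    contMDiffOn_vectorSpace_iff_contDiffOn.2 contDiffOn_const
  have h3 := h1.comp h2 (fun τ hτ => hτ)
  refine (h3.contMDiffAt (hJ.mem_nhds ht)).congr_of_eventuallyEq ?_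
  filter_upwards [hJ.mem_nhds ht] with τ hτ
  simp only [comp_apply, tangentMapWithin, mfderivWithin_of_isOpen hJ hτ]
  rfl

/-- A solution of a homogeneous linear differential equation that vanishes at one time vanishes
nearby. -/
theorem eventually_eq_zero_of_hasDerivAt_linear {ι : Type*} [Fintype ι] {θ : ℝ → ι → ℝ}
    {Ω : ℝ → ι → ι → ℝ} {t₀ : ℝ} (hΩ : ∀ i j, ContinuousAt (fun τ => Ω τ i j) t₀)
    (hθ : ∀ᶠ τ in 𝓝 t₀, ∀ i, HasDerivAt (fun τ => θ τ i) (∑ j, Ω τ i j * θ τ j) τ)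
    (h₀ : θ t₀ = 0) : ∀ᶠ τ in 𝓝 t₀, θ τ = 0 := by
  let V : ℝ → (ι → ℝ) → ι → ℝ := fun τ x i => ∑ j, Ω τ i j * x j
  let C : ι → ι → NNReal := fun i j => ‖Ω t₀ i j‖₊ + 1
  have hC : ∀ᶠ τ in 𝓝 t₀, ∀ i j, ‖Ω τ i j‖₊ ≤ C i j :=
    Filter.eventually_all.2 fun i => Filter.eventually_all.2 fun j =>
      ((hΩ i j).nnnorm.eventually_lt continuousAt_const (lt_add_one _)).mono fun τ hτ => hτ.le
  have hV : ∀ᶠ τ in 𝓝 t₀, LipschitzOnWith (∑ i, ∑ j, C i j) (V τ) univ := by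
    filter_upwards [hC] with τ hτ
    refine (LipschitzWith.of_dist_le_mul fun x y => ?_).lipschitzOnWith
    refine (dist_pi_le_iff (by positivity)).2 fun i => ?_
    calc dist (V τ x i) (V τ y i) = ‖∑ j, Ω τ i j * (x j - y j)‖ := by
          rw [dist_eq_norm, ← Finset.sum_sub_distrib]
          simp only [mul_sub]
      _ ≤ ∑ j, (C i j : ℝ) * dist x y := by
          refine (norm_sum_le _ _).trans (Finset.sum_le_sum fun j _ => ?_)
          rw [norm_mul]
          gcongr
          · exact_mod_cast hτ i j
          · exact (dist_eq_norm (x j) (y j)).symm.trans_le (dist_le_pi_dist x y j)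
      _ ≤ _ := by
          rw [← Finset.sum_mul]
          gcongr
          have := Finset.single_le_sum (f := fun i => ∑ j, C i j) (fun _ _ => zero_le)
            (Finset.mem_univ i)
          exact_mod_cast this
  have h1 : ∀ᶠ τ in 𝓝 t₀, HasDerivAt θ (V τ (θ τ)) τ ∧ θ τ ∈ univ :=
    hθ.mono fun τ hτ => ⟨hasDerivAt_pi.2 hτ, mem_univ _⟩
  have h2 : ∀ᶠ τ in 𝓝 t₀, HasDerivAt (fun _ : ℝ => (0 : ι → ℝ)) (V τ 0) τ ∧
      (0 : ι → ℝ) ∈ univ := Filter.Eventually.of_forall fun τ => by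
    refine ⟨?_, mem_univ _⟩
    have : V τ 0 = 0 := by ext i; simp [V]
    rw [this]
    exact hasDerivAt_const τ 0
  exact ODE_solution_unique_of_eventually hV h1 h2 h₀

/-- A geodesic that is orthogonal to the orbits at one time is so at all nearby times: the products
of its velocity with the vector fields `ρ(s)`, for `s` in a local frame, satisfy a homogeneous
linear differential equation. -/
theorem LieAlgebroid.IsKilling.eventually_inner_eq_zero [FiniteDimensional ℝ F]
    [CovariantDerivative.ContMDiffCovariantDerivative nabla ∞] (h : 𝒜.IsKilling nabla g)
    {γ : ℝ → M} {J : Set ℝ} (hJ : IsOpen J) (hγ : IsGeodesicOn g γ J) {t₀ : ℝ} (ht₀ : t₀ ∈ J)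
    (h₀ : ∀ a, g.inner (γ t₀) (velocity γ t₀) (𝒜.anchor (γ t₀) a) = 0) :
    ∀ᶠ τ in 𝓝 t₀, ∀ a, g.inner (γ τ) (velocity γ τ) (𝒜.anchor (γ τ) a) = 0 := by
  set p := γ t₀ with hp
  obtain ⟨S, hS⟩ := exists_frame E F A p
  let b := Module.finBasis ℝ F
  let e := trivializationAt F A p
  have hγc : ContinuousAt γ t₀ := (hγ.1.contMDiffAt (hJ.mem_nhds ht₀)).continuousAt
  have hbase : ∀ᶠ x in 𝓝 p, x ∈ e.baseSet :=
    e.open_baseSet.mem_nhds (FiberBundle.mem_baseSet_trivializationAt' p)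
  -- the products with the elements of the frame determine all the others
  have hexp : ∀ᶠ x in 𝓝 p, ∀ (v : TangentSpace 𝓘(ℝ, E) x) (a : A x),
      g.inner x v (𝒜.anchor x a) =
        ∑ j, b.repr (e ⟨x, a⟩).2 j * g.inner x v (𝒜.anchor x (S (b j) x)) := by
    filter_upwards [hS, hbase] with x hSx hx v a
    have ha : a = ∑ j, b.repr (e ⟨x, a⟩).2 j • S (b j) x := by
      conv_lhs => rw [← symmL_trivialization_snd hx a, ← b.sum_repr (e ⟨x, a⟩).2]
      rw [map_sum]
      exact Finset.sum_congr rfl fun j _ => by rw [map_smul, hSx]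
    conv_lhs => rw [ha]
    simp only [map_sum, map_smul, smul_eq_mul]
  let θ : ℝ → Fin (Module.finrank ℝ F) → ℝ := fun τ i =>
    g.inner (γ τ) (velocity γ τ) (𝒜.anchor (γ τ) (S (b i) (γ τ)))
  let Ω : ℝ → Fin (Module.finrank ℝ F) → Fin (Module.finrank ℝ F) → ℝ := fun τ i j =>
    b.repr (e ⟨γ τ, nabla (fun y => S (b i) y) (γ τ) (velocity γ τ)⟩).2 j
  have hΩ : ∀ i j, ContinuousAt (fun τ => Ω τ i j) t₀ := by
    intro i j
    have h1 : ContMDiff 𝓘(ℝ, E) (𝓘(ℝ, E).prod 𝓘(ℝ, E →L[ℝ] F)) ∞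
        (fun x => TotalSpace.mk' (E →L[ℝ] F) (E := fun x : M => TangentSpace 𝓘(ℝ, E) x →L[ℝ] A x)
          x (nabla (fun y => S (b i) y) x)) :=
      contMDiffOn_univ.1
        (CovariantDerivative.ContMDiffCovariantDerivative.contMDiff.contMDiff
          (S (b i)).contMDiff.contMDiffOn)
    have hγ1 : ContMDiffAt 𝓘(ℝ, ℝ) 𝓘(ℝ, E) 1 γ t₀ :=
      (hγ.1.contMDiffAt (hJ.mem_nhds ht₀)).of_le (by norm_num)
    have h1' := h1.of_le (m := 1) (by exact_mod_cast le_top)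
    have h2 := (h1'.contMDiffAt.comp t₀ hγ1).clm_bundle_apply (contMDiffAt_velocity hJ hγ.1 ht₀)
    have h3 := ((contMDiffAt_totalSpace).1 h2).2.continuousAt
    exact (b.coord j).toContinuousLinearMap.continuous.continuousAt.comp h3
  have hθ : ∀ᶠ τ in 𝓝 t₀, ∀ i, HasDerivAt (fun τ => θ τ i) (∑ j, Ω τ i j * θ τ j) τ := by
    filter_upwards [hγc.eventually hexp, hJ.mem_nhds ht₀] with τ hτ hτJ i
    rw [← hτ]
    exact h.hasDerivAt_inner hJ hγ (S (b i)) hτJ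
  have h0 : θ t₀ = 0 := funext fun i => h₀ _
  filter_upwards [hγc.eventually hexp, eventually_eq_zero_of_hasDerivAt_linear hΩ hθ h0]
    with τ hτ hzero a
  rw [hτ]
  exact Finset.sum_eq_zero fun j _ => mul_eq_zero_of_right _ (congrFun hzero j)

/-- The set of times at which a geodesic is orthogonal to the orbits is open and closed in its
domain. -/
theorem LieAlgebroid.IsKilling.isRiemannian_orbitFoliation [SecondCountableTopology M]
    [FiniteDimensional ℝ F]
    [CovariantDerivative.ContMDiffCovariantDerivative nabla ∞] (h : 𝒜.IsKilling nabla g) :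
    (orbitFoliation 𝒜).IsRiemannian g := by
  intro γ J hJ hconn hγ t₀ ht₀ h₀
  simp only [isOrthogonal_orbitFoliation_iff] at h₀ ⊢
  let Z : Set ℝ := {t | ∀ a, g.inner (γ t) (velocity γ t) (𝒜.anchor (γ t) a) = 0}
  suffices hZ : J ⊆ interior Z from fun t ht => interior_subset (hZ ht)
  have hopen : ∀ t ∈ J, t ∈ Z → t ∈ interior Z := fun t ht htZ =>
    mem_interior_iff_mem_nhds.2 (h.eventually_inner_eq_zero hJ hγ ht htZ)
  refine hconn.isPreconnected.subset_of_closure_inter_subset isOpen_interior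
    ⟨t₀, ht₀, hopen t₀ ht₀ h₀⟩ ?_
  rintro t ⟨htZ, htJ⟩
  refine hopen t htJ fun a => ?_
  obtain ⟨s, hs⟩ := exists_section_apply_eq (E := E) (F := F) a
  have hcont := (h.hasDerivAt_inner hJ hγ s htJ).continuousAt
  rw [← hs]
  by_contra hne
  obtain ⟨τ, hτ, hτZ⟩ := mem_closure_iff_nhds.1 htZ _ (hcont.eventually_ne hne)
  exact hτ (interior_subset hτZ _)

end Killing

/-! ### The induced metric on an immersed submanifold -/

/-- The unit ball of a positive definite form is bounded, because the form is bounded below on the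
compact unit sphere. -/
theorem isVonNBounded_of_pos {H : Type*} [NormedAddCommGroup H] [NormedSpace ℝ H]
    [FiniteDimensional ℝ H] (B : H →L[ℝ] H →L[ℝ] ℝ) (hB : ∀ v, v ≠ 0 → 0 < B v v) :
    Bornology.IsVonNBounded ℝ {v : H | B v v < 1} := by
  have hcont : Continuous fun v => B v v := B.continuous.clm_apply continuous_id
  obtain ⟨c, hc, hle⟩ := (isCompact_sphere (0 : H) 1).exists_forall_le' hcont.continuousOn
    (a := 0) fun v hv => hB v fun h0 => by simp [h0] at hv
  rw [NormedSpace.isVonNBounded_iff, isBounded_iff_forall_norm_le]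
  refine ⟨1 / c + 1, fun v hv => ?_⟩
  rcases eq_or_ne v 0 with rfl | hv0
  · rw [norm_zero]; positivity
  have hn : 0 < ‖v‖ := norm_pos_iff.2 hv0
  have h1 := hle (‖v‖⁻¹ • v) (by
    rw [mem_sphere_zero_iff_norm, norm_smul, norm_inv, norm_norm, inv_mul_cancel₀ hn.ne'])
  simp only [map_smul, smul_apply, smul_eq_mul] at h1
  have h2 : c * ‖v‖ ^ 2 < 1 := by
    have h3 : c * ‖v‖ ^ 2 ≤ B v v := by
      calc c * ‖v‖ ^ 2 ≤ (‖v‖⁻¹ * (‖v‖⁻¹ * B v v)) * ‖v‖ ^ 2 := by gcongr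
        _ = B v v := by field_simp
    exact h3.trans_lt hv
  have h4 : ‖v‖ ^ 2 < 1 / c := by rw [lt_div_iff₀ hc]; linarith
  nlinarith [sq_nonneg (‖v‖ - 1), sq_nonneg ‖v‖]

/-- Smoothness of a map with values in continuous linear maps on a finite-dimensional space can be
tested on vectors. -/
theorem contMDiffAt_clm_of_apply {H : Type*} [NormedAddCommGroup H] [NormedSpace ℝ H]
    [FiniteDimensional ℝ H] {V : Type*} [NormedAddCommGroup V] [NormedSpace ℝ V] {H' : Type*}
    [NormedAddCommGroup H'] [NormedSpace ℝ H'] {N : Type*} [TopologicalSpace N] [ChartedSpace H' N]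
    {f : N → H →L[ℝ] V} {x : N}
    (hf : ∀ u, ContMDiffAt 𝓘(ℝ, H') 𝓘(ℝ, V) ∞ (fun y => f y u) x) :
    ContMDiffAt 𝓘(ℝ, H') 𝓘(ℝ, H →L[ℝ] V) ∞ f x := by
  let b := Module.finBasis ℝ H
  let κ : Fin (Module.finrank ℝ H) → H →L[ℝ] ℝ := fun i => (b.coord i).toContinuousLinearMap
  have hexp : f = fun y => ∑ i, ContinuousLinearMap.smulRightL ℝ H V (κ i) (f y (b i)) := by
    funext y
    ext u
    conv_lhs => rw [← b.sum_repr u]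
    simp only [map_sum, map_smul, sum_apply]
    rfl
  rw [hexp]
  refine ContMDiffAt.sum fun i _ => ?_
  exact (ContinuousLinearMap.contMDiff
    (ContinuousLinearMap.smulRightL ℝ H V (κ i))).contMDiffAt.comp x (hf (b i))

section InducedMetric

variable {E : Type*} [NormedAddCommGroup E] [NormedSpace ℝ E]
  {M : Type*} [TopologicalSpace M] [ChartedSpace E M] [IsManifold 𝓘(ℝ, E) ∞ M]

/-- The pull-back of the scalar product `g` to the tangent space of an immersed submanifold. -/
noncomputable def inducedForm (N : ConnectedImmersedSubmanifold E M)
    (g : ContMDiffRiemannianMetric 𝓘(ℝ, E) ∞ E (fun x : M => TangentSpace 𝓘(ℝ, E) x))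
    (x : N.carrier) :
    EuclideanSpace ℝ (Fin N.dim) →L[ℝ] EuclideanSpace ℝ (Fin N.dim) →L[ℝ] ℝ :=
  let D : EuclideanSpace ℝ (Fin N.dim) →L[ℝ] E := mfderiv (𝓡 N.dim) 𝓘(ℝ, E) N.incl x
  let B : E →L[ℝ] E →L[ℝ] ℝ := g.inner (N.incl x)
  B.bilinearComp D D

theorem inducedForm_pos (N : ConnectedImmersedSubmanifold E M)
    (g : ContMDiffRiemannianMetric 𝓘(ℝ, E) ∞ E (fun x : M => TangentSpace 𝓘(ℝ, E) x))
    (x : N.carrier) (v : EuclideanSpace ℝ (Fin N.dim)) (hv : v ≠ 0) :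
    0 < inducedForm N g x v v :=
  g.pos (N.incl x) (mfderiv (𝓡 N.dim) 𝓘(ℝ, E) N.incl x v) fun h0 =>
    hv (N.injective_mfderiv_incl x (h0.trans (map_zero _).symm))

/-- The metric induced by `g` on an immersed submanifold. -/
noncomputable def inducedMetric (N : ConnectedImmersedSubmanifold E M)
    (g : ContMDiffRiemannianMetric 𝓘(ℝ, E) ∞ E (fun x : M => TangentSpace 𝓘(ℝ, E) x)) :
    ContMDiffRiemannianMetric (𝓡 N.dim) ∞ (EuclideanSpace ℝ (Fin N.dim))
      (fun x : N.carrier => TangentSpace (𝓡 N.dim) x) where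
  inner x := inducedForm N g x
  symm x v w := g.symm (N.incl x) _ _
  pos x v hv := inducedForm_pos N g x v hv
  isVonNBounded x := isVonNBounded_of_pos (inducedForm N g x) (inducedForm_pos N g x)
  contMDiff := by
    intro x₀
    refine (contMDiffAt_hom_bundle _).2 ⟨contMDiffAt_id, ?_⟩
    set t := trivializationAt (EuclideanSpace ℝ (Fin N.dim)) (TangentSpace (𝓡 N.dim)) x₀
    have hx₀ : t.baseSet ∈ 𝓝 x₀ :=
      t.open_baseSet.mem_nhds (FiberBundle.mem_baseSet_trivializationAt' x₀)
    have hT : ContMDiff (𝓡 N.dim).tangent 𝓘(ℝ, E).tangent ∞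
        (tangentMap (𝓡 N.dim) 𝓘(ℝ, E) N.incl) :=
      N.contMDiff_incl.contMDiff_tangentMap (by simp)
    have hu : ∀ u, ContMDiffAt (𝓡 N.dim) (𝓘(ℝ, E).prod 𝓘(ℝ, E)) ∞
        (fun x => TotalSpace.mk' E (E := fun x : M => TangentSpace 𝓘(ℝ, E) x) (N.incl x)
          (mfderiv (𝓡 N.dim) 𝓘(ℝ, E) N.incl x (t.symmL ℝ x u))) x₀ := fun u =>
      hT.contMDiffAt.comp x₀ ((contMDiffOn_symmL
        (A := fun x : N.carrier => TangentSpace (𝓡 N.dim) x) x₀ u).contMDiffAt hx₀)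
    refine contMDiffAt_clm_of_apply fun u => contMDiffAt_clm_of_apply fun w => ?_
    have h1 := g.contMDiffWithinAt_inner (s := univ) (hu u).contMDiffWithinAt
      (hu w).contMDiffWithinAt
    rw [contMDiffWithinAt_univ] at h1
    refine h1.congr_of_eventuallyEq ?_
    filter_upwards [hx₀] with x hx
    refine (inCoordinates_apply_eq₂ hx hx (mem_univ _)).trans ?_
    rw [Bundle.Trivialization.symmL_apply _ hx, Bundle.Trivialization.symmL_apply _ hx]
    simp
    rfl

theorem isInducedMetric_inducedMetric (N : ConnectedImmersedSubmanifold E M)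
    (g : ContMDiffRiemannianMetric 𝓘(ℝ, E) ∞ E (fun x : M => TangentSpace 𝓘(ℝ, E) x)) :
    IsInducedMetric N g (inducedMetric N g) :=
  fun _ _ _ => rfl

end InducedMetric

end KillingFoliation

theorem mainTheorem3
    {E : Type*} [NormedAddCommGroup E] [NormedSpace ℝ E] [FiniteDimensional ℝ E]
    {M : Type*} [TopologicalSpace M] [T2Space M] [SecondCountableTopology M]
    [ChartedSpace E M] [IsManifold 𝓘(ℝ, E) ∞ M]
    {F : Type*} [NormedAddCommGroup F] [NormedSpace ℝ F] [FiniteDimensional ℝ F]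
    {A : M → Type*} [TopologicalSpace (TotalSpace F A)]
    [∀ x, AddCommGroup (A x)] [∀ x, Module ℝ (A x)] [∀ x, TopologicalSpace (A x)]
    [∀ x, IsTopologicalAddGroup (A x)] [∀ x, ContinuousSMul ℝ (A x)]
    [FiberBundle F A] [VectorBundle ℝ F A] [ContMDiffVectorBundle ∞ F A 𝓘(ℝ, E)]
    (𝒜 : KillingFoliation.LieAlgebroid E F A)
    (nabla : CovariantDerivative 𝓘(ℝ, E) F A)
    [CovariantDerivative.ContMDiffCovariantDerivative nabla ∞]
    (g : ContMDiffRiemannianMetric 𝓘(ℝ, E) ∞ E (fun x : M => TangentSpace 𝓘(ℝ, E) x))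
    (hKilling : 𝒜.IsKilling nabla g) :
    ∃ 𝓕 : KillingFoliation.SingularFoliation E M,
      -- the leaves are the orbits of the Lie algebroid
      (∀ (i : 𝓕.Index) (x : (𝓕.leaf i).carrier),
        range (𝓕.leaf i).incl = 𝒜.orbit ((𝓕.leaf i).incl x)) ∧
      -- the tangent spaces of the leaves are the images of the anchor
      (∀ (i : 𝓕.Index) (x : (𝓕.leaf i).carrier),
        range (mfderiv (𝓡 (𝓕.leaf i).dim) 𝓘(ℝ, E) (𝓕.leaf i).incl x) =
          range (𝒜.anchor ((𝓕.leaf i).incl x))) ∧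
      -- the foliation is Riemannian
      𝓕.IsRiemannian g ∧
      -- every leaf carries the Riemannian metric induced by `g`
      (∀ i : 𝓕.Index, ∃ h, KillingFoliation.IsInducedMetric (𝓕.leaf i) g h) := by
  refine ⟨KillingFoliation.orbitFoliation 𝒜, fun i x => ?_,
    fun i x => KillingFoliation.Leaf.range_mfderiv_incl x,
    hKilling.isRiemannian_orbitFoliation,
    fun i => ⟨_, KillingFoliation.isInducedMetric_inducedMetric _ g⟩⟩
  exact (KillingFoliation.range_incl_leafSubmanifold _).trans
    (KillingFoliation.LieAlgebroid.orbit_eq_of_mem (p := KillingFoliation.orbitBase i) x.2).symm
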